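/- **Setting.** Let $N,d\ge 1$ and $d_Z\ge 0$ be integers; all spaces $\mathbb R^m$ below carry the max-norm $\|\cdot\|_{\max}$ where distances are measured. Let $U_t=(X_t,Z_t)\in\mathbb R^{d}\times\mathbb R^{d_Z}$, $t\ge 0$, be a time-homogeneous Markov chain with transition kernel $\wp$, and let $(\eta_t)_{t\ge0}$ be i.i.d. real random variables with law $\mu_\eta$, independent of $(U_t)_{t\ge 0}$. Assume that * $\mathrm{Wass}_2(\wp(u,\cdot),\wp(u',\cdot))\le L_\wp\|u-u'\|_{\max}$ for all $u,u'$, where $0\le L_\wp<1$ and $\mathrm{Wass}_2$ is the 2-Wasserstein distance for the max-norm; * $\|U_t\|_{\max}\le 1$ almost surely for every $t$; * $Y_t=f(X_t,Z_t,\eta_t)$, where $f$ is measurable, $|f|\le L_f$, and $|f(u,\eta)-f(u',\eta)|\le L_f\|u-u'\|_{\max}$ for all $u,u',\eta$. Let $\sigma(r)=1/(1+e^{-r})$, and let $\phi,\lambda:\mathbb R\to\mathbb R$ be twice continuously differentiable, each bounded together with its first two derivatives, with $|\phi|\le C_\phi$, $|\phi'|\le C_{\phi'}$, $|\phi''|\le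 C_{\phi''}$. Put $n=\min(N,d)$, $M_\phi=1+\frac{C_\phi}{4-C_\phi}$, $$L_0=\max\Big(\tfrac{3C_{\phi'}}{n}\big(\tfrac{C_\phi M_\phi}{10}+\tfrac14\big),\tfrac{3C_\phi}{4}\Big),\qquad L_2=\max\Big(\tfrac{C_{\phi''}}{n},\tfrac{C_{\phi'}^2}{Nd(4-C_\phi)}\Big),$$ $$L_1=\max\Big\{4\max\Big[\tfrac{M_\phi C_\phi^2}{5n^2}+\tfrac{C_\phi M_\phi^2C_{\phi'}^2}{8n^2}+\tfrac{C_{\phi''}}{4n}+\tfrac{C_\phi}{10}\Big(L_2+\tfrac{C_\phi}{1-C_\phi/4}\big(\tfrac{C_\phi^2M_\phi^2}{10n^2}+\tfrac14L_2\big)\Big),\ \tfrac{C_\phi M_\phi C_{\phi'}}{5n}+\tfrac{C_{\phi'}}{4N}\Big],\ C_\phi\Big\},$$ and assume $0<q:=\sqrt{\max(L_0,L_1)^2+L_\wp^2}<1$. **Network and loss.** The parameter is $\theta=(A,W,B,c)\in\Theta=\mathbb R^{N\times d}\times\mathbb R^{N\times N}\times\mathbb R^N\times\mathbb R$. Starting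 from a fixed $S_0\in\mathbb R^N$ (not depending on $\theta$), let $$S^k_{t+1}=\sigma\big(a_k(X_t,S_t)\big),\qquad a_k(x,s)=\tfrac1d\sum_{j=1}^d\phi(A^{kj})x^j+\tfrac1N\sum_{j=1}^N\phi(W^{kj})s^j,$$ $f_t(\theta)=\langle\lambda(B),S_t\rangle+\lambda(c)$ (with $\lambda$ applied entrywise), and $L_T(\theta)=\frac1{2T}\sum_{t=1}^T(Y_t-f_t(\theta))^2$. **Joint chain.** Let $p,q$ run over the entries of $A$ and $W$. The hidden state is $v=(s,\tilde s,\tilde{\tilde s})$ with components $s^k$, $\tilde s^{p,k}$, $\tilde{\tilde s}^{p,q,k}$ ($\tilde s$ and $\tilde{\tilde s}$ stand for the first and second derivatives of the memory with respect to the weights). For $\psi:\mathbb R\to\mathbb R$ let $D^{\psi}_{p,k}(x,s)=\frac1d\delta_{ik}\psi(A^{ij})x^j$ if $p=A^{ij}$, and $D^{\psi}_{p,k}(x,s)=\frac1N\delta_{ik}\psi(W^{ij})s^j$ if $p=W^{ij}$. Define $$a_{p,k}=D^{\phi'}_{p,k}(x,s)+\tfrac1N\sum_{\ell}\phi(W^{k\ell})\tilde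 s^{p,\ell},$$ $$a_{pq,k}=\delta_{pq}D^{\phi''}_{p,k}(x,s)+D^{\phi'}_{p,k}(0,\tilde s^{q,\cdot})+D^{\phi'}_{q,k}(0,\tilde s^{p,\cdot})+\tfrac1N\sum_\ell\phi(W^{k\ell})\tilde{\tilde s}^{p,q,\ell},$$ and let $F^\theta(u,v)$, for $u=(x,z)$, have the components $\sigma(a_k)$, $\ \sigma'(a_k)\,a_{p,k}$, $\ \sigma''(a_k)\,a_{p,k}\,a_{q,k}+\sigma'(a_k)\,a_{pq,k}$, where $a_k=a_k(x,s)$. The joint chain on the space of the states $h=(u,v,\eta)$ has the transition kernel $$P_\theta((u,v,\eta),\cdot)=\wp(u,\cdot)\otimes\delta_{F^\theta(u,v)}\otimes\mu_\eta.$$ For $h=(x,z,s,\tilde s,\tilde{\tilde s},\eta)$ let $r^\theta(h)=f(x,z,\eta)-\langle\lambda(B),s\rangle-\lambda(c)$. Let $\gamma^\theta(h)\in\mathbb R^{\dim\Theta}$ have the entries $\sum_k\lambda(B^k)\tilde s^{p,k}$ for a weight $p$, $\lambda'(B^i)s^i$ for $B^i$, and $\lambda'(c)$ for $c$. Let $\Gamma^\theta(h)$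 be the symmetric matrix with the entries $\sum_k\lambda(B^k)\tilde{\tilde s}^{p,q,k}$ at $(p,q)$, $\lambda'(B^i)\tilde s^{p,i}$ at $(p,B^i)$ and $(B^i,p)$, $\delta_{ij}\lambda''(B^i)s^i$ at $(B^i,B^j)$, $\lambda''(c)$ at $(c,c)$, and $0$ elsewhere. Put $$g^\theta(h)=-r^\theta(h)\,\gamma^\theta(h),\qquad \mathrm{he}^\theta(h)=\gamma^\theta(h)\gamma^\theta(h)^\top-r^\theta(h)\,\Gamma^\theta(h).$$ **Theorem.** For every $\theta\in\Theta$ the kernel $P_\theta$ has a unique stationary probability measure $\mu^\theta$; the limit $L(\theta)=\lim_{T\to\infty}\mathbb E[L_T(\theta)]$ exists and equals $\int\frac12 r^\theta(h)^2\,\mu^\theta(dh)$. The functions $\mathbb E[L_T(\cdot)]$ and $L$ are twice differentiable on $\Theta$; $g^\theta$ and $\mathrm{he}^\theta$ are $\mu^\theta$-integrable, and for every $\theta$ $$\nabla_\theta L(\theta)=\lim_{T\to\infty}\nabla_\theta\mathbb E[L_T(\theta)]=\int g^\theta\,d\mu^\theta,\qquad \mathrm{Hess}_\theta L(\theta)=\lim_{T\to\infty}\mathrm{Hess}_\theta\,\mathbb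 E[L_T(\theta)]=\int \mathrm{he}^\theta\,d\mu^\theta,$$ where both limits are uniform in $\theta\in\Theta$ (in the max-norm). Moreover there is a constant $C>0$ with $\|\nabla_\theta L(\theta)\|_{\max}\vee\|\mathrm{Hess}_\theta L(\theta)\|_{\max}\le C$ for all $\theta\in\Theta$. -/

import Mathlib

open MeasureTheory ProbabilityTheory Filter Topology
open scoped ENNReal

noncomputable section

namespace RTRL

/-! ### Wasserstein distance and Markov chains -/

/-- `γ` is a coupling of `μ` and `ν`. -/
def IsCoupling {E : Type*} [MeasurableSpace E] (γ : Measure (E × E)) (μ ν : Measure E) : Prop :=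
  γ.map Prod.fst = μ ∧ γ.map Prod.snd = ν

/-- The `p`-Wasserstein distance with respect to the norm of `E`, with values in `[0, ∞]`. -/
def wass {E : Type*} [NormedAddCommGroup E] [MeasurableSpace E] (p : ℝ) (μ ν : Measure E) :
    ℝ≥0∞ :=
  ⨅ (γ : Measure (E × E)) (_ : IsCoupling γ μ ν), (∫⁻ z, ‖z.1 - z.2‖ₑ ^ p ∂γ) ^ (1 / p)

/-- `U` is a time-homogeneous Markov chain with transition kernel `κ` under `P`: for every `t`, the
conditional law of `U (t + 1)` given the whole past `(U 0, …, U t)` is `κ (U t)`. -/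
def IsMarkovChain {Ω E : Type*} [MeasurableSpace Ω] [MeasurableSpace E]
    (U : ℕ → Ω → E) (κ : Kernel E E) (P : Measure Ω) : Prop :=
  ∀ t : ℕ, HasCondDistrib (U (t + 1)) (fun ω (i : Finset.Iic t) => U i ω)
    (κ.comap (fun u : Finset.Iic t → E => u ⟨t, Finset.mem_Iic.2 le_rfl⟩)
      (measurable_pi_apply _)) P

/-! ### Parameters, data and states

Products and function spaces carry the maximum norm. -/

/-- The space of the pairs `(x, z)`. -/
abbrev Data (d dZ : ℕ) : Type := (Fin d → ℝ) × (Fin dZ → ℝ)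

/-- Entries of the weight matrices: `Sum.inl (i, j)` is the entry `A i j`, and `Sum.inr (i, j)` is
the entry `W i j`. -/
abbrev WeightIdx (N d : ℕ) : Type := (Fin N × Fin d) ⊕ (Fin N × Fin N)

/-- Entries of the parameter `θ = (A, W, B, c)`. -/
abbrev ParamIdx (N d : ℕ) : Type := WeightIdx N d ⊕ (Fin N ⊕ Unit)

/-- The parameter space. -/
abbrev Param (N d : ℕ) : Type := EuclideanSpace ℝ (ParamIdx N d)

/-- The space of the triples `v = (s, s', s'')`: `s k` is the value of the memory unit `k`,
`s' p k` stands for its derivative with respect to the weight `p`, and `s'' p q k` for its second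
derivative with respect to the weights `p` and `q`. -/
abbrev Hidden (N d : ℕ) : Type :=
  (Fin N → ℝ) × (WeightIdx N d → Fin N → ℝ) × (WeightIdx N d → WeightIdx N d → Fin N → ℝ)

/-- The space of the states `h = (u, v, η)`, where `u = (x, z)`. -/
abbrev State (N d dZ : ℕ) : Type := Data d dZ × Hidden N d × ℝ

variable {N d dZ : ℕ}

/-- The matrix `A`. -/
def matA (θ : Param N d) (i : Fin N) (j : Fin d) : ℝ := θ (Sum.inl (Sum.inl (i, j)))

/-- The matrix `W`. -/
def matW (θ : Param N d) (i j : Fin N) : ℝ := θ (Sum.inl (Sum.inr (i, j)))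

/-- The vector `B`. -/
def vecB (θ : Param N d) (i : Fin N) : ℝ := θ (Sum.inr (Sum.inl i))

/-- The scalar `c`. -/
def scalC (θ : Param N d) : ℝ := θ (Sum.inr (Sum.inr ()))

/-! ### The recurrent network and its loss -/

/-- The argument of the sigmoid function in unit `k`. -/
def preact (φ : ℝ → ℝ) (θ : Param N d) (x : Fin d → ℝ) (s : Fin N → ℝ) (k : Fin N) : ℝ :=
  1 / (d : ℝ) * ∑ j, φ (matA θ k j) * x j + 1 / (N : ℝ) * ∑ l, φ (matW θ k l) * s l

/-- One step of the memory layer. -/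
def memStep (φ : ℝ → ℝ) (θ : Param N d) (x : Fin d → ℝ) (s : Fin N → ℝ) : Fin N → ℝ :=
  fun k => Real.sigmoid (preact φ θ x s k)

/-- The memory layer at time `t`, with input sequence `x` and initial value `s₀`. -/
def memory (φ : ℝ → ℝ) (θ : Param N d) (s₀ : Fin N → ℝ) (x : ℕ → Fin d → ℝ) : ℕ → Fin N → ℝ
  | 0 => s₀
  | t + 1 => memStep φ θ (x t) (memory φ θ s₀ x t)

/-- The output of the network with memory `s`. -/
def output (lam : ℝ → ℝ) (θ : Param N d) (s : Fin N → ℝ) : ℝ :=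
  ∑ i, lam (vecB θ i) * s i + lam (scalC θ)

/-- The loss `L_T(θ)` for the input sequence `x` and the output sequence `y`. -/
def empLoss (φ lam : ℝ → ℝ) (s₀ : Fin N → ℝ) (x : ℕ → Fin d → ℝ) (y : ℕ → ℝ) (T : ℕ)
    (θ : Param N d) : ℝ :=
  1 / (2 * (T : ℝ)) *
    ∑ t ∈ Finset.Icc 1 T, (y t - output lam θ (memory φ θ s₀ x t)) ^ 2

/-- The expected loss `𝔼[L_T(θ)]`, for the data `(X_t, Z_t) = U t` and `Y_t = f (U t) (η t)`. -/
def expLoss {Ω : Type*} [MeasurableSpace Ω] (P : Measure Ω) (U : ℕ → Ω → Data d dZ)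
    (η : ℕ → Ω → ℝ) (f : Data d dZ → ℝ → ℝ) (φ lam : ℝ → ℝ) (s₀ : Fin N → ℝ) (T : ℕ)
    (θ : Param N d) : ℝ :=
  ∫ ω, empLoss φ lam s₀ (fun t => (U t ω).1) (fun t => f (U t ω) (η t ω)) T θ ∂P

/-! ### The joint chain of the data, the memory layer and its derivatives -/

/-- With `ψ = φ'`, the partial derivative of `preact φ θ x s k` with respect to the weight `p` at
fixed `x` and `s`; with `ψ = φ''`, its second partial derivative with respect to `p`. -/
def direct (ψ : ℝ → ℝ) (θ : Param N d) (p : WeightIdx N d) (x : Fin d → ℝ) (s : Fin N → ℝ)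
    (k : Fin N) : ℝ :=
  match p with
  | Sum.inl (i, j) => if i = k then 1 / (d : ℝ) * (ψ (matA θ i j) * x j) else 0
  | Sum.inr (i, j) => if i = k then 1 / (N : ℝ) * (ψ (matW θ i j) * s j) else 0

/-- The derivative of the argument of the sigmoid function in unit `k` with respect to the weight
`p`, by the chain rule. -/
def preact₁ (φ : ℝ → ℝ) (θ : Param N d) (x : Fin d → ℝ) (v : Hidden N d) (p : WeightIdx N d)
    (k : Fin N) : ℝ :=
  direct (deriv φ) θ p x v.1 k + 1 / (N : ℝ) * ∑ l, φ (matW θ k l) * v.2.1 p l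

/-- The second derivative of the argument of the sigmoid function in unit `k` with respect to the
weights `p` and `q`, by the chain rule. The second and third terms come from the factors
`φ (W k m)` that multiply the memory; they vanish if `p`, respectively `q`, is an entry of `A`. -/
def preact₂ (φ : ℝ → ℝ) (θ : Param N d) (x : Fin d → ℝ) (v : Hidden N d)
    (p q : WeightIdx N d) (k : Fin N) : ℝ :=
  (if p = q then direct (deriv (deriv φ)) θ p x v.1 k else 0)
    + direct (deriv φ) θ p 0 (v.2.1 q) k + direct (deriv φ) θ q 0 (v.2.1 p) k
    + 1 / (N : ℝ) * ∑ l, φ (matW θ k l) * v.2.2 p q l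

/-- The update `F^θ(u, v)` of the memory layer and of its first and second derivatives with respect
to the weights (it depends on `u = (x, z)` through `x` only). -/
def hiddenStep (φ : ℝ → ℝ) (θ : Param N d) (x : Fin d → ℝ) (v : Hidden N d) : Hidden N d :=
  (memStep φ θ x v.1,
    fun p k => deriv Real.sigmoid (preact φ θ x v.1 k) * preact₁ φ θ x v p k,
    fun p q k =>
      deriv (deriv Real.sigmoid) (preact φ θ x v.1 k) * preact₁ φ θ x v p k * preact₁ φ θ x v q k
        + deriv Real.sigmoid (preact φ θ x v.1 k) * preact₂ φ θ x v p q k)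

@[fun_prop]
theorem measurable_preact (φ : ℝ → ℝ) (θ : Param N d) (k : Fin N) :
    Measurable fun h : State N d dZ => preact φ θ h.1.1 h.2.1.1 k := by
  unfold preact; fun_prop

theorem measurable_hiddenStep (φ : ℝ → ℝ) (θ : Param N d) :
    Measurable fun h : State N d dZ => hiddenStep φ θ h.1.1 h.2.1 := by
  have h0 : ∀ (ψ : ℝ → ℝ) (p : WeightIdx N d) (k : Fin N),
      Measurable fun h : State N d dZ => direct ψ θ p h.1.1 h.2.1.1 k := by
    rintro ψ (⟨i, j⟩ | ⟨i, j⟩) k <;> by_cases hik : i = k <;> simp only [direct, hik, if_true,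
      if_false] <;> fun_prop
  have h1 : ∀ (ψ : ℝ → ℝ) (p q : WeightIdx N d) (k : Fin N),
      Measurable fun h : State N d dZ => direct ψ θ p 0 (h.2.1.2.1 q) k := by
    rintro ψ (⟨i, j⟩ | ⟨i, j⟩) q k <;> by_cases hik : i = k <;> simp only [direct, hik, if_true,
      if_false] <;> fun_prop
  have h2 : ∀ (p : WeightIdx N d) (k : Fin N),
      Measurable fun h : State N d dZ => preact₁ φ θ h.1.1 h.2.1 p k := by
    intro p k
    unfold preact₁
    exact (h0 _ p k).add (by fun_prop)
  have h3 : ∀ (p q : WeightIdx N d) (k : Fin N),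
      Measurable fun h : State N d dZ => preact₂ φ θ h.1.1 h.2.1 p q k := by
    intro p q k
    unfold preact₂
    refine (((?_ : Measurable _).add (h1 _ p q k)).add (h1 _ q p k)).add (by fun_prop)
    by_cases hpq : p = q
    · simpa only [hpq, if_true] using h0 _ q k
    · simp only [hpq, if_false]; fun_prop
  have hd1 : Measurable (deriv Real.sigmoid) := measurable_deriv _
  have hd2 : Measurable (deriv (deriv Real.sigmoid)) := measurable_deriv _
  have hs : Measurable Real.sigmoid := by
    unfold Real.sigmoid; fun_prop
  unfold hiddenStep memStep
  refine Measurable.prodMk ?_ (Measurable.prodMk ?_ ?_)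
  · exact measurable_pi_lambda _ fun k => hs.comp (measurable_preact φ θ k)
  · exact measurable_pi_lambda _ fun p => measurable_pi_lambda _ fun k =>
      (hd1.comp (measurable_preact φ θ k)).mul (h2 p k)
  · exact measurable_pi_lambda _ fun p => measurable_pi_lambda _ fun q =>
      measurable_pi_lambda _ fun k =>
        (((hd2.comp (measurable_preact φ θ k)).mul (h2 p k)).mul (h2 q k)).add
          ((hd1.comp (measurable_preact φ θ k)).mul (h3 p q k))

/-- The transition kernel `P_θ((u, v, η), ·) = κ(u, ·) ⊗ δ_{F^θ(u, v)} ⊗ μη` of the joint chain. -/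
def jointKernel (φ : ℝ → ℝ) (κ : Kernel (Data d dZ) (Data d dZ)) (μη : Measure ℝ)
    (θ : Param N d) : Kernel (State N d dZ) (State N d dZ) :=
  (κ.comap Prod.fst measurable_fst) ×ₖ
    ((Kernel.deterministic (fun h : State N d dZ => hiddenStep φ θ h.1.1 h.2.1)
        (measurable_hiddenStep φ θ)) ×ₖ
      Kernel.const (State N d dZ) μη)

/-- `μ` is the unique stationary probability measure of the joint chain with parameter `θ`. -/
def IsUniqueStationary (φ : ℝ → ℝ) (κ : Kernel (Data d dZ) (Data d dZ)) (μη : Measure ℝ)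
    (θ : Param N d) (μ : Measure (State N d dZ)) : Prop :=
  IsProbabilityMeasure μ ∧ (jointKernel φ κ μη θ).Invariant μ ∧
    ∀ ν : Measure (State N d dZ), IsProbabilityMeasure ν →
      (jointKernel φ κ μη θ).Invariant ν → ν = μ

/-! ### The integrands -/

/-- The residual `f(x, z, η) - ⟨λ(B), s⟩ - λ(c)`. -/
def residual (f : Data d dZ → ℝ → ℝ) (lam : ℝ → ℝ) (θ : Param N d) (h : State N d dZ) : ℝ :=
  f h.1 h.2.2 - output lam θ h.2.1.1

/-- The integrand of the loss. -/
def lossFun (f : Data d dZ → ℝ → ℝ) (lam : ℝ → ℝ) (θ : Param N d) (h : State N d dZ) : ℝ :=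
  1 / 2 * residual f lam θ h ^ 2

/-- The gradient of the output of the network in terms of the forward derivatives. -/
def outGrad (lam : ℝ → ℝ) (θ : Param N d) (v : Hidden N d) : ParamIdx N d → ℝ
  | Sum.inl p => ∑ k, lam (vecB θ k) * v.2.1 p k
  | Sum.inr (Sum.inl i) => deriv lam (vecB θ i) * v.1 i
  | Sum.inr (Sum.inr _) => deriv lam (scalC θ)

/-- The Hessian of the output of the network in terms of the forward derivatives. -/
def outHess (lam : ℝ → ℝ) (θ : Param N d) (v : Hidden N d) :
    Matrix (ParamIdx N d) (ParamIdx N d) ℝ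
  | Sum.inl p, Sum.inl q => ∑ k, lam (vecB θ k) * v.2.2 p q k
  | Sum.inl p, Sum.inr (Sum.inl i) => deriv lam (vecB θ i) * v.2.1 p i
  | Sum.inr (Sum.inl i), Sum.inl p => deriv lam (vecB θ i) * v.2.1 p i
  | Sum.inr (Sum.inl i), Sum.inr (Sum.inl j) =>
      if i = j then deriv (deriv lam) (vecB θ i) * v.1 i else 0
  | Sum.inr (Sum.inr _), Sum.inr (Sum.inr _) => deriv (deriv lam) (scalC θ)
  | _, _ => 0

/-- The function `g^θ`. -/
def gFun (f : Data d dZ → ℝ → ℝ) (lam : ℝ → ℝ) (θ : Param N d) (h : State N d dZ)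
    (a : ParamIdx N d) : ℝ :=
  -residual f lam θ h * outGrad lam θ h.2.1 a

/-- The function `he^θ`. -/
def heFun (f : Data d dZ → ℝ → ℝ) (lam : ℝ → ℝ) (θ : Param N d) (h : State N d dZ) :
    Matrix (ParamIdx N d) (ParamIdx N d) ℝ :=
  Matrix.vecMulVec (outGrad lam θ h.2.1) (outGrad lam θ h.2.1)
    - residual f lam θ h • outHess lam θ h.2.1

/-- `F` is twice (Fréchet) differentiable. -/
def TwiceDifferentiable (F : Param N d → ℝ) : Prop :=
  Differentiable ℝ F ∧ Differentiable ℝ (gradient F)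

/-- The Hessian matrix of `F`: the derivative of the gradient of `F`. -/
def hessian (F : Param N d → ℝ) (θ : Param N d) : Matrix (ParamIdx N d) (ParamIdx N d) ℝ :=
  Matrix.of fun a b => (fderiv ℝ (gradient F) θ (EuclideanSpace.single b 1)) a

/-! ### The constants of the smallness condition

`C0`, `C1`, `C2` are bounds of `|φ|`, `|φ'|`, `|φ''|`. -/

/-- `M_φ` -/
def constM (C0 : ℝ) : ℝ := 1 + C0 / (4 - C0)

/-- `L₀` -/
def constL0 (N d : ℕ) (C0 C1 : ℝ) : ℝ :=
  max (3 * C1 / (min N d : ℕ) * (C0 * constM C0 / 10 + 1 / 4)) (3 * C0 / 4)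

/-- `L₂` -/
def constL2 (N d : ℕ) (C0 C1 C2 : ℝ) : ℝ :=
  max (C2 / (min N d : ℕ)) (C1 ^ 2 / (N * d * (4 - C0)))

/-- `L₁` -/
def constL1 (N d : ℕ) (C0 C1 C2 : ℝ) : ℝ :=
  max
    (4 * max
      (constM C0 * C0 ^ 2 / (5 * (min N d : ℕ) ^ 2)
        + C0 * constM C0 ^ 2 * C1 ^ 2 / (8 * (min N d : ℕ) ^ 2)
        + C2 / (4 * (min N d : ℕ))
        + C0 / 10 * (constL2 N d C0 C1 C2
          + C0 / (1 - C0 / 4) *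
            (C0 ^ 2 * constM C0 ^ 2 / (10 * (min N d : ℕ) ^ 2) + 1 / 4 * constL2 N d C0 C1 C2)))
      (C0 * constM C0 * C1 / (5 * (min N d : ℕ)) + C1 / (4 * N)))
    C0

/-- `q = √(L² + L_℘²)` with `L = L₀ ∨ L₁` -/
def constQ (N d : ℕ) (C0 C1 C2 Lw : ℝ) : ℝ :=
  Real.sqrt (max (constL0 N d C0 C1) (constL1 N d C0 C1 C2) ^ 2 + Lw ^ 2)

end RTRL

end

open RTRL

/-!
Of the smallness condition, only `C0 < 1` is needed: `C0` is one of the terms in the maximum `L₁`,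
so `constQ < 1` forces it (`lt_one_of_constQ_lt_one`). Since `|σ'| ≤ 1/4`, the update of each of the
three levels `s`, `s'`, `s''` of the hidden state then contracts that level by the factor `1/4` and
depends in a Lipschitz way on the data and on the levels before it (`exists_clippedStep_bounds`).
A weighted sum of the distances of the data and of the levels, with weights that dominate the cross
terms, is therefore contracted by the joint chain, at the rate `(1 + Lw) / 2` and uniformly in `θ`
(`exists_isContractive`). The data contribute through the Wasserstein condition, used in the form
that the kernel `κ` multiplies Lipschitz constants by `Lw` (`abs_integral_sub_le_of_wass_le`).

The update is only locally Lipschitz, since it is quadratic in `s'`. So it is precomposed with a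
truncation at radii that the chain started at `(s₀, 0, 0)` never leaves. This does not change the
trajectory, and every stationary distribution of the joint chain is also stationary for the
truncated one, because it lives within these radii (`IsModel.ae_mem_of_invariant`): the data by
contraction towards the laws of `U t`, and each hidden level because a function that vanishes only
within the radius is at least halved in each step, which stationarity permits only if it vanishes
almost everywhere (`ae_eq_zero_of_invariant`).

The noise is redrawn in each step, hence test functions may depend on it arbitrarily. Iterating the
kernel multiplies the Lipschitz constant of a test function by the contraction rate
(`IsTest.step`). This yields uniqueness of the stationary distribution, its existence as a limit
point of the tight laws of the chain (`IsContractive.exists_invariant`), and convergence of the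
expectations of `lossFun`, `gFun` and `heFun` along the chain, exponentially fast and uniformly in
`θ` (`IsModel.exists_integral_sub_le`). Time averages then converge uniformly
(`tendstoUniformly_mean`).

Along a trajectory, `s'` and `s''` are the true derivatives of the memory with respect to the
weights (`hasForwardDerivs_hiddenPath`), so `gFun` and `heFun` are the gradient and the Hessian of
`lossFun` (`hasGrad_lossFun`, `hasGrad_gFun`). Everything is bounded along the chain, so that
expectations may be differentiated under the integral sign (`hasGrad_integral`). Finally, uniform
convergence of the derivatives makes the limit differentiable, with the limit of the derivatives as
its derivative (`hasGrad_of_tendstoUniformly`). Applied twice, this gives the gradient and the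
Hessian of the stationary loss.
-/

noncomputable section

namespace RTRL

/-! ### Lipschitz test functions and the Wasserstein distance -/

/-- The easy half of Kantorovich duality: since `wass 1 ≤ wass 2`, integrals of a bounded
`K`-Lipschitz function against two measures differ by at most `K` times their `2`-Wasserstein
distance. -/
theorem abs_integral_sub_le_of_wass_le {E : Type*} [NormedAddCommGroup E] [MeasurableSpace E]
    [BorelSpace E] [SecondCountableTopology E] {μ ν : Measure E} [IsProbabilityMeasure μ]
    {r : ℝ} (hr : 0 ≤ r)
    (h : wass 2 μ ν ≤ ENNReal.ofReal r) {g : E → ℝ} (hg : Measurable g) {b K : ℝ}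
    (hb : ∀ x, |g x| ≤ b) (hK : 0 ≤ K) (hlip : ∀ x y, |g x - g y| ≤ K * ‖x - y‖) :
    |∫ x, g x ∂μ - ∫ x, g x ∂ν| ≤ K * r := by
  have key : ∀ ε : ℝ, 0 < ε → |∫ x, g x ∂μ - ∫ x, g x ∂ν| ≤ K * (r + ε) := by
    intro ε hε
    have hlt : wass 2 μ ν < ENNReal.ofReal (r + ε) :=
      h.trans_lt ((ENNReal.ofReal_lt_ofReal_iff (by linarith)).2 (by linarith))
    simp only [wass, iInf_lt_iff] at hlt
    obtain ⟨γ, ⟨hγ1, hγ2⟩, hγ⟩ := hlt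
    have hγp : IsProbabilityMeasure γ := by
      constructor
      have h1 : (γ.map Prod.fst) Set.univ = 1 := by rw [hγ1]; exact measure_univ
      rwa [Measure.map_apply measurable_fst MeasurableSet.univ, Set.preimage_univ] at h1
    have hi1 : Integrable (fun z : E × E => g z.1) γ :=
      Integrable.of_bound (hg.comp measurable_fst).aestronglyMeasurable b
        (Eventually.of_forall fun z => hb _)
    have hi2 : Integrable (fun z : E × E => g z.2) γ :=
      Integrable.of_bound (hg.comp measurable_snd).aestronglyMeasurable b
        (Eventually.of_forall fun z => hb _)
    have e1 : ∫ x, g x ∂μ = ∫ z, g z.1 ∂γ := by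
      rw [← hγ1, integral_map measurable_fst.aemeasurable hg.aestronglyMeasurable]
    have e2 : ∫ x, g x ∂ν = ∫ z, g z.2 ∂γ := by
      rw [← hγ2, integral_map measurable_snd.aemeasurable hg.aestronglyMeasurable]
    have hm : AEMeasurable (fun z : E × E => ‖z.1 - z.2‖ₑ) γ := by fun_prop
    have hH : ∫⁻ z, ‖z.1 - z.2‖ₑ ∂γ ≤ (∫⁻ z, ‖z.1 - z.2‖ₑ ^ (2 : ℝ) ∂γ) ^ (1 / (2 : ℝ)) := by
      have := ENNReal.lintegral_mul_le_Lp_mul_Lq γ (Real.HolderConjugate.two_two) hm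
        (aemeasurable_const (b := (1 : ℝ≥0∞)))
      simpa using this
    have h3 : ENNReal.ofReal |∫ x, g x ∂μ - ∫ x, g x ∂ν| ≤ ENNReal.ofReal (K * (r + ε)) := by
      rw [e1, e2, ← integral_sub hi1 hi2, ← Real.enorm_eq_ofReal_abs]
      calc ‖∫ z, (g z.1 - g z.2) ∂γ‖ₑ ≤ ∫⁻ z, ‖g z.1 - g z.2‖ₑ ∂γ :=
            enorm_integral_le_lintegral_enorm _
        _ ≤ ∫⁻ z, ENNReal.ofReal K * ‖z.1 - z.2‖ₑ ∂γ := by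
            refine lintegral_mono fun z => ?_
            rw [Real.enorm_eq_ofReal_abs, ← ofReal_norm, ← ENNReal.ofReal_mul hK]
            exact ENNReal.ofReal_le_ofReal (hlip _ _)
        _ = ENNReal.ofReal K * ∫⁻ z, ‖z.1 - z.2‖ₑ ∂γ := lintegral_const_mul'' _ hm
        _ ≤ ENNReal.ofReal K * ENNReal.ofReal (r + ε) := by
            gcongr
            exact hH.trans hγ.le
        _ = ENNReal.ofReal (K * (r + ε)) := (ENNReal.ofReal_mul hK).symm
    exact (ENNReal.ofReal_le_ofReal_iff (by positivity)).1 h3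
  refine le_of_forall_pos_le_add fun ε hε => (key (ε / (K + 1)) (by positivity)).trans ?_
  have : K * (ε / (K + 1)) ≤ ε := by
    rw [mul_div_assoc', div_le_iff₀ (by positivity)]
    nlinarith
  linarith

theorem integral_bind_of_bounded {E : Type*} [MeasurableSpace E] (Q : Kernel E E)
    [IsMarkovKernel Q] (m : Measure E) [IsProbabilityMeasure m] {g : E → ℝ} (hg : Measurable g)
    {b : ℝ} (hb : ∀ x, |g x| ≤ b) :
    ∫ x, g x ∂(m.bind Q) = ∫ x, ∫ y, g y ∂(Q x) ∂m := by
  rw [Measure.comp_eq_comp_const_apply, Kernel.integral_comp]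
  · simp
  · exact Integrable.of_bound hg.aestronglyMeasurable b (Eventually.of_forall hb)

theorem abs_integral_le_of_bounded {E : Type*} [MeasurableSpace E] (m : Measure E)
    [IsProbabilityMeasure m] {g : E → ℝ} {b : ℝ} (hb : ∀ x, |g x| ≤ b) :
    |∫ x, g x ∂m| ≤ b := by
  have := norm_integral_le_of_norm_le_const (μ := m) (f := g) (C := b) (Eventually.of_forall hb)
  simpa using this

/-- If `a` oscillates by at most `c` on `S`, its means under probability measures carried by `S`
differ by at most `c`. -/
theorem abs_integral_sub_integral_le_of_osc {E : Type*} [MeasurableSpace E] {ν ν' : Measure E}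
    [IsProbabilityMeasure ν] [IsProbabilityMeasure ν'] {a : E → ℝ} (ha : Integrable a ν)
    (ha' : Integrable a ν') {S : Set E} (hS : ∀ᵐ x ∂ν, x ∈ S) (hS' : ∀ᵐ x ∂ν', x ∈ S) {c : ℝ}
    (h : ∀ x ∈ S, ∀ y ∈ S, |a x - a y| ≤ c) :
    |∫ x, a x ∂ν - ∫ x, a x ∂ν'| ≤ c := by
  have h1 : ∀ x ∈ S, |a x - ∫ y, a y ∂ν'| ≤ c := by
    intro x hx
    have : a x - ∫ y, a y ∂ν' = ∫ y, (a x - a y) ∂ν' := by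
      rw [integral_sub (integrable_const _) ha']; simp
    rw [this]
    have := norm_integral_le_of_norm_le_const (μ := ν') (f := fun y => a x - a y) (C := c)
      (hS'.mono fun y hy => h x hx y hy)
    simpa using this
  have : ∫ x, a x ∂ν - ∫ x, a x ∂ν' = ∫ x, (a x - ∫ y, a y ∂ν') ∂ν := by
    rw [integral_sub ha (integrable_const _)]; simp
  rw [this]
  have := norm_integral_le_of_norm_le_const (μ := ν) (f := fun x => a x - ∫ y, a y ∂ν') (C := c)
    (hS.mono fun x hx => h1 x hx)
  simpa using this

/-- Bounded Lipschitz functions separate probability measures. -/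
theorem measure_eq_of_forall_lipschitz {E : Type*} [PseudoMetricSpace E] [HasOuterApproxClosed E]
    [MeasurableSpace E] [BorelSpace E] {μ ν : Measure E} [IsProbabilityMeasure μ]
    [IsProbabilityMeasure ν]
    (h : ∀ g : E → ℝ, (∃ b, ∀ x, |g x| ≤ b) → (∃ L, LipschitzWith L g) →
      ∫ x, g x ∂μ = ∫ x, g x ∂ν) : μ = ν := by
  let μ' : ProbabilityMeasure E := ⟨μ, inferInstance⟩
  let ν' : ProbabilityMeasure E := ⟨ν, inferInstance⟩
  have ht : Tendsto (fun _ : ℕ => μ') atTop (𝓝 ν') := by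
    rw [tendsto_iff_forall_lipschitz_integral_tendsto]
    rintro g ⟨C, hC⟩ hL
    have hb : ∃ b, ∀ x, |g x| ≤ b := by
      by_cases hE : Nonempty E
      · obtain ⟨x₀⟩ := hE
        refine ⟨C + |g x₀|, fun x => ?_⟩
        have h1 := hC x x₀
        rw [Real.dist_eq] at h1
        have h2 := abs_sub_abs_le_abs_sub (g x) (g x₀)
        linarith
      · exact ⟨0, fun x => (hE ⟨x⟩).elim⟩
    have : ∫ x, g x ∂(μ' : Measure E) = ∫ x, g x ∂(ν' : Measure E) := h g hb hL
    rw [this]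
    exact tendsto_const_nhds
  have : μ' = ν' := tendsto_nhds_unique tendsto_const_nhds ht
  exact congrArg Subtype.val this

/-! ### Contractive random iterations -/

/-- The kernel `(u, v, η) ↦ κ(u, ·) ⊗ δ_{F(u, v)} ⊗ μη` for an arbitrary update map `F`. -/
def stepKernel {A V : Type*} [MeasurableSpace A] [MeasurableSpace V] (κ : Kernel A A)
    (μη : Measure ℝ) (F : A → V → V) (hF : Measurable fun h : A × V × ℝ => F h.1 h.2.1) :
    Kernel (A × V × ℝ) (A × V × ℝ) :=
  (κ.comap Prod.fst measurable_fst) ×ₖ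
    ((Kernel.deterministic (fun h : A × V × ℝ => F h.1 h.2.1) hF) ×ₖ
      Kernel.const (A × V × ℝ) μη)

section Kernel

variable {A V : Type*} [MeasurableSpace A] [MeasurableSpace V] {κ : Kernel A A} [IsMarkovKernel κ]
  {μη : Measure ℝ} [IsProbabilityMeasure μη] {F : A → V → V}
  {hF : Measurable fun h : A × V × ℝ => F h.1 h.2.1}

instance : IsMarkovKernel (stepKernel κ μη F hF) := by unfold stepKernel; infer_instance

theorem stepKernel_apply (h : A × V × ℝ) :
    stepKernel κ μη F hF h = (κ h.1).prod ((Measure.dirac (F h.1 h.2.1)).prod μη) := by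
  unfold stepKernel
  rw [Kernel.prod_apply, Kernel.prod_apply]
  rfl

theorem lintegral_stepKernel (h : A × V × ℝ) {g : A × V × ℝ → ℝ≥0∞} (hg : Measurable g) :
    ∫⁻ z, g z ∂(stepKernel κ μη F hF h) = ∫⁻ u, ∫⁻ e, g (u, F h.1 h.2.1, e) ∂μη ∂(κ h.1) := by
  rw [stepKernel_apply, lintegral_prod _ hg.aemeasurable]
  refine lintegral_congr fun u => ?_
  rw [Measure.dirac_prod]
  exact lintegral_map (hg.comp measurable_prodMk_left) measurable_prodMk_left

theorem integral_stepKernel (h : A × V × ℝ) {g : A × V × ℝ → ℝ} (hg : Measurable g) {b : ℝ}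
    (hb : ∀ z, |g z| ≤ b) :
    ∫ z, g z ∂(stepKernel κ μη F hF h) = ∫ u, ∫ e, g (u, F h.1 h.2.1, e) ∂μη ∂(κ h.1) := by
  rw [stepKernel_apply,
    integral_prod _ (Integrable.of_bound hg.aestronglyMeasurable b (Eventually.of_forall hb))]
  refine integral_congr_ae (Eventually.of_forall fun u => ?_)
  simp only
  rw [Measure.dirac_prod]
  exact integral_map measurable_prodMk_left.aemeasurable
    (hg.comp measurable_prodMk_left).aestronglyMeasurable

end Kernel

section Iteration

variable {A V : Type*} [NormedAddCommGroup A] [MeasurableSpace A] [NormedAddCommGroup V]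
  [MeasurableSpace V]

/-- Bounded measurable functions `g` of `(u, v, η)` that are `K`-Lipschitz in `(u, v)` for the cost
`M ‖u - u'‖ + δ v v'`, uniformly in `η`. No regularity in `η` is required, since one step of the
chain forgets `η`. -/
structure IsTest (M : ℝ) (δ : V → V → ℝ) (K : ℝ) (g : A × V × ℝ → ℝ) : Prop where
  meas : Measurable g
  bdd : ∃ b, ∀ h, |g h| ≤ b
  nonneg : 0 ≤ K
  lip : ∀ u v u' v' e, |g (u, v, e) - g (u', v', e)| ≤ K * (M * ‖u - u'‖ + δ v v')

/-- The data of a contraction by the factor `ρ`: the kernel `κ` shrinks Lipschitz constants by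
`Lw`, the distance-like function `δ` is comparable with the distance of `V`, and the update `F`
shrinks `δ` up to an error that the weight `M` of the data in the cost absorbs. -/
structure IsContractive (κ : Kernel A A) (F : A → V → V) (M : ℝ) (δ : V → V → ℝ) (ρ : ℝ) :
    Prop where
  rho_nonneg : 0 ≤ ρ
  rho_lt_one : ρ < 1
  one_le : 1 ≤ M
  dist_le : ∀ v v', dist v v' ≤ δ v v'
  le_dist : ∃ c, 0 ≤ c ∧ ∀ v v', δ v v' ≤ c * dist v v'
  step : ∃ Lw, (∀ (g : A → ℝ) (b K : ℝ), Measurable g → (∀ x, |g x| ≤ b) → 0 ≤ K →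
      (∀ x y, |g x - g y| ≤ K * ‖x - y‖) →
      ∀ u u', |∫ x, g x ∂(κ u) - ∫ x, g x ∂(κ u')| ≤ K * (Lw * ‖u - u'‖)) ∧
    ∀ u v u' v', δ (F u v) (F u' v') ≤ ρ * δ v v' + (ρ - Lw) * M * ‖u - u'‖

section Lipschitz

variable [BorelSpace A] [BorelSpace V] [SecondCountableTopology V] {M : ℝ} {δ : V → V → ℝ}
  {g : A × V × ℝ → ℝ}

/-- Bounded Lipschitz functions are test functions. -/
theorem isTest_of_lipschitzWith (hM : 1 ≤ M) (hδ : ∀ v v', dist v v' ≤ δ v v')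
    (hb : ∃ b, ∀ x, |g x| ≤ b)
    {L : NNReal} (hL : LipschitzWith L g) : IsTest M δ L g := by
  refine ⟨hL.continuous.measurable, hb, L.2, fun u v u' v' e => ?_⟩
  have h1 := hL.dist_le_mul (u, v, e) (u', v', e)
  rw [Real.dist_eq] at h1
  refine h1.trans (mul_le_mul_of_nonneg_left ?_ L.2)
  rw [Prod.dist_eq, Prod.dist_eq]
  have h0 := norm_nonneg (u - u')
  have h2 := hδ v v'
  have h3 : (0 : ℝ) ≤ dist v v' := dist_nonneg
  simp only [dist_self, dist_eq_norm u u']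
  refine max_le (by nlinarith) (max_le (by nlinarith) (by nlinarith))

end Lipschitz

variable {κ : Kernel A A} [IsMarkovKernel κ] {μη : Measure ℝ} [IsProbabilityMeasure μη]
  {F : A → V → V} {hF : Measurable fun h : A × V × ℝ => F h.1 h.2.1} {M ρ K : ℝ} {δ : V → V → ℝ}
  {g : A × V × ℝ → ℝ}

/-- One step of the chain multiplies the Lipschitz constant of a test function by `ρ`. -/
theorem IsTest.step (hc : IsContractive κ F M δ ρ) (hg : IsTest M δ K g) :
    IsTest M δ (ρ * K) (fun h => ∫ z, g z ∂(stepKernel κ μη F hF h)) ∧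
      ∀ u v u' v' e e', |∫ z, g z ∂(stepKernel κ μη F hF (u, v, e)) -
        ∫ z, g z ∂(stepKernel κ μη F hF (u', v', e'))| ≤ ρ * K * (M * ‖u - u'‖ + δ v v') := by
  obtain ⟨b, hb⟩ := hg.bdd
  obtain ⟨Lw, hκ, hδ⟩ := hc.step
  have hK := hg.nonneg
  have hM : 0 ≤ M := zero_le_one.trans hc.one_le
  have hδ0 : ∀ v, δ v v = 0 := by
    intro v
    obtain ⟨c, -, h2⟩ := hc.le_dist
    refine le_antisymm ?_ ?_
    · simpa using h2 v v
    · simpa using hc.dist_le v v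
  -- averaging over the noise first leaves a Lipschitz function of `(u, v)`
  let G : A → V → ℝ := fun u v => ∫ e, g (u, v, e) ∂μη
  have hint : ∀ u v, Integrable (fun e => g (u, v, e)) μη := fun u v =>
    Integrable.of_bound (hg.meas.comp (by fun_prop)).aestronglyMeasurable b
      (Eventually.of_forall fun e => hb _)
  have hGm : ∀ v, Measurable fun u => G u v := by
    intro v
    have h1 : StronglyMeasurable fun q : A × ℝ => g (q.1, v, q.2) :=
      (hg.meas.comp (by fun_prop)).stronglyMeasurable
    exact h1.integral_prod_right'.measurable
  have hGb : ∀ u v, |G u v| ≤ b := fun u v => abs_integral_le_of_bounded μη fun e => hb _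
  have hGlip : ∀ u v u' v', |G u v - G u' v'| ≤ K * (M * ‖u - u'‖ + δ v v') := by
    intro u v u' v'
    simp only [G]
    rw [← integral_sub (hint _ _) (hint _ _)]
    exact abs_integral_le_of_bounded μη fun e => hg.lip _ _ _ _ _
  have hGi : ∀ w u, Integrable (fun x => G x w) (κ u) := fun w u =>
    Integrable.of_bound (hGm w).aestronglyMeasurable b (Eventually.of_forall fun x => hGb x w)
  have main : ∀ u v u' v' e e', |∫ z, g z ∂(stepKernel κ μη F hF (u, v, e)) -
      ∫ z, g z ∂(stepKernel κ μη F hF (u', v', e'))| ≤ ρ * K * (M * ‖u - u'‖ + δ v v') := by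
    intro u v u' v' e e'
    rw [integral_stepKernel _ hg.meas hb, integral_stepKernel _ hg.meas hb]
    change |∫ x, G x (F u v) ∂(κ u) - ∫ x, G x (F u' v') ∂(κ u')| ≤ _
    have h1 : |∫ x, G x (F u v) ∂(κ u) - ∫ x, G x (F u v) ∂(κ u')| ≤
        K * M * (Lw * ‖u - u'‖) := by
      refine hκ _ b (K * M) (hGm _) (fun x => hGb x _) (by positivity) (fun x y => ?_) u u'
      have := hGlip x (F u v) y (F u v)
      rw [hδ0, add_zero] at this
      linarith
    have h2 : |∫ x, G x (F u v) ∂(κ u') - ∫ x, G x (F u' v') ∂(κ u')| ≤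
        K * δ (F u v) (F u' v') := by
      rw [← integral_sub (hGi _ _) (hGi _ _)]
      refine abs_integral_le_of_bounded (κ u') fun x => ?_
      have := hGlip x (F u v) x (F u' v')
      simpa using this
    have h3 := mul_le_mul_of_nonneg_left (hδ u v u' v') hK
    have h4 := abs_sub_le (∫ x, G x (F u v) ∂(κ u)) (∫ x, G x (F u v) ∂(κ u'))
      (∫ x, G x (F u' v') ∂(κ u'))
    nlinarith
  refine ⟨⟨?_, ⟨b, fun h => abs_integral_le_of_bounded _ hb⟩, mul_nonneg hc.rho_nonneg hK,
    fun u v u' v' e => main u v u' v' e e⟩, main⟩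
  exact (hg.meas.stronglyMeasurable.integral_kernel).measurable

variable {m m' : ℕ → Measure (A × V × ℝ)} {S : Set (A × V × ℝ)} {B : ℝ}

/-- Two copies of the chain that start in a set of cost diameter `B` give the same mean to a test
function, up to an exponentially small error. At time `0` this would fail, as test functions may
depend on `η` in any way. -/
theorem IsTest.abs_integral_sub_le (hc : IsContractive κ F M δ ρ)
    (hS : ∀ h ∈ S, ∀ h' ∈ S, M * ‖h.1 - h'.1‖ + δ h.2.1 h'.2.1 ≤ B) (hg : IsTest M δ K g) (t : ℕ)
    (hm : ∀ n, IsProbabilityMeasure (m n)) (hm' : ∀ n, IsProbabilityMeasure (m' n))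
    (hmS : ∀ᵐ h ∂(m 0), h ∈ S) (hmS' : ∀ᵐ h ∂(m' 0), h ∈ S)
    (hs : ∀ n, m (n + 1) = (m n).bind (stepKernel κ μη F hF))
    (hs' : ∀ n, m' (n + 1) = (m' n).bind (stepKernel κ μη F hF)) :
    |∫ h, g h ∂(m (t + 1)) - ∫ h, g h ∂(m' (t + 1))| ≤ ρ ^ (t + 1) * K * B := by
  induction t generalizing g K with
  | zero =>
    obtain ⟨b, hb⟩ := hg.bdd
    obtain ⟨h1, h2⟩ := hg.step (μη := μη) (hF := hF) hc
    obtain ⟨b', hb'⟩ := h1.bdd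
    rw [hs, hs', integral_bind_of_bounded _ _ hg.meas hb, integral_bind_of_bounded _ _ hg.meas hb]
    refine abs_integral_sub_integral_le_of_osc
      (Integrable.of_bound h1.meas.aestronglyMeasurable b' (Eventually.of_forall hb'))
      (Integrable.of_bound h1.meas.aestronglyMeasurable b' (Eventually.of_forall hb')) hmS hmS' ?_
    rintro ⟨u, v, e⟩ hx ⟨u', v', e'⟩ hy
    refine (h2 u v u' v' e e').trans ?_
    have := hS _ hx _ hy
    rw [zero_add, pow_one]
    exact mul_le_mul_of_nonneg_left this h1.nonneg
  | succ t ih =>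
    obtain ⟨b, hb⟩ := hg.bdd
    obtain ⟨h1, -⟩ := hg.step (μη := μη) (hF := hF) hc
    rw [hs, hs', integral_bind_of_bounded _ _ hg.meas hb, integral_bind_of_bounded _ _ hg.meas hb]
    refine (ih h1).trans (le_of_eq ?_)
    ring

variable [BorelSpace A] [BorelSpace V] [SecondCountableTopology V]

/-- There is at most one stationary distribution on a set of finite cost diameter. -/
theorem IsContractive.invariant_unique (hc : IsContractive κ F M δ ρ)
    (hS : ∀ h ∈ S, ∀ h' ∈ S, M * ‖h.1 - h'.1‖ + δ h.2.1 h'.2.1 ≤ B)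
    {ν ν' : Measure (A × V × ℝ)} [IsProbabilityMeasure ν] [IsProbabilityMeasure ν']
    (h : (stepKernel κ μη F hF).Invariant ν) (h' : (stepKernel κ μη F hF).Invariant ν')
    (hν : ∀ᵐ x ∂ν, x ∈ S) (hν' : ∀ᵐ x ∂ν', x ∈ S) : ν = ν' := by
  refine measure_eq_of_forall_lipschitz fun g hb ⟨L, hL⟩ => ?_
  have ht := isTest_of_lipschitzWith hc.one_le hc.dist_le hb hL
  have key : ∀ t : ℕ, |∫ x, g x ∂ν - ∫ x, g x ∂ν'| ≤ ρ ^ (t + 1) * L * B := fun t =>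
    ht.abs_integral_sub_le hc hS t (m := fun _ => ν) (m' := fun _ => ν') (fun _ => inferInstance)
      (fun _ => inferInstance) hν hν' (fun _ => h.symm) (fun _ => h'.symm)
  have hlim : Tendsto (fun t : ℕ => ρ ^ (t + 1) * L * B) atTop (𝓝 0) := by
    have := (tendsto_pow_atTop_nhds_zero_of_lt_one hc.rho_nonneg hc.rho_lt_one).comp
      (tendsto_add_atTop_nat 1)
    simpa using (this.mul_const (L : ℝ)).mul_const B
  have h0 : |∫ x, g x ∂ν - ∫ x, g x ∂ν'| ≤ 0 :=
    ge_of_tendsto hlim (Eventually.of_forall key)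
  exact sub_eq_zero.1 (abs_nonpos_iff.1 h0)

/-- A stationary distribution exists as soon as one trajectory of laws is tight and stays in a
closed set of finite cost diameter: limit points of the laws are stationary, because consecutive
laws become indistinguishable for test functions. -/
theorem IsContractive.exists_invariant [SecondCountableTopology A] [CompleteSpace A]
    [CompleteSpace V]
    (hc : IsContractive κ F M δ ρ)
    (hS : ∀ h ∈ S, ∀ h' ∈ S, M * ‖h.1 - h'.1‖ + δ h.2.1 h'.2.1 ≤ B) (hSc : IsClosed S)
    (hm : ∀ n, IsProbabilityMeasure (m n)) (hmS : ∀ n, ∀ᵐ h ∂(m n), h ∈ S)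
    (hs : ∀ n, m (n + 1) = (m n).bind (stepKernel κ μη F hF))
    (htight : IsTightMeasureSet (Set.range m)) :
    ∃ μ : Measure (A × V × ℝ), IsProbabilityMeasure μ ∧ (stepKernel κ μη F hF).Invariant μ ∧
      ∀ᵐ x ∂μ, x ∈ S := by
  let p : ℕ → ProbabilityMeasure (A × V × ℝ) := fun n => ⟨m n, hm n⟩
  have hcomp : IsCompact (closure (Set.range p)) := by
    refine isCompact_closure_of_isTightMeasureSet (htight.subset ?_)
    rintro _ ⟨_, ⟨n, rfl⟩, rfl⟩
    exact ⟨n, rfl⟩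
  let l : Ultrafilter ℕ := hyperfilter ℕ
  obtain ⟨μ, -, hμ⟩ := hcomp.ultrafilter_le_nhds (l.map p)
    (by
      rw [le_principal_iff]
      exact Ultrafilter.mem_map.2 (univ_mem' fun n => subset_closure ⟨n, rfl⟩))
  have hlim : Tendsto p l (𝓝 μ) := hμ
  have hl : (l : Filter ℕ) ≤ atTop := Nat.hyperfilter_le_atTop
  have hconv : ∀ g : A × V × ℝ → ℝ, Continuous g → (∃ b, ∀ x, |g x| ≤ b) →
      Tendsto (fun n => ∫ x, g x ∂(m n)) l (𝓝 (∫ x, g x ∂(μ : Measure (A × V × ℝ)))) := by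
    rintro g hgc ⟨b, hb⟩
    exact ProbabilityMeasure.tendsto_iff_forall_integral_tendsto.1 hlim
      (BoundedContinuousFunction.ofNormedAddCommGroup g hgc b hb)
  refine ⟨μ, inferInstance, ?_, ?_⟩
  · refine measure_eq_of_forall_lipschitz fun g hbb ⟨L, hL⟩ => ?_
    obtain ⟨b, hb⟩ := hbb
    have ht := isTest_of_lipschitzWith hc.one_le hc.dist_le ⟨b, hb⟩ hL
    obtain ⟨ht1, ht2⟩ := ht.step (μη := μη) (hF := hF) hc
    have hcont : Continuous fun h => ∫ z, g z ∂(stepKernel κ μη F hF h) := by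
      obtain ⟨c, hc0, hcd⟩ := hc.le_dist
      have hM : 0 ≤ M := zero_le_one.trans hc.one_le
      refine (LipschitzWith.of_dist_le_mul (K := Real.toNNReal (ρ * L * (M + c)))
        fun x y => ?_).continuous
      obtain ⟨u, v, e⟩ := x
      obtain ⟨u', v', e'⟩ := y
      rw [Real.dist_eq]
      refine (ht2 u v u' v' e e').trans ?_
      have h0 := ht1.nonneg
      rw [Real.coe_toNNReal _ (by positivity), mul_assoc (ρ * L : ℝ)]
      refine mul_le_mul_of_nonneg_left ?_ h0
      have h1 : ‖u - u'‖ ≤ dist (u, v, e) (u', v', e') := by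
        rw [← dist_eq_norm, Prod.dist_eq]; exact le_max_left _ _
      have h2 : dist v v' ≤ dist (u, v, e) (u', v', e') := by
        rw [Prod.dist_eq, Prod.dist_eq]; exact (le_max_left _ _).trans (le_max_right _ _)
      have := hcd v v'
      nlinarith [mul_le_mul_of_nonneg_left h1 hM, mul_le_mul_of_nonneg_left h2 hc0]
    rw [integral_bind_of_bounded _ _ hL.continuous.measurable hb]
    have h1 := hconv _ hcont ht1.bdd
    have h2 := hconv g hL.continuous ⟨b, hb⟩
    have h3 : Tendsto (fun n => ∫ x, g x ∂(m (n + 1)) - ∫ x, g x ∂(m n)) atTop (𝓝 0) := by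
      rw [← tendsto_add_atTop_iff_nat 1]
      refine squeeze_zero_norm (a := fun n => ρ ^ (n + 1) * L * B) (fun n => ?_) ?_
      · exact ht.abs_integral_sub_le hc hS n (m := fun n => m (n + 1)) (m' := m) (fun _ => hm _)
          hm (hmS _) (hmS _) (fun _ => hs _) hs
      · have := (tendsto_pow_atTop_nhds_zero_of_lt_one hc.rho_nonneg hc.rho_lt_one).comp
          (tendsto_add_atTop_nat 1)
        simpa using (this.mul_const (L : ℝ)).mul_const B
    have h4 : Tendsto (fun n => ∫ x, ∫ z, g z ∂(stepKernel κ μη F hF x) ∂(m n)) l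
        (𝓝 (∫ x, g x ∂(μ : Measure (A × V × ℝ)))) := by
      have := (h3.mono_left hl).add h2
      rw [zero_add] at this
      refine this.congr fun n => ?_
      rw [sub_add_cancel, hs n, integral_bind_of_bounded _ _ hL.continuous.measurable hb]
    exact tendsto_nhds_unique h1 h4
  · have h1 := ProbabilityMeasure.limsup_measure_closed_le_of_tendsto hlim hSc
    have h2 : ∀ n, ((p n : ProbabilityMeasure (A × V × ℝ)) : Measure (A × V × ℝ)) S = 1 :=
      fun n => (prob_compl_eq_zero_iff hSc.measurableSet).1 (hmS n)
    simp only [h2, limsup_const] at h1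
    exact (prob_compl_eq_zero_iff hSc.measurableSet).2 (le_antisymm prob_le_one h1)

end Iteration

/-! ### Uniformly bounded and Lipschitz families -/

/-- A family of real functions with a common bound and a common Lipschitz constant. -/
def UnifLip {ι E : Type*} [PseudoMetricSpace E] (g : ι → E → ℝ) : Prop :=
  ∃ C, 0 ≤ C ∧ (∀ i x, |g i x| ≤ C) ∧ ∀ i x y, |g i x - g i y| ≤ C * dist x y

namespace UnifLip

variable {ι E : Type*} [PseudoMetricSpace E] {g h : ι → E → ℝ}

theorem const {a : ι → ℝ} {C : ℝ} (ha : ∀ i, |a i| ≤ C) : UnifLip (fun i (_ : E) => a i) := by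
  refine ⟨|C|, abs_nonneg _, fun i _ => (ha i).trans (le_abs_self _), fun i x y => ?_⟩
  rw [sub_self, abs_zero]
  positivity

theorem add (hg : UnifLip g) (hh : UnifLip h) : UnifLip (fun i x => g i x + h i x) := by
  obtain ⟨C, hC, h1, h2⟩ := hg
  obtain ⟨C', hC', h1', h2'⟩ := hh
  refine ⟨C + C', by positivity, fun i x => (abs_add_le _ _).trans (add_le_add (h1 i x) (h1' i x)),
    fun i x y => ?_⟩
  rw [add_sub_add_comm, add_mul]
  exact (abs_add_le _ _).trans (add_le_add (h2 i x y) (h2' i x y))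

theorem mul (hg : UnifLip g) (hh : UnifLip h) : UnifLip (fun i x => g i x * h i x) := by
  obtain ⟨C, hC, h1, h2⟩ := hg
  obtain ⟨C', hC', h1', h2'⟩ := hh
  refine ⟨2 * (C * C'), by positivity, fun i x => ?_, fun i x y => ?_⟩
  · rw [abs_mul]
    have := mul_le_mul (h1 i x) (h1' i x) (abs_nonneg _) hC
    nlinarith [mul_nonneg hC hC']
  · have e : g i x * h i x - g i y * h i y = g i x * (h i x - h i y) + (g i x - g i y) * h i y := by
      ring
    rw [e]
    have a1 := mul_le_mul (h1 i x) (h2' i x y) (abs_nonneg _) hC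
    have a2 := mul_le_mul (h2 i x y) (h1' i y) (abs_nonneg _) (by positivity)
    rw [← abs_mul] at a1 a2
    refine (abs_add_le _ _).trans ((add_le_add a1 a2).trans (le_of_eq ?_))
    ring

theorem neg (hg : UnifLip g) : UnifLip (fun i x => -g i x) := by
  obtain ⟨C, hC, h1, h2⟩ := hg
  refine ⟨C, hC, fun i x => by rw [abs_neg]; exact h1 i x, fun i x y => ?_⟩
  rw [neg_sub_neg, abs_sub_comm]
  exact h2 i x y

theorem sub (hg : UnifLip g) (hh : UnifLip h) : UnifLip (fun i x => g i x - h i x) := by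
  simpa only [sub_eq_add_neg] using hg.add hh.neg

theorem zero : UnifLip (fun (_ : ι) (_ : E) => (0 : ℝ)) := const (C := 0) fun _ => by simp

theorem sum {κ : Type*} (s : Finset κ) {g : κ → ι → E → ℝ} (hg : ∀ k, UnifLip (g k)) :
    UnifLip (fun i x => ∑ k ∈ s, g k i x) := by
  classical
  induction s using Finset.induction_on with
  | empty => simpa using zero
  | insert a s ha ih => simpa only [Finset.sum_insert ha] using (hg a).add ih

theorem comp {ψ : ℝ → ℝ} {b l : ℝ} (hb : ∀ x, |ψ x| ≤ b) (hl : ∀ x y, |ψ x - ψ y| ≤ l * |x - y|)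
    (hl0 : 0 ≤ l) (hg : UnifLip g) : UnifLip (fun i x => ψ (g i x)) := by
  obtain ⟨C, hC, -, h2⟩ := hg
  refine ⟨max b (l * C), le_max_of_le_right (by positivity),
    fun i x => (hb _).trans (le_max_left _ _), fun i x y => (hl _ _).trans ?_⟩
  calc l * |g i x - g i y| ≤ l * (C * dist x y) := mul_le_mul_of_nonneg_left (h2 i x y) hl0
    _ = l * C * dist x y := by ring
    _ ≤ _ := mul_le_mul_of_nonneg_right (le_max_right _ _) dist_nonneg

/-- Finitely many families have a common constant. -/
theorem uncurry {κ : Type*} [Finite κ] {g : κ → ι → E → ℝ} (hg : ∀ k, UnifLip (g k)) :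
    UnifLip (fun (i : κ × ι) x => g i.1 i.2 x) := by
  choose C hC h1 h2 using hg
  obtain ⟨D, hD⟩ := Set.Finite.bddAbove (Set.finite_range C)
  have hD' : ∀ k, C k ≤ D := fun k => hD ⟨k, rfl⟩
  refine ⟨|D|, abs_nonneg _, fun i x => (h1 _ _ _).trans ((hD' _).trans (le_abs_self _)),
    fun i x y => (h2 _ _ _ _).trans ?_⟩
  exact mul_le_mul_of_nonneg_right ((hD' _).trans (le_abs_self _)) dist_nonneg

end UnifLip

/-! ### Truncation -/

instance {N d : ℕ} : BorelSpace (Hidden N d) := by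
  have : BorelSpace ((WeightIdx N d → Fin N → ℝ) ×
      (WeightIdx N d → WeightIdx N d → Fin N → ℝ)) := Prod.borelSpace
  exact Prod.borelSpace

/-- The nearest-point projection of the line onto `[-r, r]`. -/
def clip (r x : ℝ) : ℝ := max (-r) (min r x)

theorem abs_clip_le {r : ℝ} (hr : 0 ≤ r) (x : ℝ) : |clip r x| ≤ r :=
  abs_le.2 ⟨le_max_left _ _, max_le (by linarith) (min_le_left _ _)⟩

theorem abs_clip_sub_clip_le (r x y : ℝ) : |clip r x - clip r y| ≤ |x - y| := by
  have h1 := abs_max_sub_max_le_max (-r) (min r x) (-r) (min r y)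
  have h2 := abs_min_sub_min_le_max r x r y
  rw [sub_self, abs_zero] at h1 h2
  exact (h1.trans (max_le (abs_nonneg _) le_rfl)).trans (h2.trans (max_le (abs_nonneg _) le_rfl))

theorem clip_eq_self {r x : ℝ} (h : |x| ≤ r) : clip r x = x := by
  obtain ⟨h1, h2⟩ := abs_le.1 h
  rw [clip, min_eq_right h2, max_eq_right h1]

variable {N d dZ : ℕ}

/-- The input `x` of `u = (x, z)`, truncated to the unit cube. -/
def clipData (u : Data d dZ) : Fin d → ℝ := fun j => clip 1 (u.1 j)

/-- The three components of the hidden state, truncated at the radii `r₀`, `r₁` and `r₂`. -/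
def clipHidden (r₀ r₁ r₂ : ℝ) (v : Hidden N d) : Hidden N d :=
  (fun k => clip r₀ (v.1 k), fun p k => clip r₁ (v.2.1 p k), fun p q k => clip r₂ (v.2.2 p q k))

theorem clipData_eq {u : Data d dZ} (hu : ‖u‖ ≤ 1) : clipData u = u.1 := by
  funext j
  exact clip_eq_self ((norm_le_pi_norm u.1 j).trans ((norm_fst_le u).trans hu))

theorem clipHidden_eq {r₀ r₁ r₂ : ℝ} {v : Hidden N d} (h0 : ‖v.1‖ ≤ r₀) (h1 : ‖v.2.1‖ ≤ r₁)
    (h2 : ‖v.2.2‖ ≤ r₂) : clipHidden r₀ r₁ r₂ v = v := by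
  unfold clipHidden
  refine Prod.ext ?_ (Prod.ext ?_ ?_)
  · funext k
    exact clip_eq_self ((norm_le_pi_norm v.1 k).trans h0)
  · funext p k
    exact clip_eq_self ((norm_le_pi_norm (v.2.1 p) k).trans ((norm_le_pi_norm v.2.1 p).trans h1))
  · funext p q k
    exact clip_eq_self ((norm_le_pi_norm (v.2.2 p q) k).trans
      ((norm_le_pi_norm (v.2.2 p) q).trans ((norm_le_pi_norm v.2.2 p).trans h2)))

/-- The hidden update, applied to the truncated data and hidden state. On the invariant set that
carries the chain it agrees with `hiddenStep`, but it is globally Lipschitz. -/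
def clippedStep (φ : ℝ → ℝ) (θ : Param N d) (r₀ r₁ r₂ : ℝ) (u : Data d dZ) (v : Hidden N d) :
    Hidden N d :=
  hiddenStep φ θ (clipData u) (clipHidden r₀ r₁ r₂ v)

theorem continuous_clip (r : ℝ) : Continuous (clip r) := by unfold clip; fun_prop

theorem measurable_hiddenStep_comp {T : Type*} [MeasurableSpace T] (φ : ℝ → ℝ) (θ : Param N d)
    {x : T → Fin d → ℝ} {v : T → Hidden N d} (hx : Measurable x) (hv : Measurable v) :
    Measurable fun a => hiddenStep φ θ (x a) (v a) := by
  have h : Measurable fun a => (((x a, 0), v a, 0) : State N d 0) :=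
    (hx.prodMk measurable_const).prodMk (hv.prodMk measurable_const)
  simpa only [Function.comp_def] using (measurable_hiddenStep (dZ := 0) φ θ).comp h

theorem measurable_clipHidden (r₀ r₁ r₂ : ℝ) :
    Measurable (clipHidden r₀ r₁ r₂ : Hidden N d → Hidden N d) := by
  have h := fun r => (continuous_clip r).measurable
  unfold clipHidden
  refine Measurable.prodMk ?_ (Measurable.prodMk ?_ ?_)
  · exact measurable_pi_lambda _ fun k => (h r₀).comp (by fun_prop)
  · exact measurable_pi_lambda _ fun p => measurable_pi_lambda _ fun k => (h r₁).comp (by fun_prop)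
  · exact measurable_pi_lambda _ fun p => measurable_pi_lambda _ fun q =>
      measurable_pi_lambda _ fun k => (h r₂).comp (by fun_prop)

theorem measurable_clipData : Measurable (clipData : Data d dZ → Fin d → ℝ) :=
  measurable_pi_lambda _ fun j => (continuous_clip 1).measurable.comp (by fun_prop)

theorem measurable_clippedStep (φ : ℝ → ℝ) (θ : Param N d) (r₀ r₁ r₂ : ℝ) :
    Measurable fun h : State N d dZ => clippedStep φ θ r₀ r₁ r₂ h.1 h.2.1 :=
  measurable_hiddenStep_comp φ θ (measurable_clipData.comp measurable_fst)
    ((measurable_clipHidden r₀ r₁ r₂).comp (measurable_fst.comp measurable_snd))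

/-! ### Bounds for the sigmoid function and for one hidden update -/

theorem deriv_deriv_sigmoid (x : ℝ) : deriv (deriv Real.sigmoid) x =
    Real.sigmoid x * (1 - Real.sigmoid x) * (1 - 2 * Real.sigmoid x) := by
  have h := Real.hasDerivAt_sigmoid x
  rw [Real.deriv_sigmoid]
  have := h.mul (h.const_sub 1)
  rw [show (fun x => Real.sigmoid x * (1 - Real.sigmoid x)) =
    (Real.sigmoid * fun x => 1 - Real.sigmoid x) from rfl, this.deriv]
  ring

theorem abs_sigmoid_le (x : ℝ) : |Real.sigmoid x| ≤ 1 := by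
  rw [abs_of_nonneg (Real.sigmoid_nonneg x)]; exact Real.sigmoid_le_one x

theorem abs_deriv_sigmoid_le (x : ℝ) : |deriv Real.sigmoid x| ≤ 1 / 4 := by
  have h0 := Real.sigmoid_nonneg x
  have h1 := Real.sigmoid_le_one x
  rw [Real.deriv_sigmoid, abs_of_nonneg (mul_nonneg h0 (by linarith))]
  nlinarith [sq_nonneg (Real.sigmoid x - 1 / 2)]

theorem abs_deriv_deriv_sigmoid_le (x : ℝ) : |deriv (deriv Real.sigmoid) x| ≤ 1 / 4 := by
  have h0 := Real.sigmoid_nonneg x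
  have h1 := Real.sigmoid_le_one x
  have h2 := abs_deriv_sigmoid_le x
  rw [Real.deriv_sigmoid] at h2
  rw [deriv_deriv_sigmoid, abs_mul]
  have h3 : |1 - 2 * Real.sigmoid x| ≤ 1 := abs_le.2 ⟨by linarith, by linarith⟩
  simpa using mul_le_mul h2 h3 (abs_nonneg _) (by norm_num)

theorem abs_sigmoid_sub_le (x y : ℝ) : |Real.sigmoid x - Real.sigmoid y| ≤ 1 / 4 * |x - y| := by
  have := Convex.norm_image_sub_le_of_norm_deriv_le (f := Real.sigmoid) (C := 1 / 4)
    (fun x _ => differentiableAt_sigmoid) (fun x _ => abs_deriv_sigmoid_le x) convex_univ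
    (Set.mem_univ y) (Set.mem_univ x)
  simpa [Real.norm_eq_abs] using this

theorem abs_mean_mul_le {n : ℕ} {C r : ℝ} (hC : 0 ≤ C) (hr : 0 ≤ r) {a b : Fin n → ℝ}
    (ha : ∀ l, |a l| ≤ C) (hb : ∀ l, |b l| ≤ r) :
    |1 / (n : ℝ) * ∑ l, a l * b l| ≤ C * r := by
  rw [abs_mul]
  have h1 : |∑ l, a l * b l| ≤ n * (C * r) := by
    refine (Finset.abs_sum_le_sum_abs _ _).trans ?_
    refine (Finset.sum_le_sum (g := fun _ => C * r) fun l _ => ?_).trans (by simp)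
    rw [abs_mul]
    exact mul_le_mul (ha l) (hb l) (abs_nonneg _) hC
  rcases Nat.eq_zero_or_pos n with rfl | hn
  · simp; positivity
  · have hn' : (0 : ℝ) < n := by exact_mod_cast hn
    rw [abs_of_nonneg (by positivity), one_div, inv_mul_le_iff₀ hn']
    exact h1

theorem abs_one_div_mul_le (n : ℕ) (a : ℝ) : |1 / (n : ℝ) * a| ≤ |a| := by
  rw [abs_mul, abs_of_nonneg (by positivity : (0 : ℝ) ≤ 1 / (n : ℝ))]
  refine mul_le_of_le_one_left (abs_nonneg _) ?_
  rcases Nat.eq_zero_or_pos n with rfl | hn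
  · simp
  · rw [div_le_one (by exact_mod_cast hn)]
    exact_mod_cast hn

theorem abs_direct_le {ψ : ℝ → ℝ} {C r : ℝ} (hψ : ∀ x, |ψ x| ≤ C) (hr : 0 ≤ r) (θ : Param N d)
    (p : WeightIdx N d) {x : Fin d → ℝ} {s : Fin N → ℝ} (hx : ‖x‖ ≤ r) (hs : ‖s‖ ≤ r)
    (k : Fin N) : |direct ψ θ p x s k| ≤ C * r := by
  have hC : 0 ≤ C := (abs_nonneg _).trans (hψ 0)
  rcases p with ⟨i, j⟩ | ⟨i, j⟩ <;> simp only [direct] <;> split_ifs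
  · refine (abs_one_div_mul_le _ _).trans ?_
    rw [abs_mul]
    exact mul_le_mul (hψ _) ((norm_le_pi_norm x j).trans hx) (abs_nonneg _) hC
  · simp only [abs_zero]; positivity
  · refine (abs_one_div_mul_le _ _).trans ?_
    rw [abs_mul]
    exact mul_le_mul (hψ _) ((norm_le_pi_norm s j).trans hs) (abs_nonneg _) hC
  · simp only [abs_zero]; positivity

/-- `|ψ| ≤ C0`, `|ψ'| ≤ C1` and `|ψ''| ≤ C2`. -/
structure HasBounds (ψ : ℝ → ℝ) (C0 C1 C2 : ℝ) : Prop where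
  zero : ∀ r, |ψ r| ≤ C0
  one : ∀ r, |deriv ψ r| ≤ C1
  two : ∀ r, |deriv (deriv ψ) r| ≤ C2

section Bounds

variable {φ : ℝ → ℝ} {C1 C2 r₀ r₁ : ℝ}

theorem HasBounds.one_nonneg {C0 : ℝ} (hφ : HasBounds φ C0 C1 C2) : 0 ≤ C1 :=
  (abs_nonneg _).trans (hφ.one 0)

theorem norm_hiddenStep_fst_le (θ : Param N d) (x : Fin d → ℝ) (v : Hidden N d) :
    ‖(hiddenStep φ θ x v).1‖ ≤ 1 :=
  (pi_norm_le_iff_of_nonneg zero_le_one).2 fun _ => abs_sigmoid_le _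

theorem abs_preact₁_le (hφ : HasBounds φ 1 C1 C2) (θ : Param N d) {x : Fin d → ℝ} {v : Hidden N d}
    (hr : 1 ≤ r₀) (hx : ‖x‖ ≤ 1) (hs : ‖v.1‖ ≤ r₀) (p : WeightIdx N d) (k : Fin N) :
    |preact₁ φ θ x v p k| ≤ C1 * r₀ + ‖v.2.1‖ := by
  refine (abs_add_le _ _).trans (add_le_add (abs_direct_le hφ.one (by linarith) θ p
    (hx.trans hr) hs k) ?_)
  have := abs_mean_mul_le (C := 1) (r := ‖v.2.1‖) zero_le_one (norm_nonneg _)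
    (a := fun l => φ (matW θ k l)) (b := fun l => v.2.1 p l) (fun _ => hφ.zero _)
    fun l => (norm_le_pi_norm (v.2.1 p) l).trans (norm_le_pi_norm v.2.1 p)
  linarith

theorem norm_hiddenStep_snd_fst_le (hφ : HasBounds φ 1 C1 C2) (θ : Param N d) {x : Fin d → ℝ}
    {v : Hidden N d} (hr : 1 ≤ r₀) (hx : ‖x‖ ≤ 1) (hs : ‖v.1‖ ≤ r₀) :
    ‖(hiddenStep φ θ x v).2.1‖ ≤ C1 * r₀ / 4 + 1 / 4 * ‖v.2.1‖ := by
  have hC1 := hφ.one_nonneg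
  refine (pi_norm_le_iff_of_nonneg (by positivity)).2 fun p =>
    (pi_norm_le_iff_of_nonneg (by positivity)).2 fun k => ?_
  simp only [hiddenStep, Real.norm_eq_abs, abs_mul]
  have := mul_le_mul (abs_deriv_sigmoid_le (preact φ θ x v.1 k))
    (abs_preact₁_le hφ θ hr hx hs p k) (abs_nonneg _) (by norm_num)
  linarith

/-- The constant term in the bound for the updated second derivatives. -/
def hessDrift (C1 C2 r₀ r₁ : ℝ) : ℝ := ((C1 * r₀ + r₁) ^ 2 + C2 * r₀ + 2 * (C1 * r₁)) / 4

theorem norm_hiddenStep_snd_snd_le (hφ : HasBounds φ 1 C1 C2) (θ : Param N d) {x : Fin d → ℝ}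
    {v : Hidden N d} (hr : 1 ≤ r₀) (hx : ‖x‖ ≤ 1) (hs : ‖v.1‖ ≤ r₀) (hs' : ‖v.2.1‖ ≤ r₁) :
    ‖(hiddenStep φ θ x v).2.2‖ ≤ hessDrift C1 C2 r₀ r₁ + 1 / 4 * ‖v.2.2‖ := by
  have hC1 := hφ.one_nonneg
  have hC2 : 0 ≤ C2 := (abs_nonneg _).trans (hφ.two 0)
  have hr₁ : 0 ≤ r₁ := (norm_nonneg _).trans hs'
  have h0 : 0 ≤ hessDrift C1 C2 r₀ r₁ := by unfold hessDrift; positivity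
  refine (pi_norm_le_iff_of_nonneg (by positivity)).2 fun p =>
    (pi_norm_le_iff_of_nonneg (by positivity)).2 fun q =>
    (pi_norm_le_iff_of_nonneg (by positivity)).2 fun k => ?_
  have hp : ∀ p, |preact₁ φ θ x v p k| ≤ C1 * r₀ + r₁ := fun p =>
    (abs_preact₁_le hφ θ hr hx hs p k).trans (by linarith)
  have hd : ∀ p q, |direct (deriv φ) θ p 0 (v.2.1 q) k| ≤ C1 * r₁ := fun p q =>
    abs_direct_le hφ.one hr₁ θ p (by simpa using hr₁) ((norm_le_pi_norm v.2.1 q).trans hs') k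
  have hm : |1 / (N : ℝ) * ∑ l, φ (matW θ k l) * v.2.2 p q l| ≤ 1 * ‖v.2.2‖ :=
    abs_mean_mul_le zero_le_one (norm_nonneg _) (fun _ => hφ.zero _) fun l =>
      (norm_le_pi_norm (v.2.2 p q) l).trans ((norm_le_pi_norm (v.2.2 p) q).trans
        (norm_le_pi_norm v.2.2 p))
  have hpq : |if p = q then direct (deriv (deriv φ)) θ p x v.1 k else 0| ≤ C2 * r₀ := by
    split_ifs
    · exact abs_direct_le hφ.two (by linarith) θ p (hx.trans hr) hs k
    · simp only [abs_zero]; positivity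
  have h2 : |preact₂ φ θ x v p q k| ≤ C2 * r₀ + 2 * (C1 * r₁) + ‖v.2.2‖ := by
    unfold preact₂
    refine (abs_add_le _ _).trans ?_
    have a1 := abs_add_le ((if p = q then direct (deriv (deriv φ)) θ p x v.1 k else 0) +
      direct (deriv φ) θ p 0 (v.2.1 q) k) (direct (deriv φ) θ q 0 (v.2.1 p) k)
    have a2 := abs_add_le (if p = q then direct (deriv (deriv φ)) θ p x v.1 k else 0)
      (direct (deriv φ) θ p 0 (v.2.1 q) k)
    linarith [hd p q, hd q p]
  have b1 : |deriv (deriv Real.sigmoid) (preact φ θ x v.1 k) * preact₁ φ θ x v p k *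
      preact₁ φ θ x v q k| ≤ 1 / 4 * (C1 * r₀ + r₁) * (C1 * r₀ + r₁) := by
    rw [abs_mul, abs_mul]
    gcongr
    · exact abs_deriv_deriv_sigmoid_le _
    · exact hp p
    · exact hp q
  have b2 : |deriv Real.sigmoid (preact φ θ x v.1 k) * preact₂ φ θ x v p q k| ≤
      1 / 4 * (C2 * r₀ + 2 * (C1 * r₁) + ‖v.2.2‖) := by
    rw [abs_mul]
    exact mul_le_mul (abs_deriv_sigmoid_le _) h2 (abs_nonneg _) (by norm_num)
  refine (abs_add_le _ _).trans ((add_le_add b1 b2).trans (le_of_eq ?_))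
  unfold hessDrift
  ring

end Bounds

/-! ### The truncated update is Lipschitz -/

section Lip

variable {ι : Type*} {φ : ℝ → ℝ} {C1 C2 r₀ r₁ r₂ : ℝ}

theorem unifLip_clipData (j : Fin d) :
    UnifLip (fun (_ : ι) (h : Data d dZ × Hidden N d) => clipData h.1 j) := by
  refine ⟨1, zero_le_one, fun _ _ => abs_clip_le zero_le_one _, fun _ h h' => ?_⟩
  rw [one_mul]
  refine (abs_clip_sub_clip_le _ _ _).trans ?_
  exact (dist_le_pi_dist h.1.1 h'.1.1 j).trans ((le_max_left _ _).trans (le_max_left _ _))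

theorem dist_apply_fst_le (v v' : Hidden N d) (k : Fin N) : |v.1 k - v'.1 k| ≤ dist v v' :=
  (dist_le_pi_dist v.1 v'.1 k).trans (le_max_left _ _)

theorem dist_apply_snd_fst_le (v v' : Hidden N d) (p : WeightIdx N d) (k : Fin N) :
    |v.2.1 p k - v'.2.1 p k| ≤ dist v v' :=
  (dist_le_pi_dist (v.2.1 p) (v'.2.1 p) k).trans ((dist_le_pi_dist v.2.1 v'.2.1 p).trans
    ((le_max_left _ _).trans (le_max_right _ _)))

theorem dist_apply_snd_snd_le (v v' : Hidden N d) (p q : WeightIdx N d) (k : Fin N) :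
    |v.2.2 p q k - v'.2.2 p q k| ≤ dist v v' :=
  (dist_le_pi_dist (v.2.2 p q) (v'.2.2 p q) k).trans ((dist_le_pi_dist (v.2.2 p) (v'.2.2 p) q).trans
    ((dist_le_pi_dist v.2.2 v'.2.2 p).trans ((le_max_right _ _).trans (le_max_right _ _))))

theorem dist_snd_le_dist {X Y : Type*} [PseudoMetricSpace X] [PseudoMetricSpace Y] (h h' : X × Y) :
    dist h.2 h'.2 ≤ dist h h' :=
  le_max_right _ _

theorem unifLip_clipHidden_fst (hr₀ : 0 ≤ r₀) (k : Fin N) :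
    UnifLip (fun (_ : ι) (h : Data d dZ × Hidden N d) => (clipHidden r₀ r₁ r₂ h.2).1 k) := by
  refine ⟨max r₀ 1, by positivity, fun _ _ => (abs_clip_le hr₀ _).trans (le_max_left _ _),
    fun _ h h' => (abs_clip_sub_clip_le _ _ _).trans ?_⟩
  refine ((dist_apply_fst_le h.2 h'.2 k).trans (dist_snd_le_dist h h')).trans ?_
  exact le_mul_of_one_le_left dist_nonneg (le_max_right _ _)

theorem unifLip_clipHidden_snd_fst (hr₁ : 0 ≤ r₁) (p : WeightIdx N d) (k : Fin N) :
    UnifLip (fun (_ : ι) (h : Data d dZ × Hidden N d) => (clipHidden r₀ r₁ r₂ h.2).2.1 p k) := by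
  refine ⟨max r₁ 1, by positivity, fun _ _ => (abs_clip_le hr₁ _).trans (le_max_left _ _),
    fun _ h h' => (abs_clip_sub_clip_le _ _ _).trans ?_⟩
  refine ((dist_apply_snd_fst_le h.2 h'.2 p k).trans (dist_snd_le_dist h h')).trans ?_
  exact le_mul_of_one_le_left dist_nonneg (le_max_right _ _)

theorem unifLip_clipHidden_snd_snd (hr₂ : 0 ≤ r₂) (p q : WeightIdx N d) (k : Fin N) :
    UnifLip (fun (_ : ι) (h : Data d dZ × Hidden N d) =>
      (clipHidden r₀ r₁ r₂ h.2).2.2 p q k) := by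
  refine ⟨max r₂ 1, by positivity, fun _ _ => (abs_clip_le hr₂ _).trans (le_max_left _ _),
    fun _ h h' => (abs_clip_sub_clip_le _ _ _).trans ?_⟩
  refine ((dist_apply_snd_snd_le h.2 h'.2 p q k).trans (dist_snd_le_dist h h')).trans ?_
  exact le_mul_of_one_le_left dist_nonneg (le_max_right _ _)

variable {E : Type*} [PseudoMetricSpace E] {x : E → Fin d → ℝ} {s : E → Fin N → ℝ}
  (θ : ι → Param N d)

theorem unifLip_preact (hφ : HasBounds φ 1 C1 C2)
    (hx : ∀ j, UnifLip fun (_ : ι) h => x h j) (hs : ∀ k, UnifLip fun (_ : ι) h => s h k)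
    (k : Fin N) : UnifLip fun i h => preact φ (θ i) (x h) (s h) k := by
  refine UnifLip.add ?_ ?_
  · exact (UnifLip.const fun _ => le_rfl).mul
      (UnifLip.sum _ fun j => (UnifLip.const fun i => hφ.zero (matA (θ i) k j)).mul (hx j))
  · exact (UnifLip.const fun _ => le_rfl).mul
      (UnifLip.sum _ fun l => (UnifLip.const fun i => hφ.zero (matW (θ i) k l)).mul (hs l))

theorem unifLip_direct {ψ : ℝ → ℝ} {C : ℝ} (hψ : ∀ r, |ψ r| ≤ C)
    (hx : ∀ j, UnifLip fun (_ : ι) h => x h j) (hs : ∀ k, UnifLip fun (_ : ι) h => s h k)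
    (p : WeightIdx N d) (k : Fin N) : UnifLip fun i h => direct ψ (θ i) p (x h) (s h) k := by
  rcases p with ⟨i, j⟩ | ⟨i, j⟩ <;> by_cases hik : i = k <;>
    simp only [direct, hik, if_true, if_false]
  · exact (UnifLip.const fun _ => le_rfl).mul ((UnifLip.const fun i => hψ _).mul (hx j))
  · exact UnifLip.zero
  · exact (UnifLip.const fun _ => le_rfl).mul ((UnifLip.const fun i => hψ _).mul (hs j))
  · exact UnifLip.zero

theorem unifLip_sigmoid {g : ι → E → ℝ} (hg : UnifLip g) :
    UnifLip fun i h => Real.sigmoid (g i h) :=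
  hg.comp abs_sigmoid_le abs_sigmoid_sub_le (by norm_num)

theorem unifLip_deriv_sigmoid {g : ι → E → ℝ} (hg : UnifLip g) :
    UnifLip fun i h => deriv Real.sigmoid (g i h) := by
  simp only [Real.deriv_sigmoid]
  exact (unifLip_sigmoid hg).mul ((UnifLip.const fun _ => le_rfl).sub (unifLip_sigmoid hg))

theorem unifLip_deriv_deriv_sigmoid {g : ι → E → ℝ} (hg : UnifLip g) :
    UnifLip fun i h => deriv (deriv Real.sigmoid) (g i h) := by
  simp only [deriv_deriv_sigmoid]
  have h := unifLip_sigmoid hg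
  exact (h.mul ((UnifLip.const fun _ => le_rfl).sub h)).mul
    ((UnifLip.const fun _ => le_rfl).sub ((UnifLip.const fun _ => le_rfl).mul h))

variable (r₀ r₁ r₂)

theorem unifLip_clippedStep_fst (hφ : HasBounds φ 1 C1 C2) (hr₀ : 0 ≤ r₀) (k : Fin N) :
    UnifLip fun i (h : Data d dZ × Hidden N d) =>
      (clippedStep φ (θ i) r₀ r₁ r₂ h.1 h.2).1 k :=
  unifLip_sigmoid (unifLip_preact θ hφ (fun j => unifLip_clipData j)
    (fun k => unifLip_clipHidden_fst hr₀ k) k)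

theorem unifLip_preact₁ (hφ : HasBounds φ 1 C1 C2) (hr₀ : 0 ≤ r₀) (hr₁ : 0 ≤ r₁)
    (p : WeightIdx N d) (k : Fin N) : UnifLip fun i (h : Data d dZ × Hidden N d) =>
      preact₁ φ (θ i) (clipData h.1) (clipHidden r₀ r₁ r₂ h.2) p k :=
  (unifLip_direct θ hφ.one (fun j => unifLip_clipData j)
    (fun k => unifLip_clipHidden_fst hr₀ k) p k).add
    ((UnifLip.const fun _ => le_rfl).mul (UnifLip.sum _ fun l =>
      (UnifLip.const fun i => hφ.zero (matW (θ i) k l)).mul (unifLip_clipHidden_snd_fst hr₁ p l)))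

theorem unifLip_clippedStep_snd_fst (hφ : HasBounds φ 1 C1 C2) (hr₀ : 0 ≤ r₀) (hr₁ : 0 ≤ r₁)
    (p : WeightIdx N d) (k : Fin N) : UnifLip fun i (h : Data d dZ × Hidden N d) =>
      (clippedStep φ (θ i) r₀ r₁ r₂ h.1 h.2).2.1 p k :=
  (unifLip_deriv_sigmoid (unifLip_preact θ hφ (fun j => unifLip_clipData j)
    (fun k => unifLip_clipHidden_fst hr₀ k) k)).mul (unifLip_preact₁ r₀ r₁ r₂ θ hφ hr₀ hr₁ p k)

theorem unifLip_clippedStep_snd_snd (hφ : HasBounds φ 1 C1 C2) (hr₀ : 0 ≤ r₀) (hr₁ : 0 ≤ r₁)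
    (hr₂ : 0 ≤ r₂) (p q : WeightIdx N d) (k : Fin N) :
    UnifLip fun i (h : Data d dZ × Hidden N d) =>
      (clippedStep φ (θ i) r₀ r₁ r₂ h.1 h.2).2.2 p q k := by
  have ha : UnifLip fun i (h : Data d dZ × Hidden N d) =>
      preact φ (θ i) (clipData h.1) (clipHidden r₀ r₁ r₂ h.2).1 k :=
    unifLip_preact θ hφ (fun j => unifLip_clipData j) (fun k => unifLip_clipHidden_fst hr₀ k) k
  have hd : ∀ p q, UnifLip fun i (h : Data d dZ × Hidden N d) =>
      direct (deriv φ) (θ i) p 0 ((clipHidden r₀ r₁ r₂ h.2).2.1 q) k := fun p q =>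
    unifLip_direct (x := fun _ => 0) θ hφ.one (fun _ => UnifLip.zero)
      (fun k => unifLip_clipHidden_snd_fst hr₁ q k) p k
  simp only [clippedStep, hiddenStep, preact₂]
  refine (((unifLip_deriv_deriv_sigmoid ha).mul (unifLip_preact₁ r₀ r₁ r₂ θ hφ hr₀ hr₁ p k)).mul
    (unifLip_preact₁ r₀ r₁ r₂ θ hφ hr₀ hr₁ q k)).add ((unifLip_deriv_sigmoid ha).mul ?_)
  refine ((UnifLip.add ?_ (hd p q)).add (hd q p)).add
    ((UnifLip.const fun _ => le_rfl).mul (UnifLip.sum _ fun l =>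
      (UnifLip.const fun i => hφ.zero (matW (θ i) k l)).mul
        (unifLip_clipHidden_snd_snd hr₂ p q l)))
  by_cases hpq : p = q
  · simp only [hpq, if_true]
    exact unifLip_direct θ hφ.two (fun j => unifLip_clipData j)
      (fun k => unifLip_clipHidden_fst hr₀ k) q k
  · simp only [hpq, if_false]
    exact UnifLip.zero

end Lip

/-! ### The joint chain is contractive -/

section Contraction

variable {φ : ℝ → ℝ} {C1 C2 r₀ r₁ r₂ Lw : ℝ}

theorem abs_mean_sub_mean_le {n : ℕ} {a b c : Fin n → ℝ} {r : ℝ} (hr : 0 ≤ r)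
    (ha : ∀ l, |a l| ≤ 1) (hbc : ∀ l, |b l - c l| ≤ r) :
    |1 / (n : ℝ) * ∑ l, a l * b l - 1 / (n : ℝ) * ∑ l, a l * c l| ≤ r := by
  have := abs_mean_mul_le zero_le_one hr ha hbc
  rw [one_mul] at this
  rwa [← mul_sub, ← Finset.sum_sub_distrib, Finset.sum_congr rfl fun l _ => (mul_sub _ _ _).symm]

/-- The hidden update is block triangular: each of the three levels depends on itself through the
mean `1 / N * ∑ φ(W) ·` inside a sigmoid of slope at most `1 / 4`, hence with factor `1 / 4`, and
in a Lipschitz way on the data and the levels before it. -/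
theorem exists_clippedStep_bounds (hφ : HasBounds φ 1 C1 C2) (hr₀ : 0 ≤ r₀) (hr₁ : 0 ≤ r₁)
    (hr₂ : 0 ≤ r₂) :
    ∃ C, 0 ≤ C ∧ ∀ (θ : Param N d) (u u' : Data d dZ) (v v' : Hidden N d),
      ‖(clippedStep φ θ r₀ r₁ r₂ u v).1 - (clippedStep φ θ r₀ r₁ r₂ u' v').1‖ ≤
        1 / 4 * ‖v.1 - v'.1‖ + C * ‖u - u'‖ ∧
      ‖(clippedStep φ θ r₀ r₁ r₂ u v).2.1 - (clippedStep φ θ r₀ r₁ r₂ u' v').2.1‖ ≤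
        1 / 4 * ‖v.2.1 - v'.2.1‖ + C * (‖u - u'‖ + ‖v.1 - v'.1‖) ∧
      ‖(clippedStep φ θ r₀ r₁ r₂ u v).2.2 - (clippedStep φ θ r₀ r₁ r₂ u' v').2.2‖ ≤
        1 / 4 * ‖v.2.2 - v'.2.2‖ + C * (‖u - u'‖ + ‖v.1 - v'.1‖ + ‖v.2.1 - v'.2.1‖) := by
  obtain ⟨c0, hc0, -, h0⟩ := UnifLip.uncurry fun k =>
    unifLip_clippedStep_fst (dZ := dZ) r₀ r₁ r₂ (fun θ : Param N d => θ) hφ hr₀ k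
  obtain ⟨c1, hc1, -, h1⟩ := UnifLip.uncurry fun pk : WeightIdx N d × Fin N =>
    unifLip_clippedStep_snd_fst (dZ := dZ) r₀ r₁ r₂ (fun θ : Param N d => θ) hφ hr₀ hr₁ pk.1 pk.2
  obtain ⟨c2, hc2, -, h2⟩ := UnifLip.uncurry
    fun pqk : WeightIdx N d × WeightIdx N d × Fin N =>
      unifLip_clippedStep_snd_snd (dZ := dZ) r₀ r₁ r₂ (fun θ : Param N d => θ) hφ hr₀ hr₁ hr₂
        pqk.1 pqk.2.1 pqk.2.2
  refine ⟨max c0 (max c1 c2), by positivity, fun θ u u' v v' => ⟨?_, ?_, ?_⟩⟩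
  · refine (pi_norm_le_iff_of_nonneg (by positivity)).2 fun k => ?_
    have a1 := h0 (k, θ) (u, v) (u', v)
    have a2 : |(clippedStep φ θ r₀ r₁ r₂ u' v).1 k - (clippedStep φ θ r₀ r₁ r₂ u' v').1 k| ≤
        1 / 4 * ‖v.1 - v'.1‖ := by
      refine (abs_sigmoid_sub_le _ _).trans (mul_le_mul_of_nonneg_left ?_ (by norm_num))
      simp only [preact, add_sub_add_left_eq_sub]
      refine abs_mean_sub_mean_le (norm_nonneg _) (fun l => hφ.zero _) fun l => ?_
      exact (abs_clip_sub_clip_le _ _ _).trans (norm_le_pi_norm (v.1 - v'.1) l)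
    have hd : dist (u, v) (u', v) = ‖u - u'‖ := by
      rw [Prod.dist_eq, dist_self, dist_eq_norm]
      exact max_eq_left (norm_nonneg _)
    rw [hd] at a1
    have := abs_sub_le ((clippedStep φ θ r₀ r₁ r₂ u v).1 k) ((clippedStep φ θ r₀ r₁ r₂ u' v).1 k)
      ((clippedStep φ θ r₀ r₁ r₂ u' v').1 k)
    have h3 : c0 * ‖u - u'‖ ≤ max c0 (max c1 c2) * ‖u - u'‖ :=
      mul_le_mul_of_nonneg_right (le_max_left _ _) (norm_nonneg _)
    exact this.trans (by linarith)
  · refine (pi_norm_le_iff_of_nonneg (by positivity)).2 fun p =>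
      (pi_norm_le_iff_of_nonneg (by positivity)).2 fun k => ?_
    let w : Hidden N d := (v'.1, v.2)
    have a1 := h1 ((p, k), θ) (u, v) (u', w)
    have a2 : |(clippedStep φ θ r₀ r₁ r₂ u' w).2.1 p k -
        (clippedStep φ θ r₀ r₁ r₂ u' v').2.1 p k| ≤ 1 / 4 * ‖v.2.1 - v'.2.1‖ := by
      simp only [clippedStep, hiddenStep, clipHidden, w]
      rw [← mul_sub, abs_mul]
      refine mul_le_mul (abs_deriv_sigmoid_le _) ?_ (abs_nonneg _) (by norm_num)
      simp only [preact₁, add_sub_add_left_eq_sub]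
      refine abs_mean_sub_mean_le (norm_nonneg _) (fun l => hφ.zero _) fun l => ?_
      exact (abs_clip_sub_clip_le _ _ _).trans
        ((norm_le_pi_norm ((v.2.1 - v'.2.1) p) l).trans (norm_le_pi_norm (v.2.1 - v'.2.1) p))
    have hd : dist (u, v) (u', w) ≤ ‖u - u'‖ + ‖v.1 - v'.1‖ := by
      change max (dist u u') (max (dist v.1 v'.1) (dist v.2 v.2)) ≤ _
      rw [dist_self, dist_eq_norm, dist_eq_norm]
      have := norm_nonneg (u - u')
      have := norm_nonneg (v.1 - v'.1)
      exact max_le (by linarith) (max_le (by linarith) (by linarith))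
    have := abs_sub_le ((clippedStep φ θ r₀ r₁ r₂ u v).2.1 p k)
      ((clippedStep φ θ r₀ r₁ r₂ u' w).2.1 p k) ((clippedStep φ θ r₀ r₁ r₂ u' v').2.1 p k)
    have h3 : c1 * dist (u, v) (u', w) ≤ max c0 (max c1 c2) * (‖u - u'‖ + ‖v.1 - v'.1‖) :=
      mul_le_mul ((le_max_left _ _).trans (le_max_right _ _)) hd dist_nonneg (by positivity)
    exact this.trans (by linarith)
  · refine (pi_norm_le_iff_of_nonneg (by positivity)).2 fun p =>
      (pi_norm_le_iff_of_nonneg (by positivity)).2 fun q =>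
      (pi_norm_le_iff_of_nonneg (by positivity)).2 fun k => ?_
    let w : Hidden N d := (v'.1, v'.2.1, v.2.2)
    have a1 := h2 ((p, q, k), θ) (u, v) (u', w)
    have a2 : |(clippedStep φ θ r₀ r₁ r₂ u' w).2.2 p q k -
        (clippedStep φ θ r₀ r₁ r₂ u' v').2.2 p q k| ≤ 1 / 4 * ‖v.2.2 - v'.2.2‖ := by
      simp only [clippedStep, hiddenStep, preact₁, clipHidden, w]
      rw [add_sub_add_left_eq_sub, ← mul_sub, abs_mul]
      refine mul_le_mul (abs_deriv_sigmoid_le _) ?_ (abs_nonneg _) (by norm_num)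
      simp only [preact₂, add_sub_add_left_eq_sub]
      refine abs_mean_sub_mean_le (norm_nonneg _) (fun l => hφ.zero _) fun l => ?_
      exact (abs_clip_sub_clip_le _ _ _).trans ((norm_le_pi_norm ((v.2.2 - v'.2.2) p q) l).trans
        ((norm_le_pi_norm ((v.2.2 - v'.2.2) p) q).trans (norm_le_pi_norm (v.2.2 - v'.2.2) p)))
    have hd : dist (u, v) (u', w) ≤ ‖u - u'‖ + ‖v.1 - v'.1‖ + ‖v.2.1 - v'.2.1‖ := by
      change max (dist u u') (max (dist v.1 v'.1) (max (dist v.2.1 v'.2.1) (dist v.2.2 v.2.2))) ≤ _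
      rw [dist_self, dist_eq_norm, dist_eq_norm, dist_eq_norm]
      have := norm_nonneg (u - u')
      have := norm_nonneg (v.1 - v'.1)
      have := norm_nonneg (v.2.1 - v'.2.1)
      exact max_le (by linarith) (max_le (by linarith) (max_le (by linarith) (by linarith)))
    have := abs_sub_le ((clippedStep φ θ r₀ r₁ r₂ u v).2.2 p q k)
      ((clippedStep φ θ r₀ r₁ r₂ u' w).2.2 p q k) ((clippedStep φ θ r₀ r₁ r₂ u' v').2.2 p q k)
    have h3 : c2 * dist (u, v) (u', w) ≤
        max c0 (max c1 c2) * (‖u - u'‖ + ‖v.1 - v'.1‖ + ‖v.2.1 - v'.2.1‖) :=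
      mul_le_mul ((le_max_right _ _).trans (le_max_right _ _)) hd dist_nonneg (by positivity)
    exact this.trans (by linarith)

/-- The weighted distance of two hidden states. -/
def hiddenCost (M₁ M₂ : ℝ) (v v' : Hidden N d) : ℝ :=
  M₂ * ‖v.1 - v'.1‖ + M₁ * ‖v.2.1 - v'.2.1‖ + ‖v.2.2 - v'.2.2‖

/-- For suitable weights, which do not depend on the parameter, the joint chain of the data and the
truncated hidden state is contractive. -/
theorem exists_isContractive (κ : Kernel (Data d dZ) (Data d dZ)) [IsMarkovKernel κ]
    (hLw0 : 0 ≤ Lw) (hLw1 : Lw < 1)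
    (hκ : ∀ u u' : Data d dZ, wass 2 (κ u) (κ u') ≤ ENNReal.ofReal (Lw * ‖u - u'‖))
    (hφ : HasBounds φ 1 C1 C2) (hr₀ : 0 ≤ r₀) (hr₁ : 0 ≤ r₁) (hr₂ : 0 ≤ r₂) :
    ∃ M M₁ M₂ : ℝ, 1 ≤ M ∧ 1 ≤ M₁ ∧ 1 ≤ M₂ ∧ ∀ θ : Param N d,
      IsContractive κ (clippedStep φ θ r₀ r₁ r₂) M (hiddenCost M₁ M₂) ((1 + Lw) / 2) := by
  obtain ⟨C, hC, h⟩ := exists_clippedStep_bounds (N := N) (d := d) (dZ := dZ) hφ hr₀ hr₁ hr₂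
  -- each weight dominates the cross terms that its level feeds into the later levels
  obtain ⟨M₁, hM₁⟩ : ∃ M₁, M₁ = 1 + 4 * C := ⟨_, rfl⟩
  obtain ⟨M₂, hM₂⟩ : ∃ M₂, M₂ = 1 + 4 * (C * (M₁ + 1)) := ⟨_, rfl⟩
  have h1 : 1 ≤ M₁ := by linarith
  have h2 : 1 ≤ M₂ := by
    have : 0 ≤ C * (M₁ + 1) := mul_nonneg hC (by linarith)
    linarith
  have hgap : 0 < (1 + Lw) / 2 - Lw := by linarith
  obtain ⟨M, hM⟩ : ∃ M, M = 1 + C * (M₂ + M₁ + 1) / ((1 + Lw) / 2 - Lw) := ⟨_, rfl⟩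
  have hX : 0 ≤ C * (M₂ + M₁ + 1) := mul_nonneg hC (by linarith)
  have hM1 : 1 ≤ M := by
    have : 0 ≤ C * (M₂ + M₁ + 1) / ((1 + Lw) / 2 - Lw) := div_nonneg hX hgap.le
    linarith
  have hMX : C * (M₂ + M₁ + 1) ≤ ((1 + Lw) / 2 - Lw) * M := by
    rw [hM, mul_add ((1 + Lw) / 2 - Lw), mul_div_cancel₀ _ hgap.ne']
    linarith
  refine ⟨M, M₁, M₂, hM1, h1, h2, fun θ => ⟨by linarith, by linarith, hM1, fun v v' => ?_, ?_,
    Lw, fun g b K hg hb hK hl u u' => ?_, fun u v u' v' => ?_⟩⟩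
  · have a0 := norm_nonneg (v.1 - v'.1)
    have a1 := norm_nonneg (v.2.1 - v'.2.1)
    have a2 := norm_nonneg (v.2.2 - v'.2.2)
    simp only [hiddenCost, dist_eq_norm, Prod.norm_def, Prod.fst_sub, Prod.snd_sub]
    exact max_le (by nlinarith) (max_le (by nlinarith) (by nlinarith))
  · refine ⟨M₂ + M₁ + 1, by linarith, fun v v' => ?_⟩
    have a0 : ‖v.1 - v'.1‖ ≤ dist v v' := by rw [← dist_eq_norm]; exact le_max_left _ _
    have a1 : ‖v.2.1 - v'.2.1‖ ≤ dist v v' := by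
      rw [← dist_eq_norm]; exact (le_max_left _ _).trans (le_max_right _ _)
    have a2 : ‖v.2.2 - v'.2.2‖ ≤ dist v v' := by
      rw [← dist_eq_norm]; exact (le_max_right _ _).trans (le_max_right _ _)
    unfold hiddenCost
    nlinarith
  · exact abs_integral_sub_le_of_wass_le (by positivity) (hκ u u') hg hb hK hl
  · obtain ⟨b0, b1, b2⟩ := h θ u u' v v'
    have a0 := norm_nonneg (v.1 - v'.1)
    have a1 := norm_nonneg (v.2.1 - v'.2.1)
    have a2 := norm_nonneg (v.2.2 - v'.2.2)
    have a3 := norm_nonneg (u - u')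
    have e0 := mul_le_mul_of_nonneg_left b0 (zero_le_one.trans h2)
    have e1 := mul_le_mul_of_nonneg_left b1 (zero_le_one.trans h1)
    have e3 := mul_le_mul_of_nonneg_right hMX a3
    unfold hiddenCost
    generalize ‖v.1 - v'.1‖ = x0 at *
    generalize ‖v.2.1 - v'.2.1‖ = x1 at *
    generalize ‖v.2.2 - v'.2.2‖ = x2 at *
    generalize ‖u - u'‖ = y at *
    have f0 : C * M₁ * x0 + C * x0 = 1 / 4 * M₂ * x0 - 1 / 4 * x0 := by rw [hM₂]; ring
    have f1 : C * x1 = 1 / 4 * M₁ * x1 - 1 / 4 * x1 := by rw [hM₁]; ring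
    have g0 : 0 ≤ (1 + Lw) / 2 * (M₂ * x0 + M₁ * x1 + x2) -
        1 / 2 * (M₂ * x0 + M₁ * x1 + x2) := by
      have : 0 ≤ M₂ * x0 + M₁ * x1 + x2 := by positivity
      nlinarith
    nlinarith

/-! ### The carrier of the joint chain -/

/-- The set that carries the joint chain: data in the unit ball, hidden state within the radii
`r₀`, `r₁` and `r₂`. -/
def carrier (N d dZ : ℕ) (r₀ r₁ r₂ : ℝ) : Set (State N d dZ) :=
  {h | ‖h.1‖ ≤ 1 ∧ ‖h.2.1.1‖ ≤ r₀ ∧ ‖h.2.1.2.1‖ ≤ r₁ ∧ ‖h.2.1.2.2‖ ≤ r₂}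

theorem isClosed_carrier : IsClosed (carrier N d dZ r₀ r₁ r₂) := by
  unfold carrier
  simp only [Set.ofPred_and]
  refine IsClosed.inter ?_ (IsClosed.inter ?_ (IsClosed.inter ?_ ?_)) <;>
    exact isClosed_le (by fun_prop) continuous_const

theorem cost_le_of_mem_carrier {M M₁ M₂ : ℝ} (hM : 0 ≤ M) (hM₁ : 0 ≤ M₁) (hM₂ : 0 ≤ M₂) :
    ∀ h ∈ carrier N d dZ r₀ r₁ r₂, ∀ h' ∈ carrier N d dZ r₀ r₁ r₂,
      M * ‖h.1 - h'.1‖ + hiddenCost M₁ M₂ h.2.1 h'.2.1 ≤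
        M * 2 + (M₂ * (2 * r₀) + M₁ * (2 * r₁) + 2 * r₂) := by
  rintro h ⟨a0, a1, a2, a3⟩ h' ⟨b0, b1, b2, b3⟩
  unfold hiddenCost
  gcongr
  · exact (norm_sub_le _ _).trans (by linarith)
  · exact (norm_sub_le _ _).trans (by linarith)
  · exact (norm_sub_le _ _).trans (by linarith)
  · exact (norm_sub_le _ _).trans (by linarith)

theorem clippedStep_eq_of_mem_carrier (θ : Param N d) {h : State N d dZ}
    (hh : h ∈ carrier N d dZ r₀ r₁ r₂) :
    clippedStep φ θ r₀ r₁ r₂ h.1 h.2.1 = hiddenStep φ θ h.1.1 h.2.1 := by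
  obtain ⟨a0, a1, a2, a3⟩ := hh
  rw [clippedStep, clipData_eq a0, clipHidden_eq a1 a2 a3]

end Contraction

/-! ### Stationary distributions are carried by a bounded set -/

/-- A nonnegative function of the hidden state that every update at least halves vanishes almost
everywhere for a stationary distribution. No integrability is needed: the mean of `arctan ∘ W` is
preserved by stationarity, but halving `W` decreases it strictly where `W ≠ 0`. -/
theorem ae_eq_zero_of_invariant {A V : Type*} [MeasurableSpace A] [MeasurableSpace V]
    {κ : Kernel A A} [IsMarkovKernel κ] {μη : Measure ℝ} [IsProbabilityMeasure μη] {F : A → V → V}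
    {hF : Measurable fun h : A × V × ℝ => F h.1 h.2.1} {ν : Measure (A × V × ℝ)}
    [IsProbabilityMeasure ν] (hν : (stepKernel κ μη F hF).Invariant ν) {W : V → ℝ}
    (hW : Measurable W) (hW0 : ∀ v, 0 ≤ W v)
    (h : ∀ᵐ x ∂ν, W (F x.1 x.2.1) ≤ 1 / 2 * W x.2.1) : ∀ᵐ x ∂ν, W x.2.1 = 0 := by
  have hb : ∀ y : ℝ, |Real.arctan y| ≤ Real.pi / 2 := fun y =>
    abs_le.2 ⟨(Real.neg_pi_div_two_lt_arctan y).le, (Real.arctan_lt_pi_div_two y).le⟩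
  have hm : Measurable fun x : A × V × ℝ => Real.arctan (W x.2.1) := by fun_prop
  have hm' : Measurable fun x : A × V × ℝ => Real.arctan (1 / 2 * W x.2.1) := by fun_prop
  have hFm : Measurable fun x : A × V × ℝ => Real.arctan (W (F x.1 x.2.1)) :=
    Real.continuous_arctan.measurable.comp (hW.comp hF)
  have hint : ∀ g : A × V × ℝ → ℝ, Measurable (fun x => Real.arctan (g x)) →
      Integrable (fun x => Real.arctan (g x)) ν := fun g hg =>
    Integrable.of_bound hg.aestronglyMeasurable _ (Eventually.of_forall fun x => hb _)
  have h1 : ∫ x, Real.arctan (W x.2.1) ∂ν = ∫ x, Real.arctan (W (F x.1 x.2.1)) ∂ν := by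
    have h2 := integral_bind_of_bounded (stepKernel κ μη F hF) ν hm (fun x => hb _)
    rw [hν.def] at h2
    rw [h2]
    refine integral_congr_ae (Eventually.of_forall fun x => ?_)
    simp only
    rw [integral_stepKernel x hm (fun x => hb _)]
    simp
  have h3 : ∫ x, (Real.arctan (W x.2.1) - Real.arctan (1 / 2 * W x.2.1)) ∂ν ≤ 0 := by
    rw [integral_sub (hint _ hm) (hint _ hm'), h1, sub_nonpos]
    exact integral_mono_ae (hint _ hFm) (hint _ hm')
      (h.mono fun x hx => Real.arctan_strictMono.monotone hx)
  have h4 : ∀ x : A × V × ℝ, 0 ≤ Real.arctan (W x.2.1) - Real.arctan (1 / 2 * W x.2.1) := by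
    intro x
    have := hW0 x.2.1
    exact sub_nonneg.2 (Real.arctan_strictMono.monotone (by linarith))
  have h5 := (integral_eq_zero_iff_of_nonneg h4 ((hint _ hm).sub (hint _ hm'))).1
    (le_antisymm h3 (integral_nonneg h4))
  filter_upwards [h5] with x hx
  have := Real.arctan_injective (sub_eq_zero.1 hx)
  linarith

/-- If one trajectory of laws of a Wasserstein-contractive chain stays in the unit ball, so does
every stationary distribution: the chain started at any point approaches the ball. -/
theorem ae_norm_le_one_of_invariant {A : Type*} [NormedAddCommGroup A] [MeasurableSpace A]
    [BorelSpace A] {κ : Kernel A A} [IsMarkovKernel κ] {Lw : ℝ} (hLw0 : 0 ≤ Lw)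
    (hLw1 : Lw < 1)
    (hκ : ∀ (g : A → ℝ) (b K : ℝ), Measurable g → (∀ x, |g x| ≤ b) → 0 ≤ K →
      (∀ x y, |g x - g y| ≤ K * ‖x - y‖) →
      ∀ u u', |∫ x, g x ∂(κ u) - ∫ x, g x ∂(κ u')| ≤ K * (Lw * ‖u - u'‖))
    {m : ℕ → Measure A} (hm : ∀ n, IsProbabilityMeasure (m n)) (hs : ∀ n, m (n + 1) = (m n).bind κ)
    (hmS : ∀ n, ∀ᵐ u ∂(m n), ‖u‖ ≤ 1) {ν : Measure A} [IsProbabilityMeasure ν]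
    (hν : κ.Invariant ν) : ∀ᵐ u ∂ν, ‖u‖ ≤ 1 := by
  let g₀ : A → ℝ := fun u => min 1 (max (‖u‖ - 1) 0)
  have hg₀m : Measurable g₀ := by
    have : Continuous g₀ := by fun_prop
    exact this.measurable
  have hg₀0 : ∀ u, 0 ≤ g₀ u := fun u => le_min zero_le_one (le_max_right _ _)
  have hg₀b : ∀ u, |g₀ u| ≤ 1 := fun u => by
    rw [abs_of_nonneg (hg₀0 u)]; exact min_le_left _ _
  have hg₀l : ∀ x y, |g₀ x - g₀ y| ≤ 1 * ‖x - y‖ := by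
    intro x y
    have h1 := abs_min_sub_min_le_max 1 (max (‖x‖ - 1) 0) 1 (max (‖y‖ - 1) 0)
    have h2 := abs_max_sub_max_le_max (‖x‖ - 1) 0 (‖y‖ - 1) 0
    have h3 := abs_norm_sub_norm_le x y
    rw [sub_self, abs_zero] at h1 h2
    rw [sub_sub_sub_cancel_right] at h2
    rw [one_mul]
    refine h1.trans (max_le (norm_nonneg _) (h2.trans (max_le h3 (norm_nonneg _))))
  have key : ∀ t : ℕ, ∃ g : A → ℝ, Measurable g ∧ (∀ u, |g u| ≤ 1) ∧
      (∀ x y, |g x - g y| ≤ Lw ^ t * ‖x - y‖) ∧ ∫ u, g u ∂ν = ∫ u, g₀ u ∂ν ∧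
      ∀ n, ∫ u, g u ∂(m n) = ∫ u, g₀ u ∂(m (n + t)) := by
    intro t
    induction t with
    | zero => exact ⟨g₀, hg₀m, hg₀b, by simpa using hg₀l, rfl, fun n => rfl⟩
    | succ t ih =>
      obtain ⟨g, h1, h2, h3, h4, h5⟩ := ih
      refine ⟨fun u => ∫ x, g x ∂(κ u), (h1.stronglyMeasurable.integral_kernel).measurable,
        fun u => abs_integral_le_of_bounded _ h2, fun x y => ?_, ?_, fun n => ?_⟩
      · refine (hκ g 1 (Lw ^ t) h1 h2 (by positivity) h3 x y).trans (le_of_eq ?_)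
        ring
      · rw [← integral_bind_of_bounded κ ν h1 h2, hν.def, h4]
      · rw [← integral_bind_of_bounded κ (m n) h1 h2, ← hs, h5, add_assoc, add_comm 1 t]
  choose g h1 h2 h3 h4 h5 using key
  have hzero : ∀ t, ∫ u, g t u ∂(m 0) = 0 := by
    intro t
    rw [h5]
    refine integral_eq_zero_of_ae ((hmS _).mono fun u hu => ?_)
    simp only [g₀, Pi.zero_apply]
    rw [max_eq_right (by linarith), min_eq_right zero_le_one]
  have hlim : ∀ u, Tendsto (fun t => g t u) atTop (𝓝 0) := by
    intro u
    refine squeeze_zero_norm (a := fun t => Lw ^ t * (‖u‖ + 1)) (fun t => ?_) ?_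
    · have hi : Integrable (g t) (m 0) :=
        Integrable.of_bound (h1 t).aestronglyMeasurable 1 (Eventually.of_forall (h2 t))
      have e : g t u = ∫ y, (g t u - g t y) ∂(m 0) := by
        rw [integral_sub (integrable_const _) hi, hzero]; simp
      rw [e]
      have := norm_integral_le_of_norm_le_const (μ := m 0) (f := fun y => g t u - g t y)
        (C := Lw ^ t * (‖u‖ + 1)) ((hmS 0).mono fun y hy => ?_)
      · simpa using this
      · refine (h3 t u y).trans (mul_le_mul_of_nonneg_left ?_ (by positivity))
        exact (norm_sub_le _ _).trans (by linarith)
    · simpa using (tendsto_pow_atTop_nhds_zero_of_lt_one hLw0 hLw1).mul_const (‖u‖ + 1)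
  have hlim' : Tendsto (fun t => ∫ u, g t u ∂ν) atTop (𝓝 (∫ _, (0 : ℝ) ∂ν)) :=
    tendsto_integral_of_dominated_convergence (fun _ => 1)
      (fun t => (h1 t).aestronglyMeasurable) (integrable_const _)
      (fun t => Eventually.of_forall (h2 t)) (Eventually.of_forall hlim)
  simp only [h4, integral_zero] at hlim'
  have h0 : ∫ u, g₀ u ∂ν = 0 := tendsto_nhds_unique tendsto_const_nhds hlim'
  have h6 := (integral_eq_zero_iff_of_nonneg hg₀0
    (Integrable.of_bound hg₀m.aestronglyMeasurable 1 (Eventually.of_forall hg₀b))).1 h0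
  filter_upwards [h6] with u hu
  by_contra hlt
  rw [not_le] at hlt
  have : 0 < g₀ u := lt_min one_pos (lt_max_of_lt_left (by linarith))
  exact this.ne' hu

theorem map_fst_bind_stepKernel {A V : Type*} [MeasurableSpace A] [MeasurableSpace V]
    {κ : Kernel A A} [IsMarkovKernel κ] {μη : Measure ℝ} [IsProbabilityMeasure μη] {F : A → V → V}
    {hF : Measurable fun h : A × V × ℝ => F h.1 h.2.1} (m : Measure (A × V × ℝ)) :
    (m.bind (stepKernel κ μη F hF)).map Prod.fst = (m.map Prod.fst).bind κ := by
  ext s hs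
  rw [Measure.map_apply measurable_fst hs, Measure.bind_apply (measurable_fst hs)
    (Kernel.aemeasurable _), Measure.bind_apply hs (Kernel.aemeasurable _),
    lintegral_map (κ.measurable_coe hs) measurable_fst]
  refine lintegral_congr fun h => ?_
  rw [stepKernel_apply, ← Set.prod_univ, Measure.prod_prod, measure_univ, mul_one]

/-! ### The law of the joint chain -/

/-- The memory layer together with its first and second derivatives along an input sequence. -/
def hiddenPath (φ : ℝ → ℝ) (θ : Param N d) (s₀ : Fin N → ℝ) (x : ℕ → Fin d → ℝ) :
    ℕ → Hidden N d
  | 0 => (s₀, 0, 0)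
  | t + 1 => hiddenStep φ θ (x t) (hiddenPath φ θ s₀ x t)

theorem hiddenPath_fst (φ : ℝ → ℝ) (θ : Param N d) (s₀ : Fin N → ℝ) (x : ℕ → Fin d → ℝ) (t : ℕ) :
    (hiddenPath φ θ s₀ x t).1 = memory φ θ s₀ x t := by
  induction t with
  | zero => rfl
  | succ t ih => simp only [hiddenPath, memory, hiddenStep, ih]

theorem hiddenPath_congr (φ : ℝ → ℝ) (θ : Param N d) (s₀ : Fin N → ℝ) {x x' : ℕ → Fin d → ℝ}
    {t : ℕ} (h : ∀ n < t, x n = x' n) : hiddenPath φ θ s₀ x t = hiddenPath φ θ s₀ x' t := by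
  induction t with
  | zero => rfl
  | succ t ih =>
    simp only [hiddenPath]
    rw [ih fun n hn => h n (hn.trans t.lt_succ_self), h t t.lt_succ_self]

theorem measurable_hiddenPath {T : Type*} [MeasurableSpace T] (φ : ℝ → ℝ) (θ : Param N d)
    (s₀ : Fin N → ℝ) {x : T → ℕ → Fin d → ℝ} (hx : ∀ n, Measurable fun a => x a n) (t : ℕ) :
    Measurable fun a => hiddenPath φ θ s₀ (x a) t := by
  induction t with
  | zero => exact measurable_const
  | succ t ih => exact measurable_hiddenStep_comp φ θ (hx t) ih

section Law

variable {Ω : Type*} [MeasurableSpace Ω] {P : Measure Ω} [IsProbabilityMeasure P]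
  {κ : Kernel (Data d dZ) (Data d dZ)} [IsMarkovKernel κ] {U : ℕ → Ω → Data d dZ} {μη : Measure ℝ}
  {η : ℕ → Ω → ℝ} (φ : ℝ → ℝ) (θ : Param N d) (s₀ : Fin N → ℝ)

/-- The joint chain at time `t`. -/
def stateAt (U : ℕ → Ω → Data d dZ) (η : ℕ → Ω → ℝ) (t : ℕ) (ω : Ω) : State N d dZ :=
  (U t ω, hiddenPath φ θ s₀ (fun n => (U n ω).1) t, η t ω)

theorem measurable_stateAt (hU : ∀ t, Measurable (U t)) (hη : ∀ t, Measurable (η t)) (t : ℕ) :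
    Measurable (stateAt φ θ s₀ U η t) :=
  (hU t).prodMk ((measurable_hiddenPath φ θ s₀ (fun n => measurable_fst.comp (hU n)) t).prodMk
    (hη t))

theorem jointKernel_eq_stepKernel {κ : Kernel (Data d dZ) (Data d dZ)} : jointKernel φ κ μη θ =
    stepKernel κ μη (fun u v => hiddenStep φ θ u.1 v) (measurable_hiddenStep φ θ) := rfl

/-- The laws of the joint chain form a trajectory of its transition kernel: the hidden state at
time `t + 1` is a function of `U 0, …, U t`, so the Markov property gives the law of `U (t + 1)`,
and `η (t + 1)` is independent of both. -/
theorem map_stateAt_succ (hU : ∀ t, Measurable (U t)) (hMarkov : IsMarkovChain U κ P)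
    (hη : ∀ t, Measurable (η t)) (hη_law : ∀ t, P.map (η t) = μη)
    (hηU : IndepFun (fun ω t => η t ω) (fun ω t => U t ω) P) (t : ℕ) :
    P.map (stateAt φ θ s₀ U η (t + 1)) =
      (P.map (stateAt φ θ s₀ U η t)).bind (jointKernel φ κ μη θ) := by
  have hμη : IsProbabilityMeasure μη := by
    rw [← hη_law 0]; exact Measure.isProbabilityMeasure_map (hη 0).aemeasurable
  let past : Ω → (Finset.Iic t → Data d dZ) := fun ω i => U i ω
  have hpast : Measurable past := measurable_pi_lambda _ fun i => hU i
  let w : (Finset.Iic t → Data d dZ) → Hidden N d := fun p =>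
    hiddenPath φ θ s₀ (fun n => if h : n ∈ Finset.Iic t then (p ⟨n, h⟩).1 else 0) (t + 1)
  have hw : Measurable w := by
    refine measurable_hiddenPath φ θ s₀ (fun n => ?_) (t + 1)
    by_cases h : n ∈ Finset.Iic t
    · simp only [h, dif_pos]; fun_prop
    · simp only [h, dif_neg, not_false_iff]; fun_prop
  have hwp : ∀ ω, hiddenPath φ θ s₀ (fun n => (U n ω).1) (t + 1) = w (past ω) := by
    intro ω
    refine hiddenPath_congr φ θ s₀ fun n hn => ?_
    have : n ∈ Finset.Iic t := Finset.mem_Iic.2 (Nat.lt_succ_iff.1 hn)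
    simp only [this, dif_pos, past]
  have hind : IndepFun (η (t + 1)) (fun ω => (past ω, U (t + 1) ω)) P := by
    have h1 : Measurable fun e : ℕ → ℝ => e (t + 1) := measurable_pi_apply _
    have h2 : Measurable fun z : ℕ → Data d dZ =>
        ((fun i => z i, z (t + 1)) : (Finset.Iic t → Data d dZ) × Data d dZ) := by fun_prop
    exact hηU.comp h1 h2
  have hpU : Measurable fun ω => (past ω, U (t + 1) ω) := hpast.prodMk (hU _)
  have hlaw := (indepFun_iff_map_prod_eq_prod_map_map (hη (t + 1)).aemeasurable
    hpU.aemeasurable).1 hind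
  have hM := (hMarkov t).map_eq
  refine Measure.ext_of_lintegral _ fun f hf => ?_
  have hf' : Measurable fun z : ℝ × (Finset.Iic t → Data d dZ) × Data d dZ =>
      f (z.2.2, w z.2.1, z.1) := hf.comp (by fun_prop)
  rw [lintegral_map hf (measurable_stateAt φ θ s₀ hU hη _),
    Measure.lintegral_bind (Kernel.aemeasurable _) hf.aemeasurable,
    lintegral_map (hf.lintegral_kernel) (measurable_stateAt φ θ s₀ hU hη _)]
  calc ∫⁻ ω, f (stateAt φ θ s₀ U η (t + 1) ω) ∂P
      = ∫⁻ ω, f (U (t + 1) ω, w (past ω), η (t + 1) ω) ∂P := by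
        refine lintegral_congr fun ω => ?_
        rw [stateAt, hwp]
    _ = ∫⁻ z, f (z.2.2, w z.2.1, z.1) ∂(P.map fun ω => (η (t + 1) ω, past ω, U (t + 1) ω)) :=
        (lintegral_map hf' ((hη _).prodMk hpU)).symm
    _ = ∫⁻ p, ∫⁻ e, f (p.2, w p.1, e) ∂μη ∂(P.map fun ω => (past ω, U (t + 1) ω)) := by
        rw [hlaw, hη_law, lintegral_prod_symm _ hf'.aemeasurable]
    _ = ∫⁻ p, ∫⁻ u, ∫⁻ e, f (u, w p, e) ∂μη ∂(κ (p ⟨t, Finset.mem_Iic.2 le_rfl⟩))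
          ∂(P.map past) := by
        rw [hM, Measure.lintegral_compProd]
        · rfl
        · exact hf'.lintegral_prod_left'
    _ = ∫⁻ ω, ∫⁻ u, ∫⁻ e, f (u, w (past ω), e) ∂μη ∂(κ (U t ω)) ∂P := by
        refine lintegral_map ?_ hpast
        exact hf'.lintegral_prod_left'.lintegral_kernel_prod_right' (κ := κ.comap
          (fun u : Finset.Iic t → Data d dZ => u ⟨t, Finset.mem_Iic.2 le_rfl⟩)
          (measurable_pi_apply _))
    _ = ∫⁻ ω, ∫⁻ z, f z ∂(jointKernel φ κ μη θ (stateAt φ θ s₀ U η t ω)) ∂P := by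
        refine lintegral_congr fun ω => ?_
        rw [jointKernel_eq_stepKernel, lintegral_stepKernel _ hf]
        simp only [stateAt]
        rw [← hwp]
        rfl

end Law

/-! ### Existence and uniqueness of the stationary distribution -/

/-- The bound of the memory layer. The initial value need not lie in the unit cube. -/
def radius₀ (s₀ : Fin N → ℝ) : ℝ := max 1 ‖s₀‖

/-- The bound of the first derivatives: twice the constant term of their update. -/
def radius₁ (C1 : ℝ) (s₀ : Fin N → ℝ) : ℝ := 2 * (C1 * radius₀ s₀ / 4)

/-- The bound of the second derivatives: twice the constant term of their update. -/
def radius₂ (C1 C2 : ℝ) (s₀ : Fin N → ℝ) : ℝ :=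
  2 * hessDrift C1 C2 (radius₀ s₀) (radius₁ C1 s₀)

/-- The forward invariant set of the joint chain started at `s₀`. -/
abbrev orbitCarrier (d dZ : ℕ) (C1 C2 : ℝ) (s₀ : Fin N → ℝ) : Set (State N d dZ) :=
  carrier N d dZ (radius₀ s₀) (radius₁ C1 s₀) (radius₂ C1 C2 s₀)

section Radii

variable {φ : ℝ → ℝ} {C1 C2 : ℝ} (s₀ : Fin N → ℝ)

theorem one_le_radius₀ : 1 ≤ radius₀ s₀ := le_max_left _ _

theorem radius₁_nonneg (hφ : HasBounds φ 1 C1 C2) : 0 ≤ radius₁ C1 s₀ := by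
  have := hφ.one_nonneg
  have := one_le_radius₀ s₀
  unfold radius₁
  positivity

theorem radius₂_nonneg (hφ : HasBounds φ 1 C1 C2) : 0 ≤ radius₂ C1 C2 s₀ := by
  have := hφ.one_nonneg
  have : 0 ≤ C2 := (abs_nonneg _).trans (hφ.two 0)
  have := one_le_radius₀ s₀
  have := radius₁_nonneg s₀ hφ
  unfold radius₂ hessDrift
  positivity

theorem hiddenPath_bounds (hφ : HasBounds φ 1 C1 C2) (θ : Param N d) {x : ℕ → Fin d → ℝ}
    (hx : ∀ n, ‖x n‖ ≤ 1) (t : ℕ) :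
    ‖(hiddenPath φ θ s₀ x t).1‖ ≤ radius₀ s₀ ∧ ‖(hiddenPath φ θ s₀ x t).2.1‖ ≤ radius₁ C1 s₀ ∧
      ‖(hiddenPath φ θ s₀ x t).2.2‖ ≤ radius₂ C1 C2 s₀ := by
  induction t with
  | zero =>
    refine ⟨le_max_right _ _, ?_, ?_⟩
    · simpa [hiddenPath] using radius₁_nonneg s₀ hφ
    · simpa [hiddenPath] using radius₂_nonneg s₀ hφ
  | succ t ih =>
    obtain ⟨h0, h1, h2⟩ := ih
    have hr := one_le_radius₀ s₀
    have hr₁ := radius₁_nonneg s₀ hφ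
    have hr₂ := radius₂_nonneg s₀ hφ
    refine ⟨(norm_hiddenStep_fst_le θ _ _).trans hr,
      (norm_hiddenStep_snd_fst_le hφ θ hr (hx t) h0).trans ?_,
      (norm_hiddenStep_snd_snd_le hφ θ hr (hx t) h0 h1).trans ?_⟩
    · have e : C1 * radius₀ s₀ / 4 = radius₁ C1 s₀ / 2 := by unfold radius₁; ring
      linarith
    · have e : hessDrift C1 C2 (radius₀ s₀) (radius₁ C1 s₀) = radius₂ C1 C2 s₀ / 2 := by
        unfold radius₂; ring
      linarith

end Radii

/-- The standing assumptions on the data chain `U`, the noise `η` and the weight function `φ`. -/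
structure IsModel {Ω : Type*} [MeasurableSpace Ω] (P : Measure Ω)
    (κ : Kernel (Data d dZ) (Data d dZ)) (U : ℕ → Ω → Data d dZ) (μη : Measure ℝ)
    (η : ℕ → Ω → ℝ) (Lw : ℝ) (φ : ℝ → ℝ) (C1 C2 : ℝ) : Prop where
  measurable_data : ∀ t, Measurable (U t)
  markov : IsMarkovChain U κ P
  measurable_noise : ∀ t, Measurable (η t)
  law_noise : ∀ t, P.map (η t) = μη
  indep : IndepFun (fun ω t => η t ω) (fun ω t => U t ω) P
  Lw_nonneg : 0 ≤ Lw
  Lw_lt_one : Lw < 1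
  wass_le : ∀ u u' : Data d dZ, wass 2 (κ u) (κ u') ≤ ENNReal.ofReal (Lw * ‖u - u'‖)
  norm_le : ∀ t, ∀ᵐ ω ∂P, ‖U t ω‖ ≤ 1
  bounds : HasBounds φ 1 C1 C2

namespace IsModel

variable {Ω : Type*} [MeasurableSpace Ω] {P : Measure Ω}
  {κ : Kernel (Data d dZ) (Data d dZ)} {U : ℕ → Ω → Data d dZ} {μη : Measure ℝ}
  {η : ℕ → Ω → ℝ} {Lw : ℝ} {φ : ℝ → ℝ} {C1 C2 : ℝ}

theorem isProbabilityMeasure_noise [IsProbabilityMeasure P]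
    (hM : IsModel P κ U μη η Lw φ C1 C2) :
    IsProbabilityMeasure μη := by
  rw [← hM.law_noise 0]
  exact Measure.isProbabilityMeasure_map (hM.measurable_noise 0).aemeasurable

theorem ae_stateAt_mem (hM : IsModel P κ U μη η Lw φ C1 C2) (s₀ : Fin N → ℝ) :
    ∀ᵐ ω ∂P, ∀ (θ : Param N d) (t : ℕ), stateAt φ θ s₀ U η t ω ∈ orbitCarrier d dZ C1 C2 s₀ := by
  filter_upwards [ae_all_iff.2 hM.norm_le] with ω hω θ t
  exact ⟨hω t, hiddenPath_bounds s₀ hM.bounds θ (fun n => (norm_fst_le _).trans (hω n)) t⟩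

theorem ae_map_stateAt_mem (hM : IsModel P κ U μη η Lw φ C1 C2) (s₀ : Fin N → ℝ)
    (θ : Param N d) (t : ℕ) :
    ∀ᵐ h ∂(P.map (stateAt φ θ s₀ U η t)), h ∈ orbitCarrier d dZ C1 C2 s₀ := by
  refine (ae_map_iff
    (measurable_stateAt φ θ s₀ hM.measurable_data hM.measurable_noise t).aemeasurable
    (p := fun h => h ∈ orbitCarrier d dZ C1 C2 s₀) isClosed_carrier.measurableSet).2 ?_
  exact (hM.ae_stateAt_mem s₀).mono fun ω hω => hω θ t

theorem isProbabilityMeasure_map_stateAt [IsProbabilityMeasure P]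
    (hM : IsModel P κ U μη η Lw φ C1 C2) (s₀ : Fin N → ℝ) (θ : Param N d) (t : ℕ) :
    IsProbabilityMeasure (P.map (stateAt φ θ s₀ U η t)) :=
  Measure.isProbabilityMeasure_map
    (measurable_stateAt φ θ s₀ hM.measurable_data hM.measurable_noise t).aemeasurable

theorem isTightMeasureSet_map_stateAt [IsProbabilityMeasure P]
    (hM : IsModel P κ U μη η Lw φ C1 C2) (s₀ : Fin N → ℝ)
    (θ : Param N d) :
    IsTightMeasureSet (Set.range fun t => P.map (stateAt φ θ s₀ U η t)) := by
  have hμη := hM.isProbabilityMeasure_noise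
  rw [isTightMeasureSet_iff_exists_isCompact_measure_compl_le]
  intro ε hε
  obtain ⟨K, hK, hKε⟩ := isTightMeasureSet_iff_exists_isCompact_measure_compl_le.1
    (isTightMeasureSet_singleton (μ := μη)) ε hε
  have hKc : IsCompact (orbitCarrier d dZ C1 C2 s₀ ∩ {h | h.2.2 ∈ K}) := by
    refine (((isCompact_closedBall (0 : Data d dZ) 1).prod
      ((isCompact_closedBall (0 : Hidden N d) (max (radius₀ s₀)
        (max (radius₁ C1 s₀) (radius₂ C1 C2 s₀)))).prod hK))).of_isClosed_subset
      (isClosed_carrier.inter (hK.isClosed.preimage (by fun_prop))) ?_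
    rintro h ⟨⟨h0, h1, h2, h3⟩, hK⟩
    refine ⟨by simpa using h0, ?_, hK⟩
    rw [mem_closedBall_zero_iff, Prod.norm_def, Prod.norm_def]
    exact max_le_max h1 (max_le_max h2 h3)
  refine ⟨_, hKc, ?_⟩
  rintro _ ⟨t, rfl⟩
  rw [Measure.map_apply (measurable_stateAt φ θ s₀ hM.measurable_data hM.measurable_noise t)
    hKc.measurableSet.compl]
  refine le_trans (measure_mono_ae ?_)
    ((Measure.map_apply (hM.measurable_noise t) hK.measurableSet.compl).symm.le.trans
      ((hM.law_noise t).symm ▸ hKε _ rfl))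
  filter_upwards [hM.ae_stateAt_mem s₀] with ω hω hωK hη
  exact hωK ⟨hω θ t, hη⟩

variable [IsMarkovKernel κ]

/-- On its carrier the joint chain follows the truncated update. -/
theorem bind_jointKernel_eq (θ : Param N d) {r₀ r₁ r₂ : ℝ} {m : Measure (State N d dZ)}
    (hm : ∀ᵐ h ∂m, h ∈ carrier N d dZ r₀ r₁ r₂) [IsProbabilityMeasure μη] :
    m.bind (jointKernel φ κ μη θ) =
      m.bind (stepKernel κ μη (clippedStep φ θ r₀ r₁ r₂)
        (measurable_clippedStep φ θ r₀ r₁ r₂)) := by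
  refine Measure.bind_congr_right (hm.mono fun h hh => ?_)
  rw [jointKernel_eq_stepKernel, stepKernel_apply, stepKernel_apply,
    clippedStep_eq_of_mem_carrier θ hh]

variable [IsProbabilityMeasure P]

theorem map_data_succ (hM : IsModel P κ U μη η Lw φ C1 C2) (t : ℕ) :
    P.map (U (t + 1)) = (P.map (U t)).bind κ := by
  have hμη := hM.isProbabilityMeasure_noise
  -- the law of the data is the marginal of the joint chain of any network, here the empty one
  have h := map_stateAt_succ (N := 0) φ 0 0 hM.measurable_data hM.markov hM.measurable_noise
    hM.law_noise hM.indep t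
  have hm := fun t => measurable_stateAt (N := 0) φ (0 : Param 0 d) 0 hM.measurable_data
    hM.measurable_noise t
  have h' := congrArg (Measure.map Prod.fst) h
  rw [jointKernel_eq_stepKernel, map_fst_bind_stepKernel, Measure.map_map measurable_fst (hm _),
    Measure.map_map measurable_fst (hm _)] at h'
  exact h'

/-- Stationary distributions have bounded support: first the data, then the memory, its first and
its second derivatives are confined, each level using the bounds for the levels before it. -/
theorem ae_mem_of_invariant (hM : IsModel P κ U μη η Lw φ C1 C2) (s₀ : Fin N → ℝ) (θ : Param N d)
    {ν : Measure (State N d dZ)} [IsProbabilityMeasure ν]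
    (hν : (jointKernel φ κ μη θ).Invariant ν) : ∀ᵐ h ∂ν, h ∈ orbitCarrier d dZ C1 C2 s₀ := by
  have hμη := hM.isProbabilityMeasure_noise
  rw [jointKernel_eq_stepKernel] at hν
  have hr := one_le_radius₀ s₀
  have hu : ∀ᵐ h ∂ν, ‖h.1‖ ≤ 1 := by
    have hinv : κ.Invariant (ν.map Prod.fst) := by
      have h := map_fst_bind_stepKernel (κ := κ) (μη := μη)
        (F := fun u v => hiddenStep φ θ u.1 v) (hF := measurable_hiddenStep φ θ) ν
      rw [hν.def] at h
      exact h.symm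
    have hp : IsProbabilityMeasure (ν.map Prod.fst) :=
      Measure.isProbabilityMeasure_map measurable_fst.aemeasurable
    have hpt : ∀ t, IsProbabilityMeasure (P.map (U t)) := fun t =>
      Measure.isProbabilityMeasure_map (hM.measurable_data t).aemeasurable
    have hmem : ∀ t, ∀ᵐ u ∂(P.map (U t)), ‖u‖ ≤ 1 := fun t =>
      (ae_map_iff (hM.measurable_data t).aemeasurable
        (measurableSet_le measurable_norm measurable_const)).2 (hM.norm_le t)
    have h := ae_norm_le_one_of_invariant hM.Lw_nonneg hM.Lw_lt_one
      (fun g b K hg hb hK hl u u' => abs_integral_sub_le_of_wass_le (μ := κ u)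
        (mul_nonneg hM.Lw_nonneg (norm_nonneg _)) (hM.wass_le u u') hg hb hK hl)
      hpt hM.map_data_succ hmem hinv
    exact ae_of_ae_map measurable_fst.aemeasurable h
  have hs : ∀ᵐ h ∂ν, ‖h.2.1.1‖ ≤ radius₀ s₀ := by
    have hset : MeasurableSet {v : Hidden N d | 1 < ‖v.1‖} :=
      measurableSet_lt measurable_const (by fun_prop)
    have h := ae_eq_zero_of_invariant hν (W := Set.indicator {v | 1 < ‖v.1‖} fun _ => 1)
      (measurable_const.indicator hset)
      (fun v => Set.indicator_nonneg (fun _ _ => zero_le_one) v) (Eventually.of_forall fun x => ?_)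
    · filter_upwards [h] with x hx
      by_contra hlt
      have : x.2.1 ∈ {v : Hidden N d | 1 < ‖v.1‖} := hr.trans_lt (not_le.1 hlt)
      rw [Set.indicator_of_mem this] at hx
      exact one_ne_zero hx
    · have hx : hiddenStep φ θ x.1.1 x.2.1 ∉ {v : Hidden N d | 1 < ‖v.1‖} :=
        (norm_hiddenStep_fst_le θ _ _).not_gt
      rw [Set.indicator_of_notMem hx]
      exact mul_nonneg (by norm_num) (Set.indicator_nonneg (fun _ _ => zero_le_one) _)
  have hs' : ∀ᵐ h ∂ν, ‖h.2.1.2.1‖ ≤ radius₁ C1 s₀ := by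
    have h := ae_eq_zero_of_invariant hν (W := fun v => max (‖v.2.1‖ - radius₁ C1 s₀) 0)
      (by fun_prop) (fun v => le_max_right _ _) ?_
    · filter_upwards [h] with x hx
      linarith [hx ▸ le_max_left (‖x.2.1.2.1‖ - radius₁ C1 s₀) 0]
    · filter_upwards [hu, hs] with x hxu hxs
      have h1 := norm_hiddenStep_snd_fst_le hM.bounds θ hr ((norm_fst_le _).trans hxu) hxs
      have e : C1 * radius₀ s₀ / 4 = radius₁ C1 s₀ / 2 := by unfold radius₁; ring
      have h2 := le_max_left (‖x.2.1.2.1‖ - radius₁ C1 s₀) 0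
      have h3 := le_max_right (‖x.2.1.2.1‖ - radius₁ C1 s₀) 0
      have h4 := radius₁_nonneg s₀ hM.bounds
      exact max_le (by linarith) (by linarith)
  have hs'' : ∀ᵐ h ∂ν, ‖h.2.1.2.2‖ ≤ radius₂ C1 C2 s₀ := by
    have h := ae_eq_zero_of_invariant hν (W := fun v => max (‖v.2.2‖ - radius₂ C1 C2 s₀) 0)
      (by fun_prop) (fun v => le_max_right _ _) ?_
    · filter_upwards [h] with x hx
      linarith [hx ▸ le_max_left (‖x.2.1.2.2‖ - radius₂ C1 C2 s₀) 0]
    · filter_upwards [hu, hs, hs'] with x hxu hxs hxs'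
      have h1 := norm_hiddenStep_snd_snd_le hM.bounds θ hr ((norm_fst_le _).trans hxu) hxs hxs'
      have e : hessDrift C1 C2 (radius₀ s₀) (radius₁ C1 s₀) = radius₂ C1 C2 s₀ / 2 := by
        unfold radius₂; ring
      have h2 := le_max_left (‖x.2.1.2.2‖ - radius₂ C1 C2 s₀) 0
      have h3 := le_max_right (‖x.2.1.2.2‖ - radius₂ C1 C2 s₀) 0
      have h4 := radius₂_nonneg s₀ hM.bounds
      exact max_le (by linarith) (by linarith)
  filter_upwards [hu, hs, hs', hs''] with h h0 h1 h2 h3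
  exact ⟨h0, h1, h2, h3⟩

theorem exists_isUniqueStationary (hM : IsModel P κ U μη η Lw φ C1 C2) (s₀ : Fin N → ℝ)
    (θ : Param N d) : ∃ μ, IsUniqueStationary φ κ μη θ μ := by
  have hμη := hM.isProbabilityMeasure_noise
  have hr₀ : 0 ≤ radius₀ s₀ := zero_le_one.trans (one_le_radius₀ s₀)
  obtain ⟨M, M₁, M₂, h, h1, h2, hc⟩ := exists_isContractive (N := N) κ hM.Lw_nonneg hM.Lw_lt_one
    hM.wass_le hM.bounds hr₀ (radius₁_nonneg s₀ hM.bounds) (radius₂_nonneg s₀ hM.bounds)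
  have hcost := cost_le_of_mem_carrier (N := N) (d := d) (dZ := dZ) (r₀ := radius₀ s₀)
    (r₁ := radius₁ C1 s₀) (r₂ := radius₂ C1 C2 s₀) (zero_le_one.trans h) (zero_le_one.trans h1)
    (zero_le_one.trans h2)
  have hclip : ∀ ν : Measure (State N d dZ), IsProbabilityMeasure ν →
      (jointKernel φ κ μη θ).Invariant ν →
      (stepKernel κ μη _ (measurable_clippedStep φ θ (radius₀ s₀) (radius₁ C1 s₀)
        (radius₂ C1 C2 s₀))).Invariant ν := by
    intro ν hνp hν
    rw [Kernel.Invariant, ← bind_jointKernel_eq θ (hM.ae_mem_of_invariant s₀ θ hν), hν.def]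
  obtain ⟨μ, hμp, hμ, hμS⟩ := (hc θ).exists_invariant (μη := μη)
    (hF := measurable_clippedStep φ θ _ _ _) hcost isClosed_carrier
    (hM.isProbabilityMeasure_map_stateAt s₀ θ) (hM.ae_map_stateAt_mem s₀ θ)
    (fun t => by
      rw [map_stateAt_succ φ θ s₀ hM.measurable_data hM.markov hM.measurable_noise hM.law_noise
        hM.indep t, bind_jointKernel_eq θ (hM.ae_map_stateAt_mem s₀ θ t)])
    (hM.isTightMeasureSet_map_stateAt s₀ θ)
  refine ⟨μ, hμp, ?_, fun ν hνp hν => ?_⟩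
  · rw [Kernel.Invariant, bind_jointKernel_eq θ hμS, hμ.def]
  · exact (hc θ).invariant_unique hcost (hclip ν hνp hν) hμ (hM.ae_mem_of_invariant s₀ θ hν) hμS

/-- Functions that are Lipschitz on the carrier, uniformly in the index `i` of the parameter and the
noise, converge in mean to their stationary values, exponentially fast and uniformly in the
parameter. -/
theorem exists_integral_sub_le (hM : IsModel P κ U μη η Lw φ C1 C2) (s₀ : Fin N → ℝ)
    {μ : Param N d → Measure (State N d dZ)} (hμ : ∀ θ, IsUniqueStationary φ κ μη θ (μ θ))
    {G : Param N d → State N d dZ → ℝ} (hG : ∀ θ, Measurable (G θ))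
    (hGl : UnifLip fun (i : Param N d × ℝ) (h : Data d dZ × Hidden N d) =>
      G i.1 (h.1, clipHidden (radius₀ s₀) (radius₁ C1 s₀) (radius₂ C1 C2 s₀) h.2, i.2)) :
    ∃ C ρ : ℝ, 0 ≤ C ∧ 0 ≤ ρ ∧ ρ < 1 ∧
      (∀ θ, Integrable (G θ) (μ θ)) ∧ (∀ θ, |∫ h, G θ h ∂(μ θ)| ≤ C) ∧
      ∀ θ t, |∫ ω, G θ (stateAt φ θ s₀ U η (t + 1) ω) ∂P - ∫ h, G θ h ∂(μ θ)| ≤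
        C * ρ ^ (t + 1) := by
  have hμη := hM.isProbabilityMeasure_noise
  have hr₀ : 0 ≤ radius₀ s₀ := zero_le_one.trans (one_le_radius₀ s₀)
  have hr₁ := radius₁_nonneg s₀ hM.bounds
  have hr₂ := radius₂_nonneg s₀ hM.bounds
  obtain ⟨M, M₁, M₂, h, h1, h2, hc⟩ := exists_isContractive (N := N) κ hM.Lw_nonneg hM.Lw_lt_one
    hM.wass_le hM.bounds hr₀ hr₁ hr₂
  have hM0 := zero_le_one.trans h
  have hM₁0 := zero_le_one.trans h1
  have hM₂0 := zero_le_one.trans h2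
  have hcost := cost_le_of_mem_carrier (N := N) (d := d) (dZ := dZ) (r₀ := radius₀ s₀)
    (r₁ := radius₁ C1 s₀) (r₂ := radius₂ C1 C2 s₀) hM0 hM₁0 hM₂0
  obtain ⟨c, hc0, hcb, hcl⟩ := hGl
  let G' : Param N d → State N d dZ → ℝ := fun θ h =>
    G θ (h.1, clipHidden (radius₀ s₀) (radius₁ C1 s₀) (radius₂ C1 C2 s₀) h.2.1, h.2.2)
  have hG'm : ∀ θ, Measurable (G' θ) := fun θ => (hG θ).comp
    (measurable_fst.prodMk (((measurable_clipHidden _ _ _).comp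
      (measurable_fst.comp measurable_snd)).prodMk (measurable_snd.comp measurable_snd)))
  have hG'b : ∀ θ h, |G' θ h| ≤ c := fun θ h => hcb (θ, h.2.2) (h.1, h.2.1)
  have htest : ∀ θ, IsTest M (hiddenCost M₁ M₂) c (G' θ) := fun θ => by
    refine ⟨hG'm θ, ⟨c, hG'b θ⟩, hc0, fun u v u' v' e => ?_⟩
    refine (hcl (θ, e) (u, v) (u', v')).trans (mul_le_mul_of_nonneg_left ?_ hc0)
    have a1 := (hc θ).dist_le v v'
    have a2 : (0 : ℝ) ≤ dist v v' := dist_nonneg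
    have a3 := norm_nonneg (u - u')
    change max (dist u u') (dist v v') ≤ _
    rw [dist_eq_norm u u']
    exact max_le (by nlinarith) (by nlinarith)
  have heq : ∀ θ, ∀ h ∈ orbitCarrier d dZ C1 C2 s₀, G' θ h = G θ h := by
    rintro θ h ⟨-, a1, a2, a3⟩
    simp only [G', clipHidden_eq a1 a2 a3]
  have hμS : ∀ θ, ∀ᵐ h ∂(μ θ), h ∈ orbitCarrier d dZ C1 C2 s₀ := fun θ => by
    have := (hμ θ).1
    exact hM.ae_mem_of_invariant s₀ θ (hμ θ).2.1
  have hμeq : ∀ θ, G' θ =ᵐ[μ θ] G θ := fun θ => (hμS θ).mono fun h hh => heq θ h hh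
  have hB : 0 ≤ M * 2 + (M₂ * (2 * radius₀ s₀) + M₁ * (2 * radius₁ C1 s₀) +
      2 * radius₂ C1 C2 s₀) := by positivity
  refine ⟨c + c * (M * 2 + (M₂ * (2 * radius₀ s₀) + M₁ * (2 * radius₁ C1 s₀) +
    2 * radius₂ C1 C2 s₀)), (1 + Lw) / 2, by positivity, ?_, ?_, fun θ => ?_, fun θ => ?_,
    fun θ t => ?_⟩
  · have := hM.Lw_nonneg; positivity
  · have := hM.Lw_lt_one; linarith
  · have := (hμ θ).1
    exact (Integrable.of_bound (hG'm θ).aestronglyMeasurable c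
      (Eventually.of_forall (hG'b θ))).congr (hμeq θ)
  · have := (hμ θ).1
    rw [← integral_congr_ae (hμeq θ)]
    refine (abs_integral_le_of_bounded (μ θ) (hG'b θ)).trans ?_
    have := mul_nonneg hc0 hB
    linarith
  · have hp := (hμ θ).1
    have hinv : ∀ _ : ℕ, μ θ = (μ θ).bind (stepKernel κ μη _ (measurable_clippedStep φ θ
        (radius₀ s₀) (radius₁ C1 s₀) (radius₂ C1 C2 s₀))) := fun _ => by
      rw [← bind_jointKernel_eq θ (hμS θ), (hμ θ).2.1.def]
    have key := (htest θ).abs_integral_sub_le (hc θ) (m := fun t => P.map (stateAt φ θ s₀ U η t))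
      (m' := fun _ => μ θ) hcost t (hM.isProbabilityMeasure_map_stateAt s₀ θ) (fun _ => hp)
      (hM.ae_map_stateAt_mem s₀ θ 0) (hμS θ)
      (fun t => by
        rw [map_stateAt_succ φ θ s₀ hM.measurable_data hM.markov hM.measurable_noise hM.law_noise
          hM.indep t, bind_jointKernel_eq θ (hM.ae_map_stateAt_mem s₀ θ t)]) hinv
    rw [integral_congr_ae (hμeq θ), integral_map (measurable_stateAt φ θ s₀ hM.measurable_data
      hM.measurable_noise _).aemeasurable (hG'm θ).aestronglyMeasurable] at key
    rw [integral_congr_ae ((hM.ae_stateAt_mem s₀).mono fun ω hω => heq θ _ (hω θ (t + 1)))] at key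
    refine key.trans ?_
    have h0 : 0 ≤ ((1 + Lw) / 2) ^ (t + 1) := by
      have := hM.Lw_nonneg; positivity
    nlinarith [mul_nonneg hc0 h0]

end IsModel

/-! ### Gradients in coordinates -/

/-- The linear functional on the parameter space with the coefficients `G`. -/
def linForm (G : ParamIdx N d → ℝ) : Param N d →L[ℝ] ℝ :=
  InnerProductSpace.toDual ℝ (Param N d) (WithLp.toLp 2 G)

theorem linForm_apply (G : ParamIdx N d → ℝ) (y : Param N d) :
    linForm G y = ∑ a, G a * y a := by
  rw [linForm, InnerProductSpace.toDual_apply_apply, PiLp.inner_apply]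
  simp [mul_comm]

theorem linForm_single (G : ParamIdx N d → ℝ) (a : ParamIdx N d) :
    linForm G (EuclideanSpace.single a 1) = G a := by
  rw [linForm_apply, Finset.sum_eq_single a]
  · simp
  · intro b _ hb; simp [hb]
  · simp

theorem norm_linForm_le (G : ParamIdx N d → ℝ) : ‖linForm G‖ ≤ ∑ a, |G a| := by
  refine ContinuousLinearMap.opNorm_le_bound _ (Finset.sum_nonneg fun _ _ => abs_nonneg _)
    fun y => ?_
  rw [linForm_apply, Finset.sum_mul, Real.norm_eq_abs]
  refine (Finset.abs_sum_le_sum_abs _ _).trans (Finset.sum_le_sum fun a _ => ?_)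
  rw [abs_mul]
  exact mul_le_mul_of_nonneg_left (PiLp.norm_apply_le y a) (abs_nonneg _)

/-- `F` is differentiable at `θ` with the partial derivatives `G`. -/
def HasGrad (F : Param N d → ℝ) (G : ParamIdx N d → ℝ) (θ : Param N d) : Prop :=
  HasFDerivAt F (linForm G) θ

namespace HasGrad

variable {F F' : Param N d → ℝ} {G G' : ParamIdx N d → ℝ} {θ : Param N d}

theorem congr (h : HasGrad F G θ) (hG : ∀ a, G a = G' a) : HasGrad F G' θ := by
  rwa [← funext hG]

theorem const (c : ℝ) : HasGrad (fun _ : Param N d => c) (fun _ => 0) θ := by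
  refine (hasFDerivAt_const c θ).congr_fderiv ?_
  ext y; simp [linForm_apply]

theorem coord (b : ParamIdx N d) : HasGrad (fun θ => θ b) (Pi.single b 1) θ := by
  refine (EuclideanSpace.proj (𝕜 := ℝ) b).hasFDerivAt.congr_fderiv ?_
  ext y
  rw [linForm_apply, Finset.sum_eq_single b]
  · simp
  · intro c _ hc; simp [hc]
  · simp

theorem add (h : HasGrad F G θ) (h' : HasGrad F' G' θ) :
    HasGrad (fun θ => F θ + F' θ) (fun a => G a + G' a) θ := by
  refine (HasFDerivAt.add h h').congr_fderiv ?_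
  ext y; simp [linForm_apply, add_mul, Finset.sum_add_distrib]

theorem mul (h : HasGrad F G θ) (h' : HasGrad F' G' θ) :
    HasGrad (fun θ => F θ * F' θ) (fun a => G a * F' θ + F θ * G' a) θ := by
  refine (HasFDerivAt.mul h h').congr_fderiv ?_
  ext y
  simp only [linForm_apply, add_apply, smul_apply,
    smul_eq_mul, Finset.mul_sum, ← Finset.sum_add_distrib]
  exact Finset.sum_congr rfl fun a _ => by ring

theorem const_mul (c : ℝ) (h : HasGrad F G θ) :
    HasGrad (fun θ => c * F θ) (fun a => c * G a) θ :=
  ((const c).mul h).congr fun a => by ring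

theorem neg (h : HasGrad F G θ) : HasGrad (fun θ => -F θ) (fun a => -G a) θ := by
  simpa only [neg_one_mul] using h.const_mul (-1)

theorem sub (h : HasGrad F G θ) (h' : HasGrad F' G' θ) :
    HasGrad (fun θ => F θ - F' θ) (fun a => G a - G' a) θ := by
  simpa only [sub_eq_add_neg] using h.add h'.neg

theorem sum {κ : Type*} (s : Finset κ) {F : κ → Param N d → ℝ} {G : κ → ParamIdx N d → ℝ}
    (h : ∀ k, HasGrad (F k) (G k) θ) :
    HasGrad (fun θ => ∑ k ∈ s, F k θ) (fun a => ∑ k ∈ s, G k a) θ := by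
  classical
  induction s using Finset.induction_on with
  | empty => simpa using const 0
  | insert a s ha ih => simpa only [Finset.sum_insert ha] using (h a).add ih

theorem comp {ψ : ℝ → ℝ} (hψ : DifferentiableAt ℝ ψ (F θ)) (h : HasGrad F G θ) :
    HasGrad (fun θ => ψ (F θ)) (fun a => deriv ψ (F θ) * G a) θ := by
  refine (hψ.hasDerivAt.comp_hasFDerivAt θ h).congr_fderiv ?_
  ext y
  rw [smul_apply, linForm_apply, linForm_apply, smul_eq_mul, Finset.mul_sum]
  exact Finset.sum_congr rfl fun a _ => (mul_assoc _ _ _).symm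

end HasGrad

/-! ### Forward derivatives of the memory layer -/

/-- The components `s'` and `s''` of `v = (s, s', s'')` are the first and second derivatives of the
memory `s` with respect to the weights, and `s` and `s'` do not depend on the other parameters. -/
structure HasForwardDerivs (v : Param N d → Hidden N d) (θ : Param N d) : Prop where
  first : ∀ k, HasGrad (fun θ => (v θ).1 k) (Sum.elim (fun p => (v θ).2.1 p k) fun _ => 0) θ
  second : ∀ p k,
    HasGrad (fun θ => (v θ).2.1 p k) (Sum.elim (fun q => (v θ).2.2 p q k) fun _ => 0) θ

section Forward

variable {φ : ℝ → ℝ} {θ : Param N d} {x : Fin d → ℝ}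

theorem direct_add (ψ : ℝ → ℝ) (p : WeightIdx N d) (s : Fin N → ℝ) (k : Fin N) :
    direct ψ θ p x 0 k + direct ψ θ p 0 s k = direct ψ θ p x s k := by
  rcases p with ⟨i, j⟩ | ⟨i, j⟩ <;> by_cases h : i = k <;> simp [direct, h]

theorem hasGrad_input (hφ : Differentiable ℝ φ) (k : Fin N) :
    HasGrad (fun θ => 1 / (d : ℝ) * ∑ j, φ (matA θ k j) * x j)
      (Sum.elim (fun p => direct (deriv φ) θ p x 0 k) fun _ => 0) θ := by
  refine ((HasGrad.sum Finset.univ fun j =>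
    ((HasGrad.coord (Sum.inl (Sum.inl (k, j)))).comp (hφ _)).mul
      (HasGrad.const (x j))).const_mul (1 / (d : ℝ))).congr ?_
  rintro ((⟨i, j⟩ | ⟨i, j⟩) | b)
  · by_cases h : i = k
    · subst h
      simp [direct, Pi.single_apply, matA]
    · simp [direct, h, Prod.ext_iff]
  · by_cases h : i = k <;> simp [direct, h]
  · simp

theorem hasGrad_mean (hφ : Differentiable ℝ φ) {b : Param N d → Fin N → ℝ}
    {b' : WeightIdx N d → Fin N → ℝ}
    (hb : ∀ l, HasGrad (fun θ => b θ l) (Sum.elim (fun p => b' p l) fun _ => 0) θ) (k : Fin N) :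
    HasGrad (fun θ => 1 / (N : ℝ) * ∑ l, φ (matW θ k l) * b θ l)
      (Sum.elim (fun p => direct (deriv φ) θ p 0 (b θ) k +
        1 / (N : ℝ) * ∑ l, φ (matW θ k l) * b' p l) fun _ => 0) θ := by
  refine ((HasGrad.sum Finset.univ fun l =>
    ((HasGrad.coord (Sum.inl (Sum.inr (k, l)))).comp (hφ _)).mul
      (hb l)).const_mul (1 / (N : ℝ))).congr ?_
  rintro ((⟨i, j⟩ | ⟨i, j⟩) | c)
  · by_cases h : i = k <;> simp [direct, h, matW]
  · by_cases h : i = k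
    · subst h
      simp [direct, Pi.single_apply, matW, Finset.sum_add_distrib, mul_add]
    · simp [direct, h, matW, Prod.ext_iff]
  · simp

theorem hasGrad_direct (hφ' : Differentiable ℝ (deriv φ)) {v : Param N d → Hidden N d}
    (hv : HasForwardDerivs v θ) (p : WeightIdx N d) (k : Fin N) :
    HasGrad (fun θ => direct (deriv φ) θ p x (v θ).1 k)
      (Sum.elim (fun q => (if p = q then direct (deriv (deriv φ)) θ p x (v θ).1 k else 0) +
        direct (deriv φ) θ p 0 ((v θ).2.1 q) k) fun _ => 0) θ := by
  rcases p with ⟨i, j⟩ | ⟨i, j⟩ <;> by_cases h : i = k <;>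
    simp only [direct, h, if_true, if_false]
  · refine ((((HasGrad.coord (Sum.inl (Sum.inl (k, j)))).comp (hφ' _)).mul
      (HasGrad.const (x j))).const_mul (1 / (d : ℝ))).congr ?_
    rintro (q | b)
    · by_cases hq : Sum.inl (k, j) = q
      · subst hq; simp [matA]
      · simp [Ne.symm hq, eq_comm]
    · simp
  · exact (HasGrad.const 0).congr fun a => by rcases a with q | b <;> simp
  · refine ((((HasGrad.coord (Sum.inl (Sum.inr (k, j)))).comp (hφ' _)).mul
      (hv.first j)).const_mul (1 / (N : ℝ))).congr ?_
    rintro (q | b)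
    · by_cases hq : Sum.inr (k, j) = q
      · subst hq; simp [matW, mul_add]
      · simp [hq, Ne.symm hq, matW]
    · simp
  · exact (HasGrad.const 0).congr fun a => by rcases a with q | b <;> simp

/-- The update `hiddenStep` differentiates the memory by the chain rule. -/
theorem HasForwardDerivs.step (hφ : ContDiff ℝ 2 φ) {v : Param N d → Hidden N d}
    (hv : HasForwardDerivs v θ) : HasForwardDerivs (fun θ => hiddenStep φ θ x (v θ)) θ := by
  have hd : Differentiable ℝ φ := hφ.differentiable (by norm_num)
  have hd' : Differentiable ℝ (deriv φ) :=
    (contDiff_succ_iff_deriv.1 (show ContDiff ℝ (1 + 1) φ by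
      rw [one_add_one_eq_two]; exact hφ)).2.2.differentiable (by norm_num)
  have hσ' : Differentiable ℝ (deriv Real.sigmoid) := by
    rw [Real.deriv_sigmoid]
    exact differentiable_sigmoid.mul ((differentiable_const 1).sub differentiable_sigmoid)
  have h0 : ∀ k, HasGrad (fun θ => preact φ θ x (v θ).1 k)
      (Sum.elim (fun p => preact₁ φ θ x (v θ) p k) fun _ => 0) θ := fun k => by
    refine ((hasGrad_input hd k).add (hasGrad_mean hd hv.first k)).congr ?_
    rintro (p | b)
    · simp only [Sum.elim_inl, preact₁]
      rw [← add_assoc, direct_add]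
    · simp
  have h1 : ∀ p k, HasGrad (fun θ => preact₁ φ θ x (v θ) p k)
      (Sum.elim (fun q => preact₂ φ θ x (v θ) p q k) fun _ => 0) θ := fun p k => by
    refine ((hasGrad_direct hd' hv p k).add (hasGrad_mean hd (hv.second p) k)).congr ?_
    rintro (q | b)
    · simp only [Sum.elim_inl, preact₂]
      ring
    · simp
  refine ⟨fun k => ?_, fun p k => ?_⟩
  · refine ((h0 k).comp differentiableAt_sigmoid).congr ?_
    rintro (p | b)
    · rfl
    · simp
  · refine (((h0 k).comp (hσ' _)).mul (h1 p k)).congr ?_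
    rintro (q | b)
    · simp only [Sum.elim_inl, hiddenStep]
      ring
    · simp

theorem hasForwardDerivs_hiddenPath (hφ : ContDiff ℝ 2 φ) (s₀ : Fin N → ℝ) (x : ℕ → Fin d → ℝ)
    (t : ℕ) (θ : Param N d) : HasForwardDerivs (fun θ => hiddenPath φ θ s₀ x t) θ := by
  induction t with
  | zero =>
    exact ⟨fun k => (HasGrad.const _).congr fun a => by rcases a with q | b <;> rfl,
      fun p k => (HasGrad.const _).congr fun a => by rcases a with q | b <;> rfl⟩
  | succ t ih => exact ih.step hφ

/-! ### Derivatives of the loss -/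

variable {lam : ℝ → ℝ} {v : Param N d → Hidden N d}

theorem hasGrad_output (hlam : Differentiable ℝ lam) (hv : HasForwardDerivs v θ) :
    HasGrad (fun θ => output lam θ (v θ).1) (outGrad lam θ (v θ)) θ := by
  refine ((HasGrad.sum Finset.univ fun i =>
    ((HasGrad.coord (Sum.inr (Sum.inl i))).comp (hlam _)).mul (hv.first i)).add
    ((HasGrad.coord (Sum.inr (Sum.inr ()))).comp (hlam _))).congr ?_
  rintro (p | i | _)
  · simp [outGrad, vecB]
  · simp [outGrad, Pi.single_apply, vecB]
  · simp [outGrad, scalC]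

theorem hasGrad_outGrad (hlam : Differentiable ℝ lam) (hlam' : Differentiable ℝ (deriv lam))
    (hv : HasForwardDerivs v θ) (a : ParamIdx N d) :
    HasGrad (fun θ => outGrad lam θ (v θ) a) (outHess lam θ (v θ) a) θ := by
  rcases a with p | i | _
  · refine (HasGrad.sum Finset.univ fun i =>
      ((HasGrad.coord (Sum.inr (Sum.inl i))).comp (hlam _)).mul (hv.second p i)).congr ?_
    rintro (q | i | _)
    · simp [outHess, vecB]
    · simp [outHess, Pi.single_apply, vecB]
    · simp [outHess]
  · refine (((HasGrad.coord (Sum.inr (Sum.inl i))).comp (hlam' _)).mul (hv.first i)).congr ?_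
    rintro (q | j | _)
    · simp [outHess, vecB]
    · by_cases h : i = j
      · subst h; simp [outHess, vecB]
      · simp [outHess, h, Ne.symm h]
    · simp [outHess]
  · refine ((HasGrad.coord (Sum.inr (Sum.inr ()))).comp (hlam' _)).congr ?_
    rintro (q | i | _) <;> simp [outHess, scalC]

variable (f : Data d dZ → ℝ → ℝ) (u : Data d dZ) (e : ℝ)

theorem hasGrad_residual (hlam : Differentiable ℝ lam) (hv : HasForwardDerivs v θ) :
    HasGrad (fun θ => residual f lam θ (u, v θ, e)) (fun a => -outGrad lam θ (v θ) a) θ :=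
  ((HasGrad.const (f u e)).sub (hasGrad_output hlam hv)).congr fun _ => zero_sub _

theorem hasGrad_lossFun (hlam : Differentiable ℝ lam) (hv : HasForwardDerivs v θ) :
    HasGrad (fun θ => lossFun f lam θ (u, v θ, e)) (gFun f lam θ (u, v θ, e)) θ := by
  have h := hasGrad_residual f u e hlam hv
  simp only [lossFun, sq]
  refine ((h.mul h).const_mul (1 / 2)).congr fun a => ?_
  simp only [gFun]
  ring

theorem hasGrad_gFun (hlam : Differentiable ℝ lam) (hlam' : Differentiable ℝ (deriv lam))
    (hv : HasForwardDerivs v θ) (a : ParamIdx N d) :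
    HasGrad (fun θ => gFun f lam θ (u, v θ, e) a) (heFun f lam θ (u, v θ, e) a) θ := by
  refine ((hasGrad_residual f u e hlam hv).neg.mul (hasGrad_outGrad hlam hlam' hv a)).congr
    fun b => ?_
  simp only [heFun, Matrix.sub_apply, Matrix.vecMulVec_apply, Matrix.smul_apply, smul_eq_mul]
  ring

end Forward

/-! ### Gradients, integrals and limits -/

theorem continuous_linForm : Continuous (linForm : (ParamIdx N d → ℝ) → Param N d →L[ℝ] ℝ) :=
  (InnerProductSpace.toDual ℝ (Param N d)).continuous.comp (PiLp.continuous_toLp 2 _)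

theorem linForm_sub (G G' : ParamIdx N d → ℝ) : linForm G - linForm G' = linForm (G - G') := by
  ext y
  rw [sub_apply, linForm_apply, linForm_apply, linForm_apply, ← Finset.sum_sub_distrib]
  exact Finset.sum_congr rfl fun a _ => (sub_mul _ _ _).symm

/-- Differentiation under the integral sign. -/
theorem hasGrad_integral {Ω : Type*} [MeasurableSpace Ω] {P : Measure Ω} [IsProbabilityMeasure P]
    {F : Param N d → Ω → ℝ} {G : Param N d → Ω → ParamIdx N d → ℝ} {b c : ℝ}
    (hF : ∀ θ, Measurable (F θ)) (hG : ∀ θ a, Measurable fun ω => G θ ω a)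
    (hFb : ∀ᵐ ω ∂P, ∀ θ, |F θ ω| ≤ b) (hGb : ∀ᵐ ω ∂P, ∀ θ a, |G θ ω a| ≤ c)
    (h : ∀ ω θ, HasGrad (fun θ => F θ ω) (G θ ω) θ) (θ : Param N d) :
    HasGrad (fun θ => ∫ ω, F θ ω ∂P) (fun a => ∫ ω, G θ ω a ∂P) θ := by
  have hGm : ∀ θ, AEStronglyMeasurable (fun ω => linForm (G θ ω)) P := fun θ =>
    (continuous_linForm.measurable.comp (measurable_pi_lambda _ (hG θ))).aestronglyMeasurable
  have hGbd : ∀ᵐ ω ∂P, ∀ θ, ‖linForm (G θ ω)‖ ≤ ∑ _a : ParamIdx N d, c :=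
    hGb.mono fun ω hω θ => (norm_linForm_le _).trans (Finset.sum_le_sum fun a _ => hω θ a)
  have key := hasFDerivAt_integral_of_dominated_of_fderiv_le (μ := P) (F := F)
    (F' := fun θ ω => linForm (G θ ω)) (x₀ := θ) (s := Set.univ)
    (bound := fun _ => ∑ _a : ParamIdx N d, c) univ_mem
    (Eventually.of_forall fun θ => (hF θ).aestronglyMeasurable)
    (Integrable.of_bound (hF θ).aestronglyMeasurable b (hFb.mono fun ω hω => hω θ)) (hGm θ)
    (hGbd.mono fun ω hω θ _ => hω θ) (integrable_const _)
    (Eventually.of_forall fun ω θ _ => h ω θ)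
  refine key.congr_fderiv ?_
  ext y
  have hi : ∀ a, Integrable (fun ω => G θ ω a) P := fun a =>
    Integrable.of_bound (hG θ a).aestronglyMeasurable c (hGb.mono fun ω hω => hω θ a)
  rw [ContinuousLinearMap.integral_apply
    (Integrable.of_bound (hGm θ) _ (hGbd.mono fun ω hω => hω θ)), linForm_apply]
  simp only [linForm_apply]
  rw [integral_finsetSum _ fun a _ => (hi a).mul_const _]
  exact Finset.sum_congr rfl fun a _ => integral_mul_const _ _

theorem hasGrad_of_tendstoUniformly {F : ℕ → Param N d → ℝ} {F₀ : Param N d → ℝ}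
    {G : ℕ → Param N d → ParamIdx N d → ℝ} {G₀ : Param N d → ParamIdx N d → ℝ}
    (h : ∀ n θ, HasGrad (F n) (G n θ) θ)
    (hF : ∀ θ, Tendsto (fun n => F n θ) atTop (𝓝 (F₀ θ)))
    (hG : ∀ a, TendstoUniformly (fun n θ => G n θ a) (fun θ => G₀ θ a) atTop) (θ : Param N d) :
    HasGrad F₀ (G₀ θ) θ := by
  refine hasFDerivAt_of_tendstoUniformly (l := atTop) (f := F) (f' := fun n θ => linForm (G n θ))
    (g' := fun θ => linForm (G₀ θ)) ?_ h hF θ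
  rw [Metric.tendstoUniformly_iff]
  intro ε hε
  have hc : (0 : ℝ) < Fintype.card (ParamIdx N d) + 1 := by positivity
  have hev : ∀ᶠ n in atTop, ∀ a θ, dist (G₀ θ a) (G n θ a) <
      ε / (Fintype.card (ParamIdx N d) + 1) := by
    rw [eventually_all]
    exact fun a => Metric.tendstoUniformly_iff.1 (hG a) _ (by positivity)
  filter_upwards [hev] with n hn θ
  rw [dist_eq_norm, linForm_sub]
  refine (norm_linForm_le _).trans_lt ?_
  calc ∑ a, |(G₀ θ - G n θ) a|
      ≤ ∑ _a : ParamIdx N d, ε / (Fintype.card (ParamIdx N d) + 1) :=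
        Finset.sum_le_sum fun a _ => (hn a θ).le
    _ = Fintype.card (ParamIdx N d) * (ε / (Fintype.card (ParamIdx N d) + 1)) := by
        simp only [Finset.sum_const, Finset.card_univ, nsmul_eq_mul]
    _ < ε := by
        rw [mul_div_assoc', div_lt_iff₀ hc]
        nlinarith

theorem gradient_eq_of_hasGrad {F : Param N d → ℝ} {G : Param N d → ParamIdx N d → ℝ}
    (h : ∀ θ, HasGrad F (G θ) θ) : gradient F = fun θ => WithLp.toLp 2 (G θ) := by
  funext θ
  exact HasGradientAt.gradient (h θ)

theorem twiceDifferentiable_of_hasGrad {F : Param N d → ℝ} {G : Param N d → ParamIdx N d → ℝ}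
    {H : Param N d → Matrix (ParamIdx N d) (ParamIdx N d) ℝ} (h : ∀ θ, HasGrad F (G θ) θ)
    (h' : ∀ θ a, HasGrad (fun θ => G θ a) (H θ a) θ) :
    TwiceDifferentiable F ∧ (∀ θ a, gradient F θ a = G θ a) ∧
      ∀ θ a b, hessian F θ a b = H θ a b := by
  have hg := gradient_eq_of_hasGrad h
  have hd : Differentiable ℝ (gradient F) := by
    rw [hg, differentiable_euclidean]
    exact fun a θ => (h' θ a).differentiableAt
  refine ⟨⟨fun θ => (h θ).differentiableAt, hd⟩, fun θ a => by rw [hg], fun θ a b => ?_⟩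
  have h1 := ((EuclideanSpace.proj (𝕜 := ℝ) a).hasFDerivAt.comp θ (hd θ).hasFDerivAt).unique
    (f := fun θ => gradient F θ a) (f₁' := linForm (H θ a)) (by
      rw [hg]; exact h' θ a)
  rw [hessian, Matrix.of_apply, ← linForm_single (H θ a) b, ← h1]
  rfl

/-- Cesàro means of a sequence that converges exponentially fast, uniformly in a parameter,
converge uniformly. -/
theorem tendstoUniformly_mean {T : Type*} {a : ℕ → T → ℝ} {a₀ : T → ℝ} {C ρ : ℝ} (hC : 0 ≤ C)
    (hρ0 : 0 ≤ ρ) (hρ1 : ρ < 1) (h : ∀ θ t, |a (t + 1) θ - a₀ θ| ≤ C * ρ ^ (t + 1)) :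
    TendstoUniformly (fun (n : ℕ) θ => 1 / (n : ℝ) * ∑ t ∈ Finset.Icc 1 n, a t θ) a₀ atTop := by
  rw [Metric.tendstoUniformly_iff]
  intro ε hε
  have h1 : ∀ θ t, t ∈ Finset.Icc 1 t → |a t θ - a₀ θ| ≤ C * ρ ^ t := by
    intro θ t ht
    obtain ⟨t, rfl⟩ : ∃ s, t = s + 1 := ⟨t - 1, by have := (Finset.mem_Icc.1 ht).1; omega⟩
    exact h θ t
  have h2 : ∀ θ (n : ℕ), 0 < n →
      |1 / (n : ℝ) * ∑ t ∈ Finset.Icc 1 n, a t θ - a₀ θ| ≤ C * (1 - ρ)⁻¹ / n := by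
    intro θ n hn
    have hn' : (0 : ℝ) < n := by exact_mod_cast hn
    have e : 1 / (n : ℝ) * ∑ t ∈ Finset.Icc 1 n, a t θ - a₀ θ =
        1 / (n : ℝ) * ∑ t ∈ Finset.Icc 1 n, (a t θ - a₀ θ) := by
      rw [Finset.sum_sub_distrib, Finset.sum_const, Nat.card_Icc, add_tsub_cancel_right, mul_sub,
        nsmul_eq_mul, ← mul_assoc, one_div, inv_mul_cancel₀ hn'.ne', one_mul]
    rw [e, abs_mul, abs_of_pos (by positivity), one_div, inv_mul_eq_div]
    refine div_le_div_of_nonneg_right ?_ hn'.le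
    calc |∑ t ∈ Finset.Icc 1 n, (a t θ - a₀ θ)| ≤ ∑ t ∈ Finset.Icc 1 n, C * ρ ^ t :=
          (Finset.abs_sum_le_sum_abs _ _).trans (Finset.sum_le_sum fun t ht =>
            h1 θ t (Finset.mem_Icc.2 ⟨(Finset.mem_Icc.1 ht).1, le_rfl⟩))
      _ = C * ∑ t ∈ Finset.Icc 1 n, ρ ^ t := by rw [Finset.mul_sum]
      _ ≤ C * (1 - ρ)⁻¹ := by
          refine mul_le_mul_of_nonneg_left ?_ hC
          rw [← tsum_geometric_of_lt_one hρ0 hρ1]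
          exact (summable_geometric_of_lt_one hρ0 hρ1).sum_le_tsum _ fun t _ => by positivity
  have h3 : Tendsto (fun n : ℕ => C * (1 - ρ)⁻¹ / (n : ℝ)) atTop (𝓝 0) :=
    tendsto_const_div_atTop_nhds_zero_nat _
  filter_upwards [h3.eventually (gt_mem_nhds hε), eventually_gt_atTop 0] with n hn hn0 θ
  rw [dist_comm, Real.dist_eq]
  exact (h2 θ n hn0).trans_lt hn

/-! ### The integrands are uniformly Lipschitz on the carrier -/

section Integrands

variable {f : Data d dZ → ℝ → ℝ} {Lf : ℝ} {lam : ℝ → ℝ} {D0 D1 D2 r₀ r₁ r₂ : ℝ}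

theorem unifLip_residual (hf_lip : ∀ u u' e, |f u e - f u' e| ≤ Lf * ‖u - u'‖)
    (hf_bdd : ∀ u e, |f u e| ≤ Lf) (hlam : HasBounds lam D0 D1 D2) (hr₀ : 0 ≤ r₀) :
    UnifLip fun (i : Param N d × ℝ) (h : Data d dZ × Hidden N d) =>
      residual f lam i.1 (h.1, clipHidden r₀ r₁ r₂ h.2, i.2) := by
  have hLf : 0 ≤ Lf := (abs_nonneg _).trans (hf_bdd 0 0)
  have hf : UnifLip fun (i : Param N d × ℝ) (h : Data d dZ × Hidden N d) => f h.1 i.2 := by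
    refine ⟨Lf, hLf, fun i h => hf_bdd _ _, fun i h h' => (hf_lip _ _ _).trans ?_⟩
    refine mul_le_mul_of_nonneg_left ?_ hLf
    rw [← dist_eq_norm]
    exact le_max_left _ _
  exact hf.sub ((UnifLip.sum _ fun k => (UnifLip.const fun i => hlam.zero _).mul
    (unifLip_clipHidden_fst hr₀ k)).add (UnifLip.const fun i => hlam.zero _))

theorem unifLip_outGrad (hlam : HasBounds lam D0 D1 D2) (hr₀ : 0 ≤ r₀) (hr₁ : 0 ≤ r₁)
    (a : ParamIdx N d) :
    UnifLip fun (i : Param N d × ℝ) (h : Data d dZ × Hidden N d) =>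
      outGrad lam i.1 (clipHidden r₀ r₁ r₂ h.2) a := by
  rcases a with p | k | _
  · exact UnifLip.sum _ fun k => (UnifLip.const fun i => hlam.zero _).mul
      (unifLip_clipHidden_snd_fst hr₁ p k)
  · exact (UnifLip.const fun i => hlam.one _).mul (unifLip_clipHidden_fst hr₀ k)
  · exact UnifLip.const fun i => hlam.one _

theorem unifLip_outHess (hlam : HasBounds lam D0 D1 D2) (hr₀ : 0 ≤ r₀) (hr₁ : 0 ≤ r₁)
    (hr₂ : 0 ≤ r₂) (a b : ParamIdx N d) :
    UnifLip fun (i : Param N d × ℝ) (h : Data d dZ × Hidden N d) =>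
      outHess lam i.1 (clipHidden r₀ r₁ r₂ h.2) a b := by
  rcases a with p | k | _ <;> rcases b with q | l | _
  · exact UnifLip.sum _ fun k => (UnifLip.const fun i => hlam.zero _).mul
      (unifLip_clipHidden_snd_snd hr₂ p q k)
  · exact (UnifLip.const fun i => hlam.one _).mul (unifLip_clipHidden_snd_fst hr₁ p l)
  · exact UnifLip.zero
  · exact (UnifLip.const fun i => hlam.one _).mul (unifLip_clipHidden_snd_fst hr₁ q k)
  · by_cases hkl : k = l
    · simp only [outHess, hkl, if_true]
      exact (UnifLip.const fun i => hlam.two _).mul (unifLip_clipHidden_fst hr₀ l)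
    · simp only [outHess, hkl, if_false]
      exact UnifLip.zero
  · exact UnifLip.zero
  · exact UnifLip.zero
  · exact UnifLip.zero
  · exact UnifLip.const fun i => hlam.two _

theorem measurable_residual (hf : Measurable (Function.uncurry f)) (θ : Param N d) :
    Measurable (residual (N := N) f lam θ) := by
  have h1 : Measurable fun h : State N d dZ => f h.1 h.2.2 :=
    hf.comp (measurable_fst.prodMk (measurable_snd.comp measurable_snd))
  have h2 : Measurable fun h : State N d dZ => output lam θ h.2.1.1 := by
    unfold output
    fun_prop
  exact h1.sub h2

theorem measurable_outGrad (θ : Param N d) (a : ParamIdx N d) :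
    Measurable fun h : State N d dZ => outGrad lam θ h.2.1 a := by
  rcases a with p | k | _ <;> simp only [outGrad] <;> fun_prop

theorem measurable_outHess (θ : Param N d) (a b : ParamIdx N d) :
    Measurable fun h : State N d dZ => outHess lam θ h.2.1 a b := by
  rcases a with p | k | _ <;> rcases b with q | l | _ <;> simp only [outHess] <;> try fun_prop
  by_cases hkl : k = l <;> simp only [hkl, if_true, if_false] <;> fun_prop

theorem measurable_lossFun (hf : Measurable (Function.uncurry f)) (θ : Param N d) :
    Measurable (lossFun (N := N) f lam θ) :=
  ((measurable_residual hf θ).pow_const 2).const_mul _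

theorem measurable_gFun (hf : Measurable (Function.uncurry f)) (θ : Param N d)
    (a : ParamIdx N d) : Measurable fun h : State N d dZ => gFun f lam θ h a :=
  (measurable_residual hf θ).neg.mul (measurable_outGrad θ a)

theorem measurable_heFun (hf : Measurable (Function.uncurry f)) (θ : Param N d)
    (a b : ParamIdx N d) : Measurable fun h : State N d dZ => heFun f lam θ h a b :=
  ((measurable_outGrad θ a).mul (measurable_outGrad θ b)).sub
    ((measurable_residual hf θ).mul (measurable_outHess θ a b))

theorem unifLip_lossFun (hf_lip : ∀ u u' e, |f u e - f u' e| ≤ Lf * ‖u - u'‖)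
    (hf_bdd : ∀ u e, |f u e| ≤ Lf) (hlam : HasBounds lam D0 D1 D2) (hr₀ : 0 ≤ r₀) :
    UnifLip fun (i : Param N d × ℝ) (h : Data d dZ × Hidden N d) =>
      lossFun f lam i.1 (h.1, clipHidden r₀ r₁ r₂ h.2, i.2) := by
  have h := unifLip_residual (N := N) (r₁ := r₁) (r₂ := r₂) hf_lip hf_bdd hlam hr₀
  simp only [lossFun, sq]
  exact (UnifLip.const fun _ => le_rfl).mul (h.mul h)

theorem unifLip_gFun (hf_lip : ∀ u u' e, |f u e - f u' e| ≤ Lf * ‖u - u'‖)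
    (hf_bdd : ∀ u e, |f u e| ≤ Lf) (hlam : HasBounds lam D0 D1 D2) (hr₀ : 0 ≤ r₀) (hr₁ : 0 ≤ r₁)
    (a : ParamIdx N d) :
    UnifLip fun (i : Param N d × ℝ) (h : Data d dZ × Hidden N d) =>
      gFun f lam i.1 (h.1, clipHidden r₀ r₁ r₂ h.2, i.2) a :=
  (unifLip_residual hf_lip hf_bdd hlam hr₀).neg.mul (unifLip_outGrad hlam hr₀ hr₁ a)

theorem unifLip_heFun (hf_lip : ∀ u u' e, |f u e - f u' e| ≤ Lf * ‖u - u'‖)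
    (hf_bdd : ∀ u e, |f u e| ≤ Lf) (hlam : HasBounds lam D0 D1 D2) (hr₀ : 0 ≤ r₀) (hr₁ : 0 ≤ r₁)
    (hr₂ : 0 ≤ r₂) (a b : ParamIdx N d) :
    UnifLip fun (i : Param N d × ℝ) (h : Data d dZ × Hidden N d) =>
      heFun f lam i.1 (h.1, clipHidden r₀ r₁ r₂ h.2, i.2) a b :=
  ((unifLip_outGrad hlam hr₀ hr₁ a).mul (unifLip_outGrad hlam hr₀ hr₁ b)).sub
    ((unifLip_residual hf_lip hf_bdd hlam hr₀).mul (unifLip_outHess hlam hr₀ hr₁ hr₂ a b))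

end Integrands

/-! ### Expectations along the chain and their time averages -/

namespace IsModel

variable {Ω : Type*} [MeasurableSpace Ω] {P : Measure Ω}
  {κ : Kernel (Data d dZ) (Data d dZ)} {U : ℕ → Ω → Data d dZ} {μη : Measure ℝ}
  {η : ℕ → Ω → ℝ} {Lw : ℝ} {φ : ℝ → ℝ} {C1 C2 : ℝ} {G : Param N d → State N d dZ → ℝ}

/-- Families with a common Lipschitz constant after truncation, uniformly in the parameter and the
noise, are bounded along the chain, since truncation does not affect it. -/
theorem exists_ae_bound (hM : IsModel P κ U μη η Lw φ C1 C2) (s₀ : Fin N → ℝ)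
    (hGl : UnifLip fun (i : Param N d × ℝ) (h : Data d dZ × Hidden N d) =>
      G i.1 (h.1, clipHidden (radius₀ s₀) (radius₁ C1 s₀) (radius₂ C1 C2 s₀) h.2, i.2)) :
    ∃ c, 0 ≤ c ∧ ∀ᵐ ω ∂P, ∀ θ t, |G θ (stateAt φ θ s₀ U η t ω)| ≤ c := by
  obtain ⟨c, hc, hb, -⟩ := hGl
  refine ⟨c, hc, (hM.ae_stateAt_mem s₀).mono fun ω hω θ t => ?_⟩
  obtain ⟨-, h0, h1, h2⟩ := hω θ t
  have := hb (θ, (stateAt φ θ s₀ U η t ω).2.2)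
    ((stateAt φ θ s₀ U η t ω).1, (stateAt φ θ s₀ U η t ω).2.1)
  beta_reduce at this
  rwa [clipHidden_eq h0 h1 h2] at this

/-- Differentiation with respect to the parameter commutes with the expectation along the chain. -/
theorem hasGrad_integral_stateAt [IsProbabilityMeasure P] (hM : IsModel P κ U μη η Lw φ C1 C2)
    (s₀ : Fin N → ℝ) {H : Param N d → State N d dZ → ParamIdx N d → ℝ}
    (hG : ∀ θ, Measurable (G θ)) (hH : ∀ θ a, Measurable fun h => H θ h a)
    (hGl : UnifLip fun (i : Param N d × ℝ) (h : Data d dZ × Hidden N d) =>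
      G i.1 (h.1, clipHidden (radius₀ s₀) (radius₁ C1 s₀) (radius₂ C1 C2 s₀) h.2, i.2))
    (hHl : ∀ a, UnifLip fun (i : Param N d × ℝ) (h : Data d dZ × Hidden N d) =>
      H i.1 (h.1, clipHidden (radius₀ s₀) (radius₁ C1 s₀) (radius₂ C1 C2 s₀) h.2, i.2) a)
    (hGH : ∀ (u : Data d dZ) (x : ℕ → Fin d → ℝ) (t : ℕ) (e : ℝ) (θ : Param N d),
      HasGrad (fun θ => G θ (u, hiddenPath φ θ s₀ x t, e)) (H θ (u, hiddenPath φ θ s₀ x t, e)) θ)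
    (t : ℕ) (θ : Param N d) :
    HasGrad (fun θ => ∫ ω, G θ (stateAt φ θ s₀ U η t ω) ∂P)
      (fun a => ∫ ω, H θ (stateAt φ θ s₀ U η t ω) a ∂P) θ := by
  have hm := fun θ : Param N d =>
    measurable_stateAt φ θ s₀ hM.measurable_data hM.measurable_noise t
  obtain ⟨b, -, hb⟩ := hM.exists_ae_bound s₀ hGl
  choose c hc0 hc using fun a => hM.exists_ae_bound (G := fun θ h => H θ h a) s₀ (hHl a)
  refine hasGrad_integral (F := fun θ ω => G θ (stateAt φ θ s₀ U η t ω))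
    (G := fun θ ω => H θ (stateAt φ θ s₀ U η t ω)) (b := b) (c := ∑ a, c a)
    (fun θ => (hG θ).comp (hm θ)) (fun θ a => (hH θ a).comp (hm θ)) (hb.mono fun ω hω θ => hω θ t)
    ?_ (fun ω θ => hGH (U t ω) _ t (η t ω) θ) θ
  filter_upwards [ae_all_iff.2 hc] with ω hω θ a
  exact (hω a θ t).trans (Finset.single_le_sum (f := c) (fun a _ => hc0 a) (Finset.mem_univ a))

/-- The ergodic theorem used for the loss, its gradient and its Hessian: the time averages of the
expectations along the chain converge to the stationary expectation, uniformly in the parameter. -/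
theorem exists_tendstoUniformly_mean [IsProbabilityMeasure P] [IsMarkovKernel κ]
    (hM : IsModel P κ U μη η Lw φ C1 C2) (s₀ : Fin N → ℝ)
    {μ : Param N d → Measure (State N d dZ)} (hμ : ∀ θ, IsUniqueStationary φ κ μη θ (μ θ))
    (hG : ∀ θ, Measurable (G θ))
    (hGl : UnifLip fun (i : Param N d × ℝ) (h : Data d dZ × Hidden N d) =>
      G i.1 (h.1, clipHidden (radius₀ s₀) (radius₁ C1 s₀) (radius₂ C1 C2 s₀) h.2, i.2)) :
    ∃ C, 0 ≤ C ∧ (∀ θ, Integrable (G θ) (μ θ)) ∧ (∀ θ, |∫ h, G θ h ∂(μ θ)| ≤ C) ∧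
      TendstoUniformly (fun (n : ℕ) θ =>
          1 / (n : ℝ) * ∑ t ∈ Finset.Icc 1 n, ∫ ω, G θ (stateAt φ θ s₀ U η t ω) ∂P)
        (fun θ => ∫ h, G θ h ∂(μ θ)) atTop := by
  obtain ⟨C, ρ, hC, hρ0, hρ1, hi, hb, h⟩ := hM.exists_integral_sub_le s₀ hμ hG hGl
  exact ⟨C, hC, hi, hb, tendstoUniformly_mean hC hρ0 hρ1 h⟩

theorem expLoss_eq [IsProbabilityMeasure P] (hM : IsModel P κ U μη η Lw φ C1 C2)
    (s₀ : Fin N → ℝ) {f : Data d dZ → ℝ → ℝ} (hf : Measurable (Function.uncurry f)) {lam : ℝ → ℝ}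
    (hGl : UnifLip fun (i : Param N d × ℝ) (h : Data d dZ × Hidden N d) =>
      lossFun f lam i.1 (h.1, clipHidden (radius₀ s₀) (radius₁ C1 s₀) (radius₂ C1 C2 s₀) h.2, i.2))
    (T : ℕ) :
    expLoss P U η f φ lam s₀ T = fun θ : Param N d => 1 / (T : ℝ) *
      ∑ t ∈ Finset.Icc 1 T, ∫ ω, lossFun f lam θ (stateAt φ θ s₀ U η t ω) ∂P := by
  funext θ
  obtain ⟨c, -, hc⟩ := hM.exists_ae_bound s₀ hGl
  have hi : ∀ t ∈ Finset.Icc 1 T,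
      Integrable (fun ω => lossFun f lam θ (stateAt φ θ s₀ U η t ω)) P := fun t _ =>
    Integrable.of_bound ((measurable_lossFun hf θ).comp
      (measurable_stateAt φ θ s₀ hM.measurable_data hM.measurable_noise t)).aestronglyMeasurable c
      (hc.mono fun ω hω => hω θ t)
  rw [← integral_finsetSum _ hi, ← integral_const_mul]
  refine integral_congr_ae (Eventually.of_forall fun ω => ?_)
  simp only [empLoss, Finset.mul_sum]
  refine Finset.sum_congr rfl fun t _ => ?_
  rw [lossFun, residual, stateAt, hiddenPath_fst, one_div_mul_eq_div, one_div_mul_eq_div,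
    one_div_mul_eq_div, div_div]

end IsModel

/-- The smallness condition bounds `φ`, hence the means `1 / N * ∑ φ(W) ·`, by a constant below
`1`. -/
theorem lt_one_of_constQ_lt_one {C0 C1 C2 Lw : ℝ} (h : constQ N d C0 C1 C2 Lw < 1) : C0 < 1 := by
  have h0 : C0 ≤ max (constL0 N d C0 C1) (constL1 N d C0 C1 C2) :=
    (le_max_right _ _).trans (le_max_right _ _)
  refine h0.trans_lt (lt_of_le_of_lt ?_ h)
  exact Real.le_sqrt_of_sq_le (le_add_of_nonneg_right (sq_nonneg _))

end RTRL

end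

theorem mainTheorem3
    {N d dZ : ℕ} (hN : 0 < N) (hd : 0 < d)
    -- the data: a Markov chain `U t = (X_t, Z_t)` and i.i.d. noises `η t`, independent of it
    {Ω : Type*} [MeasurableSpace Ω] (P : Measure Ω) [IsProbabilityMeasure P]
    (κ : Kernel (Data d dZ) (Data d dZ)) [IsMarkovKernel κ]
    (U : ℕ → Ω → Data d dZ) (hU : ∀ t, Measurable (U t)) (hMarkov : IsMarkovChain U κ P)
    (μη : Measure ℝ) (η : ℕ → Ω → ℝ) (hη : ∀ t, Measurable (η t))
    (hη_law : ∀ t, P.map (η t) = μη) (hη_indep : iIndepFun η P)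
    (hηU : IndepFun (fun ω t => η t ω) (fun ω t => U t ω) P)
    -- the transition kernel is a contraction, the data are bounded
    (Lw : ℝ) (hLw0 : 0 ≤ Lw) (hLw1 : Lw < 1)
    (hκ : ∀ u u' : Data d dZ, wass 2 (κ u) (κ u') ≤ ENNReal.ofReal (Lw * ‖u - u'‖))
    (hU_bdd : ∀ t, ∀ᵐ ω ∂P, ‖U t ω‖ ≤ 1)
    -- the output function
    (f : Data d dZ → ℝ → ℝ) (hf_meas : Measurable (Function.uncurry f)) (Lf : ℝ)
    (hf_lip : ∀ u u' e, |f u e - f u' e| ≤ Lf * ‖u - u'‖) (hf_bdd : ∀ u e, |f u e| ≤ Lf)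
    -- the functions `φ` and `λ`
    (φ lam : ℝ → ℝ) (hφ : ContDiff ℝ 2 φ) (hlam : ContDiff ℝ 2 lam)
    (C0 C1 C2 : ℝ) (hC0 : ∀ r, |φ r| ≤ C0) (hC1 : ∀ r, |deriv φ r| ≤ C1)
    (hC2 : ∀ r, |deriv (deriv φ) r| ≤ C2)
    (D0 D1 D2 : ℝ) (hD0 : ∀ r, |lam r| ≤ D0) (hD1 : ∀ r, |deriv lam r| ≤ D1)
    (hD2 : ∀ r, |deriv (deriv lam) r| ≤ D2)
    (hq0 : 0 < constQ N d C0 C1 C2 Lw) (hq1 : constQ N d C0 C1 C2 Lw < 1)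
    -- the initial value of the memory layer
    (s₀ : Fin N → ℝ) :
    ∃ (μ : Param N d → Measure (State N d dZ)) (L : Param N d → ℝ),
      -- `μ θ` is the unique stationary distribution
      (∀ θ, IsUniqueStationary φ κ μη θ (μ θ)) ∧
      -- `L` is the stationary loss
      (∀ θ, Tendsto (fun T => expLoss P U η f φ lam s₀ T θ) atTop (𝓝 (L θ))) ∧
      (∀ θ, Integrable (lossFun f lam θ) (μ θ) ∧ L θ = ∫ h, lossFun f lam θ h ∂(μ θ)) ∧
      -- twice differentiability
      (∀ T, TwiceDifferentiable (expLoss P U η f φ lam s₀ T)) ∧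
      TwiceDifferentiable L ∧
      -- the gradient and the Hessian of `L` are stationary expectations
      (∀ θ a, Integrable (fun h => gFun f lam θ h a) (μ θ) ∧
        gradient L θ a = ∫ h, gFun f lam θ h a ∂(μ θ)) ∧
      (∀ θ a b, Integrable (fun h => heFun f lam θ h a b) (μ θ) ∧
        hessian L θ a b = ∫ h, heFun f lam θ h a b ∂(μ θ)) ∧
      -- they are the limits, uniform in `θ`, of those of the expected losses
      (∀ a, TendstoUniformly (fun T θ => gradient (expLoss P U η f φ lam s₀ T) θ a)
        (fun θ => gradient L θ a) atTop) ∧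
      (∀ a b, TendstoUniformly (fun T θ => hessian (expLoss P U η f φ lam s₀ T) θ a b)
        (fun θ => hessian L θ a b) atTop) ∧
      -- they are bounded
      ∃ C : ℝ, 0 < C ∧ ∀ θ, (∀ a, |gradient L θ a| ≤ C) ∧ ∀ a b, |hessian L θ a b| ≤ C := by
  have hHφ : HasBounds φ 1 C1 C2 :=
    ⟨fun r => (hC0 r).trans (lt_one_of_constQ_lt_one hq1).le, hC1, hC2⟩
  have hHlam : HasBounds lam D0 D1 D2 := ⟨hD0, hD1, hD2⟩
  have hM : IsModel P κ U μη η Lw φ C1 C2 :=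
    ⟨hU, hMarkov, hη, hη_law, hηU, hLw0, hLw1, hκ, hU_bdd, hHφ⟩
  have hr₀ : 0 ≤ radius₀ s₀ := zero_le_one.trans (one_le_radius₀ s₀)
  have hr₁ := radius₁_nonneg s₀ hHφ
  have hr₂ := radius₂_nonneg s₀ hHφ
  have hld : Differentiable ℝ lam := hlam.differentiable (by norm_num)
  have hld' : Differentiable ℝ (deriv lam) :=
    (contDiff_succ_iff_deriv.1 (show ContDiff ℝ (1 + 1) lam by
      rw [one_add_one_eq_two]; exact hlam)).2.2.differentiable (by norm_num)
  choose μ hμ using fun θ : Param N d => hM.exists_isUniqueStationary s₀ θ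
  -- the three integrands are measurable, and uniformly Lipschitz on the carrier
  have ml := fun θ : Param N d => measurable_lossFun (lam := lam) hf_meas θ
  have mg := fun (a : ParamIdx N d) θ => measurable_gFun (lam := lam) hf_meas θ a
  have mh := fun (a b : ParamIdx N d) θ => measurable_heFun (lam := lam) hf_meas θ a b
  have ul := unifLip_lossFun (N := N) (r₁ := radius₁ C1 s₀) (r₂ := radius₂ C1 C2 s₀)
    hf_lip hf_bdd hHlam hr₀
  have ug := unifLip_gFun (N := N) (r₂ := radius₂ C1 C2 s₀) hf_lip hf_bdd hHlam hr₀ hr₁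
  have uh := unifLip_heFun (N := N) hf_lip hf_bdd hHlam hr₀ hr₁ hr₂
  obtain ⟨-, -, il, -, tl⟩ := hM.exists_tendstoUniformly_mean s₀ hμ ml ul
  choose Cg hCg ig bg tg using fun a => hM.exists_tendstoUniformly_mean
    (G := fun θ h => gFun f lam θ h a) s₀ hμ (mg a) (ug a)
  choose Ch hCh ih bh th using
    fun a b => hM.exists_tendstoUniformly_mean
      (G := fun θ h => heFun f lam θ h a b) s₀ hμ (mh a b) (uh a b)
  -- the derivatives of the expected losses
  have hv := fun x t θ => hasForwardDerivs_hiddenPath (N := N) (d := d) hφ s₀ x t θ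
  have dl := hM.hasGrad_integral_stateAt s₀ ml (fun θ a => mg a θ) ul ug
    fun u x t e θ => hasGrad_lossFun f u e hld (hv x t θ)
  have dg := fun a => hM.hasGrad_integral_stateAt
    (G := fun θ h => gFun f lam θ h a) s₀ (mg a) (fun θ b => mh a b θ) (ug a) (uh a)
    fun u x t e θ => hasGrad_gFun f u e hld hld' (hv x t θ) a
  have dlT := fun (T : ℕ) (θ : Param N d) =>
    (HasGrad.sum (Finset.Icc 1 T) fun t => dl t θ).const_mul (1 / (T : ℝ))
  have dgT := fun (T : ℕ) (θ : Param N d) (a : ParamIdx N d) =>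
    (HasGrad.sum (Finset.Icc 1 T) fun t => dg a t θ).const_mul (1 / (T : ℝ))
  have hT := fun T => twiceDifferentiable_of_hasGrad (dlT T) (dgT T)
  simp only [← hM.expLoss_eq s₀ hf_meas ul] at hT
  -- the derivatives of the stationary loss
  have hL := twiceDifferentiable_of_hasGrad
    (hasGrad_of_tendstoUniformly dlT (fun θ => tl.tendsto_at θ) tg)
    fun θ a => hasGrad_of_tendstoUniformly (fun T θ => dgT T θ a)
      (fun θ => (tg a).tendsto_at θ) (th a) θ
  refine ⟨μ, fun θ => ∫ h, lossFun f lam θ h ∂(μ θ), hμ, fun θ => ?_, fun θ => ⟨il θ, rfl⟩,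
    fun T => (hT T).1, hL.1, fun θ a => ⟨ig a θ, hL.2.1 θ a⟩, fun θ a b => ⟨ih a b θ, hL.2.2 θ a b⟩,
    fun a => ?_, fun a b => ?_, 1 + (∑ a, Cg a + ∑ a, ∑ b, Ch a b), ?_, fun θ => ⟨fun a => ?_,
      fun a b => ?_⟩⟩
  · simp only [hM.expLoss_eq s₀ hf_meas ul]
    exact tl.tendsto_at θ
  · simp only [(hT _).2.1, hL.2.1]
    exact tg a
  · simp only [(hT _).2.2, hL.2.2]
    exact th a b
  all_goals
    have s1 : 0 ≤ ∑ a, Cg a := Finset.sum_nonneg fun a _ => hCg a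
    have s2 : 0 ≤ ∑ a, ∑ b, Ch a b :=
      Finset.sum_nonneg fun a _ => Finset.sum_nonneg fun b _ => hCh a b
  · linarith
  · rw [hL.2.1]
    have := Finset.single_le_sum (f := Cg) (fun a _ => hCg a) (Finset.mem_univ a)
    linarith [bg a θ]
  · rw [hL.2.2]
    have h1 := Finset.single_le_sum (f := Ch a) (fun b _ => hCh a b) (Finset.mem_univ b)
    have h2 := Finset.single_le_sum (f := fun a => ∑ b, Ch a b)
      (fun a _ => Finset.sum_nonneg fun b _ => hCh a b) (Finset.mem_univ a)
    linarith [bh a b θ]
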